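/- **Random split trees.** Fix a branch factor $b\ge 2$, a capacity $s\ge 1$, ball distribution parameters $s_0,s_1\in\mathbb{N}_0$ with $s_0\le s$ and $s_0+bs_1\le s+1$, and a random split vector $\mathcal V=(V_1,\dots,V_b)$ with $V_j\ge 0$ and $\sum_j V_j=1$ almost surely. Give each vertex $u$ of the infinite rooted $b$-ary tree an independent copy $\mathcal V_u$ of $\mathcal V$. The random split tree $\mathcal T_n$ storing $n$ items is obtained by letting the root receive $n$ items and proceeding recursively: a vertex $u$ that receives $m\le s$ items stores all of them (and its children receive none); a vertex $u$ that receives $m>s$ items stores $s_0$ of them, passes $s_1$ of them to each of its $b$ children, and passes each of the remaining $m-s_0-bs_1$ items to one of its children, where, given $\mathcal V_u$, the children are chosen independently, the $i$-th one with probability given by the $i$-th entry of $\mathcal V_u$ (and all these choices are independent over the vertices). Let $X_n=\Psi(\mathcal T_n)$ be the total path length, that is, the sum over the $n$ items of the distance from the root to the vertex that stores the item. Let $\mu:=-\mathbb E\big[\sum_{j=1}^b V_j\ln V_j\big]$ (with $0\ln 0:=0$) and $C(\mathcal V):=1+\frac1\mu\sum_{j=1}^b V_j\ln V_j$. **Theorem.**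 Suppose that there are $\lambda,\nu>0$ such that $$\mathbb P\big(\max_j V_j\ge 1-x\big)\le\lambda x^\nu\quad\text{for all }x\ge 0$$ (in particular $\mathbb P(\max_j V_j=1)=0$, so $\mu>0$), and that $\mathbb P(C(\mathcal V)\ne 0)>0$. Then $\mathbb E[X_n]<\infty$ for all $n$, the normalized total path length $(X_n-\mathbb E[X_n])/n$ converges in distribution, as $n\to\infty$, to a real random variable $X$, and $X$ admits a Schwartz density, i.e. the law of $X$ has a Lebesgue density $f\in\mathcal C^\infty(\mathbb R)$ with $\sup_{x}|x|^\alpha|f^{(\beta)}(x)|<\infty$ for all $\alpha,\beta\in\mathbb N_0$. -/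

import Mathlib

open MeasureTheory ProbabilityTheory Filter

noncomputable section

namespace SplitTree

/-- The entropy `μ = -E[V₁ ln V₁ + ⋯ + V_b ln V_b]` of a random split vector with law `σ`
(where `0 ln 0 = 0`). -/
def entropy {b : ℕ} (σ : Measure (Fin b → ℝ)) : ℝ :=
  -∫ v, ∑ j, v j * Real.log (v j) ∂σ

/-- The function `C(v) = 1 + μ⁻¹ ∑ⱼ vⱼ ln vⱼ`. -/
def toll {b : ℕ} (μ : ℝ) (v : Fin b → ℝ) : ℝ :=
  1 + 1 / μ * ∑ j, v j * Real.log (v j)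

/-- Vertices of the infinite rooted `b`-ary tree. The root is `[]` and the `i`-th child of `u` is
`i :: u`, so the distance of `u` to the root is `u.length`. -/
abbrev Vertex (b : ℕ) : Type := List (Fin b)

/-- The randomness at the vertices: a split vector and a sequence of numbers in `[0, 1)`, the
`k`-th of which decides to which child the `k`-th item that is passed on at random goes. -/
abbrev Env (b : ℕ) : Type := Vertex b → (Fin b → ℝ) × (ℕ → ℝ)

/-- The uniform distribution on `[0, 1)`. -/
def uniformLaw : Measure ℝ := (volume : Measure ℝ).restrict (Set.Ico 0 1)

instance : IsProbabilityMeasure uniformLaw :=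
  ⟨by simp [uniformLaw]⟩

/-- The law of the environment when split vectors have law `σ`: all split vectors are independent
with law `σ`, and all the numbers are uniform on `[0, 1)`, independent of each other and of the
split vectors. -/
def envLaw {b : ℕ} (σ : Measure (Fin b → ℝ)) : Measure (Env b) :=
  Measure.infinitePi fun _ : Vertex b => σ.prod (Measure.infinitePi fun _ : ℕ => uniformLaw)

instance {b : ℕ} (σ : Measure (Fin b → ℝ)) [IsProbabilityMeasure σ] :
    IsProbabilityMeasure (envLaw σ) := by
  unfold envLaw
  infer_instance

/-- An item with the number `x` goes to child `i`. If `v` is a probability vector and `x` is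
uniform on `[0, 1)`, this happens for exactly one `i`, and for a given `i` with probability
`v i`. -/
def GoesTo {b : ℕ} (v : Fin b → ℝ) (x : ℝ) (i : Fin b) : Prop :=
  ∑ j ∈ Finset.Iio i, v j ≤ x ∧ x < ∑ j ∈ Finset.Iic i, v j

open Classical in
/-- The number of items in the subtree of the `i`-th child of a vertex whose own subtree contains
`m` items. If `m ≤ s`, the vertex is a leaf and keeps all its items. Otherwise it keeps `s₀` items,
passes `s₁` items to each of its `b` children, and passes each of the remaining
`m - s₀ - b * s₁` items to a random child, drawn according to the split vector `v`. -/
def childCount (b s s₀ s₁ : ℕ) (v : Fin b → ℝ) (x : ℕ → ℝ) (m : ℕ) (i : Fin b) : ℕ :=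
  if m ≤ s then 0
  else s₁ + ((Finset.range (m - s₀ - b * s₁)).filter fun k => GoesTo v (x k) i).card

/-- The number of items stored in the subtree of `u`, in the random split tree with branch factor
`b`, capacity `s` and ball distribution parameters `(s₀, s₁)` storing `n` items. The vertices of
the split tree are those `u` for which this number is positive (and the root).

This is also the number that results from inserting `n` items one by one: a leaf holding fewer
than `s` items takes a new item; a full leaf that gets another item keeps `s₀` of the `s + 1` items
and passes on the others as in `childCount`; an internal vertex passes a new item on to a child
drawn according to its split vector. -/
def subtreeCount (b s s₀ s₁ n : ℕ) (e : Env b) : Vertex b → ℕ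
  | [] => n
  | i :: u => childCount b s s₀ s₁ (e u).1 (e u).2 (subtreeCount b s s₀ s₁ n e u) i

/-- The number of items stored at the vertex `u` itself. -/
def itemCount (b s s₀ s₁ n : ℕ) (e : Env b) (u : Vertex b) : ℕ :=
  if subtreeCount b s s₀ s₁ n e u ≤ s then subtreeCount b s s₀ s₁ n e u else s₀

/-- The total path length with respect to the data, `Ψ = ∑ (depth of the item)` over all items,
as an extended non-negative number. -/
def pathLength (b s s₀ s₁ n : ℕ) (e : Env b) : ENNReal :=
  ∑' u : Vertex b, (u.length : ENNReal) * (itemCount b s s₀ s₁ n e u : ENNReal)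

/-- The normalized total path length `(Xₙ - E[Xₙ]) / n`, where `Xₙ` is the total path length of the
random split tree storing `n` items and `σ` is the law of the split vector. -/
def normalizedPathLength (b s s₀ s₁ : ℕ) (σ : Measure (Fin b → ℝ)) (n : ℕ) (e : Env b) : ℝ :=
  ((pathLength b s s₀ s₁ n e).toReal - ∫ e', (pathLength b s s₀ s₁ n e').toReal ∂envLaw σ) / n

/-- A real random variable admits a Schwartz density. -/
def AdmitsSchwartzDensity {Ω : Type*} [MeasurableSpace Ω] (P : Measure Ω) (X : Ω → ℝ) : Prop :=
  ∃ f : SchwartzMap ℝ ℝ, (∀ x, 0 ≤ f x) ∧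
    P.map X = (volume : Measure ℝ).withDensity fun x => ENNReal.ofReal (f x)

end SplitTree

end

set_option linter.unusedSectionVars false

/-! Given the randomness at the root, `X_n = n - s₀ + ∑_j X^{(j)}_{N_j}`, with independent copies in
the subtrees and child counts `N_j = n V_j + O(√n)` in mean square. Centring and dividing by `n`
suggests the limit equation `X = C(V) + ∑_j V_j X^{(j)}`. Three facts carry the theorem: the
rescaled centred tolls converge in `L²` to `C(V)`, the recursion contracts in `L²`, and the
characteristic function of the fixed point decays rapidly. Everything lives on the space of
environments, which `join` decomposes into a root and `b` independent copies of itself. The limit is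
a function of the same randomness as the trees, and the convergence proved is in `L²`.

Contraction. The constant is `κ = E ∑ V_j² < 1`. A child may inherit all `n` items, so recursions
over child counts are not well founded in `n`. Induction is replaced by `Setting.max_principle`,
applied to differences with explicit barrier functions. It yields conservation of items, logarithmic
increments of the mean, a linear bound on the second order term, and the vanishing of the `L²`
distance to the limit.

Tolls. Write `E X_n = n log n / μ + r(n)`. The entropy term produces `n C(V)`, so it remains to see
that `∑_j r(N_j) - r(n)` is `o(n)` in `L²`. Convergence of `r(n)/n` is not needed, and no
distinction between lattice and non-lattice split laws arises. The function `h(x) = r(⌊x⌋)/x` is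
bounded (`Setting.exists_linear_bound_meanRest`) and asymptotically harmonic for the multiplicative
random walk whose step is a size-biased entry of `V`. The asymptotic Choquet–Deny argument
`tendsto_scaleVar_of_asymptotically_harmonic` shows that `h` hardly changes along a step in mean
square, and this is what the tolls require.

Density. Iterating the fixed point equation from `0` gives `X`, with exponential moments near the
origin. The modulus `φ` of its characteristic function satisfies `φ(t) ≤ E ∏_j φ(t V_j)`. Since
`C(V)` is not almost surely zero, `X` has positive variance, so `φ < 1` near but off the origin; the
inequality propagates this to a bound away from `1`. Except with probability `O(ε^ν)`, two entries
of `V` are at least `ε`, so the decreasing majorant `ψ` of `φ` satisfies `ψ(t) ≤ ψ(εt)² + Λ ε^ν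
ψ(t/b)`. This bootstraps to decay faster than every power. Together with the moments it makes the
characteristic function Schwartz, and Fourier inversion gives the density. -/

noncomputable section

namespace SplitTree

/-! ### Schwartz densities from moments and rapid decay of the characteristic function. -/

section SchwartzDensity

open Complex FourierTransform Real

/-- If `f` decays rapidly and its second derivative is bounded, then its first derivative decays
rapidly. -/
theorem rapid_decay_deriv {f : ℝ → ℂ} (hf : Differentiable ℝ f) (hf' : Differentiable ℝ (deriv f))
    {B : ℝ} (hB : ∀ t, ‖deriv (deriv f) t‖ ≤ B)
    (hdec : ∀ k : ℕ, ∃ C, ∀ t, (1 + |t|) ^ k * ‖f t‖ ≤ C) (k : ℕ) :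
    ∃ C, ∀ t, (1 + |t|) ^ k * ‖deriv f t‖ ≤ C := by
  obtain ⟨C, hC⟩ := hdec (2 * k)
  refine ⟨2 ^ (2 * k) * C + C + B, fun t => ?_⟩
  have hB0 : 0 ≤ B := (norm_nonneg _).trans (hB 0)
  set w : ℝ := 1 + |t| with hw
  have hw1 : 1 ≤ w := by simp [hw]
  have hwk : 1 ≤ w ^ k := one_le_pow₀ hw1
  -- Taylor's formula gives `h |f'(t)| ≤ |f(t+h)| + |f(t)| + B h²`. With this step size,
  -- multiplication by `w ^ (2k)` turns the left side into `w ^ k |f'(t)|` and the remainder into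
  -- exactly `B`, while the values of `f` are absorbed by decay of order `2k`.
  set h : ℝ := 1 / w ^ k with hh
  have hh0 : 0 < h := by positivity
  have hh1 : h ≤ 1 := by rw [hh, div_le_one (by positivity)]; exact hwk
  have hwh : w ^ k * h = 1 := by rw [hh]; field_simp
  have hlip : ∀ s ∈ Set.Icc t (t + h), ‖deriv f s - deriv f t‖ ≤ B * h := by
    intro s hs
    have := (convex_univ (𝕜 := ℝ) (E := ℝ)).norm_image_sub_le_of_norm_deriv_le (f := deriv f)
      (fun x _ => hf' x) (fun x _ => hB x) (Set.mem_univ t) (Set.mem_univ s)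
    refine this.trans ?_
    gcongr
    rw [Real.norm_eq_abs, abs_le]
    constructor <;> linarith [hs.1, hs.2]
  have hT : ‖f (t + h) - f t - h • deriv f t‖ ≤ B * h * h := by
    have hg : ∀ s ∈ Set.Icc t (t + h),
        HasDerivWithinAt (fun s => f s - s • deriv f t) (deriv f s - (1 : ℝ) • deriv f t)
          (Set.Icc t (t + h)) s := fun s _ =>
      (((hf s).hasDerivAt).sub ((hasDerivAt_id s).smul_const (deriv f t))).hasDerivWithinAt
    have := (convex_Icc t (t + h)).norm_image_sub_le_of_norm_hasDerivWithin_le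
      (C := B * h) hg (fun s hs => by simpa using hlip s hs)
      (Set.left_mem_Icc.2 (by linarith)) (Set.right_mem_Icc.2 (by linarith))
    calc ‖f (t + h) - f t - h • deriv f t‖
        = ‖(f (t + h) - (t + h) • deriv f t) - (f t - t • deriv f t)‖ := by
          congr 1; rw [add_smul]; ring
      _ ≤ B * h * ‖t + h - t‖ := this
      _ = B * h * h := by rw [add_sub_cancel_left, Real.norm_of_nonneg hh0.le]
  have h1 : h * ‖deriv f t‖ ≤ ‖f (t + h)‖ + ‖f t‖ + B * h * h := by
    calc h * ‖deriv f t‖ = ‖h • deriv f t‖ := by rw [norm_smul, Real.norm_of_nonneg hh0.le]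
      _ = ‖f (t + h) - f t - (f (t + h) - f t - h • deriv f t)‖ := by congr 1; ring
      _ ≤ ‖f (t + h) - f t‖ + ‖f (t + h) - f t - h • deriv f t‖ := norm_sub_le _ _
      _ ≤ _ := add_le_add (norm_sub_le _ _) hT
  have hwt : w ≤ 2 * (1 + |t + h|) := by
    have : |t| ≤ |t + h| + |h| := by
      calc |t| = |(t + h) - h| := by ring_nf
        _ ≤ _ := abs_sub _ _
    rw [abs_of_pos hh0] at this
    rw [hw]; nlinarith [abs_nonneg (t + h)]
  have h2 : w ^ (2 * k) * ‖f (t + h)‖ ≤ 2 ^ (2 * k) * C := by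
    calc w ^ (2 * k) * ‖f (t + h)‖ ≤ (2 * (1 + |t + h|)) ^ (2 * k) * ‖f (t + h)‖ := by gcongr
      _ = 2 ^ (2 * k) * ((1 + |t + h|) ^ (2 * k) * ‖f (t + h)‖) := by rw [mul_pow]; ring
      _ ≤ _ := by gcongr; exact hC _
  calc w ^ k * ‖deriv f t‖ = w ^ k * (w ^ k * (h * ‖deriv f t‖)) := by
        rw [← mul_assoc (w ^ k) h, hwh, one_mul]
    _ ≤ w ^ k * (w ^ k * (‖f (t + h)‖ + ‖f t‖ + B * h * h)) := by gcongr
    _ = w ^ (2 * k) * ‖f (t + h)‖ + w ^ (2 * k) * ‖f t‖ + B * (w ^ k * h) * (w ^ k * h) := by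
        rw [two_mul, pow_add]; ring
    _ ≤ _ := by rw [hwh]; have := hC t; linarith

/-- The characteristic function of a law with all moments, if rapidly decaying, is a Schwartz
function. -/
theorem charFun_rapid_decay_iteratedDeriv {ρ : Measure ℝ} [IsProbabilityMeasure ρ]
    (hmom : ∀ k : ℕ, MemLp id k ρ)
    (hdec : ∀ k : ℕ, ∃ C, ∀ t, (1 + |t|) ^ k * ‖charFun ρ t‖ ≤ C) (n : ℕ) :
    ∀ k : ℕ, ∃ C, ∀ t, (1 + |t|) ^ k * ‖iteratedDeriv n (charFun ρ) t‖ ≤ C := by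
  have hsm : ContDiff ℝ (⊤ : ℕ∞) (charFun ρ) := contDiff_charFun' hmom
  have hdiff : ∀ m, Differentiable ℝ (iteratedDeriv m (charFun ρ)) := fun m =>
    hsm.differentiable_iteratedDeriv m (by exact_mod_cast WithTop.coe_lt_top m)
  induction n with
  | zero => simpa using hdec
  | succ n ih =>
    intro k
    -- The second derivative of the `n`-th derivative is bounded by the absolute moment of order `n
    -- + 2`.
    have := rapid_decay_deriv (f := iteratedDeriv n (charFun ρ)) (hdiff n)
      (by rw [← iteratedDeriv_succ]; exact hdiff _) (B := ∫ x, ‖x‖ ^ (n + 2) ∂ρ) ?_ ih k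
    · simpa [iteratedDeriv_succ] using this
    · intro t
      rw [← iteratedDeriv_succ, ← iteratedDeriv_succ, iteratedDeriv_charFun (hmom _)]
      rw [norm_mul, norm_pow, Complex.norm_I, one_pow, one_mul]
      refine (norm_integral_le_integral_norm _).trans (le_of_eq ?_)
      congr with x
      rw [norm_mul, norm_pow, ← Complex.ofReal_mul, Complex.norm_exp_ofReal_mul_I, mul_one,
        Complex.norm_real]

/-- A rapidly decaying characteristic function of a law with all moments, with the scaling
that makes it a Fourier transform. -/
theorem exists_schwartz_charFun {ρ : Measure ℝ} [IsProbabilityMeasure ρ]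
    (hmom : ∀ k : ℕ, MemLp id k ρ)
    (hdec : ∀ k : ℕ, ∃ C, ∀ t, (1 + |t|) ^ k * ‖charFun ρ t‖ ≤ C) :
    ∃ Ψ : SchwartzMap ℝ ℂ, ∀ w, Ψ w = charFun ρ (-(2 * π) * w) := by
  have hsm : ContDiff ℝ (⊤ : ℕ∞) (charFun ρ) := contDiff_charFun' hmom
  let Φ : SchwartzMap ℝ ℂ :=
    { toFun := charFun ρ
      smooth' := hsm
      decay' := by
        intro k n
        obtain ⟨C, hC⟩ := charFun_rapid_decay_iteratedDeriv hmom hdec n k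
        refine ⟨C, fun t => ?_⟩
        rw [norm_iteratedFDeriv_eq_norm_iteratedDeriv]
        refine le_trans ?_ (hC t)
        gcongr
        rw [Real.norm_eq_abs]; linarith }
  have hne : -(2 * π) ≠ 0 := by simp [Real.pi_ne_zero]
  let L : ℝ ≃L[ℝ] ℝ := ContinuousLinearEquiv.smulLeft (Units.mk0 (-(2 * π)) hne)
  refine ⟨SchwartzMap.compCLMOfContinuousLinearEquiv ℝ L Φ, fun w => ?_⟩
  rfl

/-- Fubini moves the Fourier transform from the test function to the measure; the factor `-2π`
translates between the two normalizations. -/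
theorem integral_fourier_eq_charFun {ρ : Measure ℝ} [IsProbabilityMeasure ρ]
    (g : SchwartzMap ℝ ℂ) :
    ∫ x, (𝓕 g) x ∂ρ = ∫ w, g w * charFun ρ (-(2 * π) * w) := by
  have := VectorFourier.integral_fourierIntegral_smul_eq_flip (μ := (volume : Measure ℝ)) (ν := ρ)
    (L := innerₗ ℝ) (e := fourierChar) (f := g) (g := fun _ => (1 : ℂ))
    continuous_fourierChar continuous_inner g.integrable (integrable_const _)
  simp only [smul_eq_mul, mul_one] at this
  refine Eq.trans ?_ (this.trans ?_)
  · rw [SchwartzMap.fourier_coe]; rfl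
  · congr with w
    congr 1
    rw [charFun_eq_fourierIntegral']
    congr 1
    · ext; simp
    · have : (2 * π) ≠ 0 := by simp [Real.pi_ne_zero]
      simp only [smul_eq_mul]
      field_simp

/-- A continuous function with nonnegative integrals against nonnegative test functions is
nonnegative. -/
theorem nonneg_of_integral_test_nonneg {c : ℝ → ℝ} (hc : Continuous c)
    (h : ∀ g : ℝ → ℝ, ContDiff ℝ (⊤ : ℕ∞) g → HasCompactSupport g → (∀ x, 0 ≤ g x) →
      0 ≤ ∫ x, g x * c x) (x : ℝ) : 0 ≤ c x := by
  by_contra! hx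
  have hnear : ∀ᶠ y in nhds x, c y < c x / 2 := hc.continuousAt.eventually_lt
    continuousAt_const (by linarith)
  obtain ⟨δ, hδ, hball⟩ := Metric.eventually_nhds_iff_ball.1 hnear
  let f : ContDiffBump x := ⟨δ / 2, δ, by positivity, by linarith⟩
  have h1 := h f f.contDiff f.hasCompactSupport (fun y => f.nonneg)
  have hle : ∫ y, f y * c y ≤ ∫ y, f y * (c x / 2) := by
    refine integral_mono ?_ (f.integrable.mul_const _) fun y => ?_
    · exact (f.continuous.mul hc).integrable_of_hasCompactSupport f.hasCompactSupport.mul_right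
    · by_cases hy : y ∈ Metric.ball x δ
      · exact mul_le_mul_of_nonneg_left (hball y hy).le f.nonneg
      · have : f y = 0 := f.zero_of_le_dist (by simpa using hy)
        simp [this]
  have hpos : 0 < ∫ y, f y := f.integral_pos
  rw [integral_mul_const] at hle
  nlinarith

/-- A law on the real line with all moments and a rapidly decaying characteristic function has
a Schwartz density. -/
theorem exists_schwartz_density {ρ : Measure ℝ} [IsProbabilityMeasure ρ]
    (hmom : ∀ k : ℕ, MemLp id k ρ)
    (hdec : ∀ k : ℕ, ∃ C, ∀ t, (1 + |t|) ^ k * ‖charFun ρ t‖ ≤ C) :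
    ∃ f : SchwartzMap ℝ ℝ, (∀ x, 0 ≤ f x) ∧
      ρ = (volume : Measure ℝ).withDensity fun x => ENNReal.ofReal (f x) := by
  obtain ⟨Ψ, hΨ⟩ := exists_schwartz_charFun hmom hdec
  -- The candidate density, so far only complex valued. Pairing it with test functions shows that it
  -- is real and nonnegative.
  set F : SchwartzMap ℝ ℂ := 𝓕⁻ Ψ with hF
  have hFF : 𝓕 F = Ψ := FourierTransform.fourier_fourierInv_eq Ψ
  have key : ∀ G : SchwartzMap ℝ ℂ, ∫ x, G x ∂ρ = ∫ x, G x * F x := by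
    intro G
    have hG : 𝓕 (𝓕⁻ G) = G := FourierTransform.fourier_fourierInv_eq G
    calc ∫ x, G x ∂ρ = ∫ x, (𝓕 (𝓕⁻ G)) x ∂ρ := by rw [hG]
      _ = ∫ w, (𝓕⁻ G) w * Ψ w := by
        rw [integral_fourier_eq_charFun]; simp_rw [hΨ]
      _ = ∫ w, (𝓕⁻ G) w * (𝓕 F) w := by rw [hFF]
      _ = ∫ w, (𝓕 (𝓕⁻ G)) w * F w := (SchwartzMap.integral_fourier_mul_eq _ _).symm
      _ = _ := by rw [hG]
  -- integrals against nonnegative test functions are nonnegative reals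
  have key2 : ∀ g : ℝ → ℝ, ContDiff ℝ (⊤ : ℕ∞) g → HasCompactSupport g → (∀ x, 0 ≤ g x) →
      (0 ≤ ∫ x, g x * (F x).re) ∧ ∫ x, g x * (F x).im = 0 := by
    intro g hg hgc hg0
    have hgc' : HasCompactSupport (fun x => (g x : ℂ)) := hgc.comp_left (g := ((↑) : ℝ → ℂ)) rfl
    have hgs : ContDiff ℝ (⊤ : ℕ∞) (fun x => (g x : ℂ)) := Complex.ofRealCLM.contDiff.comp hg
    have := key (hgc'.toSchwartzMap hgs)
    change ∫ x, (g x : ℂ) ∂ρ = ∫ x, (g x : ℂ) * F x at this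
    rw [integral_complex_ofReal] at this
    have hInt : Integrable (fun x => (g x : ℂ) * F x) volume := by
      obtain ⟨C, hC⟩ := hgc.exists_bound_of_continuous hg.continuous
      exact (F.integrable).bdd_mul (c := C)
        (Complex.continuous_ofReal.comp hg.continuous).aestronglyMeasurable
        (ae_of_all _ fun x => by simpa using hC x)
    constructor
    · have h2 := congrArg Complex.re this
      rw [← RCLike.re_eq_complex_re, ← integral_re hInt] at h2
      simp only [RCLike.re_eq_complex_re, Complex.re_ofReal_mul, Complex.ofReal_re] at h2
      rw [← h2]
      exact integral_nonneg hg0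
    · have h2 := congrArg Complex.im this
      rw [← RCLike.im_eq_complex_im, ← integral_im hInt] at h2
      simp only [RCLike.im_eq_complex_im, Complex.im_ofReal_mul, Complex.ofReal_im] at h2
      exact h2.symm
  have hcre : Continuous fun x => (F x).re := Complex.continuous_re.comp F.continuous
  have hcim : Continuous fun x => (F x).im := Complex.continuous_im.comp F.continuous
  have hre : ∀ x, 0 ≤ (F x).re := nonneg_of_integral_test_nonneg hcre
    fun g h1 h2 h3 => (key2 g h1 h2 h3).1
  have him : ∀ x, (F x).im = 0 := by
    have h1 := nonneg_of_integral_test_nonneg hcim fun g h1 h2 h3 => (key2 g h1 h2 h3).2.ge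
    have h2 := nonneg_of_integral_test_nonneg hcim.neg fun g h1 h2 h3 => by
      simp [integral_neg, (key2 g h1 h2 h3).2]
    exact fun x => le_antisymm (by simpa using h2 x) (h1 x)
  have hFre : ∀ x, F x = ((F x).re : ℂ) := fun x => by
    apply Complex.ext <;> simp [him]
  let f : SchwartzMap ℝ ℝ :=
    { toFun := fun x => (F x).re
      smooth' := Complex.reCLM.contDiff.comp F.smooth'
      decay' := by
        intro k n
        obtain ⟨C, hC⟩ := F.decay' k n
        refine ⟨‖Complex.reCLM‖ * C, fun x => ?_⟩
        have h1 := Complex.reCLM.norm_iteratedFDeriv_comp_left (x := x) (F.smooth n).contDiffAt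
          (le_refl _)
        calc ‖x‖ ^ k * ‖iteratedFDeriv ℝ n (fun x => (F x).re) x‖
            ≤ ‖x‖ ^ k * (‖Complex.reCLM‖ * ‖iteratedFDeriv ℝ n F x‖) := by gcongr; exact h1
          _ = ‖Complex.reCLM‖ * (‖x‖ ^ k * ‖iteratedFDeriv ℝ n F x‖) := by ring
          _ ≤ _ := by gcongr; exact hC x }
  have hfint : Integrable f volume := f.integrable
  have hf0 : ∀ x, 0 ≤ f x := hre
  refine ⟨f, hf0, ?_⟩
  have : IsFiniteMeasure ((volume : Measure ℝ).withDensity fun x => ENNReal.ofReal (f x)) :=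
    isFiniteMeasure_withDensity_ofReal hfint.2
  -- The density is identified through characteristic functions, for which finiteness of the
  -- weighted measure is enough; total mass one need not be checked separately.
  refine Measure.ext_of_charFun ?_
  ext t
  have h2π : (2 * π) ≠ 0 := by simp [Real.pi_ne_zero]
  have hw : charFun ρ t = Ψ (-(2 * π)⁻¹ * t) := by
    rw [hΨ]; congr 1; field_simp
  rw [hw, ← hFF, SchwartzMap.fourier_coe, charFun_apply_real]
  rw [integral_withDensity_eq_integral_toReal_smul
    (by exact (ENNReal.continuous_ofReal.comp f.continuous).measurable)
    (by simp), Real.fourier_real_eq_integral_exp_smul]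
  congr with x
  rw [ENNReal.toReal_ofReal (hf0 x), smul_eq_mul, hFre x]
  rw [Complex.real_smul, mul_comm]
  change (f x : ℂ) * _ = _
  congr 3
  push_cast
  have : (π : ℂ) ≠ 0 := by exact_mod_cast Real.pi_ne_zero
  field_simp

end SchwartzDensity

/-! ### Rapid decay from the split inequality. -/

section Decay

variable {ψ : ℝ → ℝ} {b ν Λ a q : ℝ}

/-- The limit `l` is the infimum. Letting `t → ∞` and then `ε → 0` in the inequality leaves `l ≤
l²`, and `l ≤ q < 1` forces `l = 0`. -/
theorem tendsto_zero_of_split_ineq (hψ : Antitone ψ) (h0 : ∀ t, 0 ≤ ψ t)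
    (hb : 1 ≤ b) (hν : 0 < ν) (hq : q < 1) (haq : ψ a ≤ q)
    (hrec : ∀ t, 0 < t → ∀ ε, 0 < ε → ε ≤ 1 / b →
      ψ t ≤ ψ (ε * t) ^ 2 + Λ * ε ^ ν * ψ (t / b)) :
    Tendsto ψ atTop (nhds 0) := by
  have hbdd : BddBelow (Set.range ψ) := ⟨0, by rintro _ ⟨t, rfl⟩; exact h0 t⟩
  have hL := tendsto_atTop_ciInf hψ hbdd
  set l := ⨅ t, ψ t with hl
  have hb0 : 0 < b := by linarith
  have hl0 : 0 ≤ l := le_ciInf h0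
  have hlq : l ≤ q := (ciInf_le hbdd a).trans haq
  have h1 : ∀ ε, 0 < ε → ε ≤ 1 / b → l ≤ l ^ 2 + Λ * ε ^ ν * l := by
    intro ε hε hεb
    have t1 : Tendsto (fun t => ψ (ε * t)) atTop (nhds l) :=
      hL.comp (tendsto_id.const_mul_atTop hε)
    have t2 : Tendsto (fun t => ψ (t / b)) atTop (nhds l) :=
      hL.comp (tendsto_id.atTop_div_const hb0)
    refine le_of_tendsto_of_tendsto hL ((t1.pow 2).add (t2.const_mul (Λ * ε ^ ν))) ?_
    filter_upwards [eventually_gt_atTop 0] with t ht using hrec t ht ε hε hεb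
  have h2 : l ≤ l ^ 2 := by
    have t3 : Tendsto (fun ε : ℝ => l ^ 2 + Λ * ε ^ ν * l) (nhdsWithin 0 (Set.Ioi 0))
        (nhds (l ^ 2 + Λ * 0 * l)) := by
      have : Tendsto (fun ε : ℝ => ε ^ ν) (nhdsWithin 0 (Set.Ioi 0)) (nhds 0) := by
        have h := (Real.continuousAt_rpow_const 0 ν (Or.inr hν.le)).tendsto
        rw [Real.zero_rpow hν.ne'] at h
        exact h.mono_left nhdsWithin_le_nhds
      exact ((this.const_mul Λ).mul_const l).const_add _
    have := ge_of_tendsto t3 (b := l) (by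
      filter_upwards [Ioo_mem_nhdsGT (show (0 : ℝ) < 1 / b by positivity)] with ε hε
        using h1 ε hε.1 hε.2.le)
    simpa using this
  have : l = 0 := by nlinarith
  rwa [this] at hL

/-- Fix `ε` with `Λ ε^ν ≤ 1/4`. Once `ψ(εt) ≤ 1/4`, both terms on the right are at most `ψ(εt)/4`,
because `εt ≤ t/b`. So shrinking the argument by `ε` costs a factor `1/2`, and iteration gives the
exponent `log 2 / (-log ε)`. -/
theorem rpow_bound_of_split_ineq (hψ : Antitone ψ) (h0 : ∀ t, 0 ≤ ψ t) (h1 : ∀ t, ψ t ≤ 1)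
    (hb : 1 < b) (hν : 0 < ν) (hq : q < 1) (haq : ψ a ≤ q)
    (hrec : ∀ t, 0 < t → ∀ ε, 0 < ε → ε ≤ 1 / b →
      ψ t ≤ ψ (ε * t) ^ 2 + Λ * ε ^ ν * ψ (t / b)) :
    ∃ p : ℝ, 0 < p ∧ ∃ C, ∀ t, 0 < t → ψ t ≤ C * t ^ (-p) := by
  have hb0 : 0 < b := by linarith
  have hlim := tendsto_zero_of_split_ineq hψ h0 hb.le hν hq haq hrec
  obtain ⟨ε, hε0, hεb, hεν⟩ : ∃ ε : ℝ, 0 < ε ∧ ε < 1 / b ∧ Λ * ε ^ ν ≤ 1 / 4 := by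
    have t3 : Tendsto (fun ε : ℝ => Λ * ε ^ ν) (nhdsWithin 0 (Set.Ioi 0)) (nhds (Λ * 0)) := by
      have h := (Real.continuousAt_rpow_const 0 ν (Or.inr hν.le)).tendsto
      rw [Real.zero_rpow hν.ne'] at h
      exact (h.mono_left nhdsWithin_le_nhds).const_mul Λ
    rw [mul_zero] at t3
    obtain ⟨ε, h, h'⟩ := ((t3.eventually_le_const (show (0 : ℝ) < 1 / 4 by norm_num)).and
      (Ioo_mem_nhdsGT (show (0 : ℝ) < 1 / b by positivity))).exists
    exact ⟨ε, h'.1, h'.2, h⟩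
  have hε1 : ε < 1 := hεb.trans (by rw [div_lt_one hb0]; exact hb)
  obtain ⟨T₀, hT₀⟩ := eventually_atTop.1
    (hlim.eventually_le_const (show (0 : ℝ) < 1 / 4 by norm_num))
  set T := max 1 (T₀ / ε) with hT
  have hT1 : 1 ≤ T := le_max_left _ _
  have hhalf : ∀ t, T ≤ t → ψ t ≤ 1 / 2 * ψ (ε * t) := by
    intro t ht
    have ht0 : 0 < t := by linarith
    have h4 : ψ (ε * t) ≤ 1 / 4 := hT₀ _ (by
      have : T₀ / ε ≤ t := (le_max_right _ _).trans ht
      rw [div_le_iff₀ hε0] at this; linarith)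
    have h5 : ψ (t / b) ≤ ψ (ε * t) := hψ (by
      rw [div_eq_mul_one_div, mul_comm t]; gcongr)
    have h6 := hrec t ht0 ε hε0 hεb.le
    have h7 : Λ * ε ^ ν * ψ (t / b) ≤ 1 / 4 * ψ (ε * t) := by
      have := h0 (t / b)
      gcongr
    nlinarith [h0 (ε * t)]
  have hlog : 0 < -Real.log ε := by have := Real.log_neg hε0 hε1; linarith
  set p := Real.log 2 / (-Real.log ε) with hp
  have hp0 : 0 < p := div_pos (Real.log_pos (by norm_num)) hlog
  have hεp : ε ^ (-p) = 2 := by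
    rw [Real.rpow_def_of_pos hε0, hp]
    rw [show Real.log ε * -(Real.log 2 / -Real.log ε) = Real.log 2 by
      have : Real.log ε ≠ 0 := by linarith
      field_simp]
    exact Real.exp_log (by norm_num)
  refine ⟨p, hp0, T ^ p, ?_⟩
  have hind : ∀ n : ℕ, ∀ t, 0 < t → ε ^ n * t ≤ T → ψ t ≤ T ^ p * t ^ (-p) := by
    intro n
    induction n with
    | zero =>
      intro t ht htT
      rw [pow_zero, one_mul] at htT
      refine (h1 t).trans ?_
      rw [Real.rpow_neg ht.le, ← div_eq_mul_inv, one_le_div (Real.rpow_pos_of_pos ht _)]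
      exact Real.rpow_le_rpow ht.le htT hp0.le
    | succ n ih =>
      intro t ht htT
      rcases le_or_gt t T with h | h
      · refine (h1 t).trans ?_
        rw [Real.rpow_neg ht.le, ← div_eq_mul_inv, one_le_div (Real.rpow_pos_of_pos ht _)]
        exact Real.rpow_le_rpow ht.le h hp0.le
      · have h2 := ih (ε * t) (by positivity) (by rw [pow_succ] at htT; linarith [mul_assoc (ε ^ n) ε t])
        rw [Real.mul_rpow hε0.le ht.le, hεp] at h2
        have h3 := hhalf t h.le
        linarith
  intro t ht
  obtain ⟨n, hn⟩ := exists_pow_lt_of_lt_one (show 0 < T / t by positivity) hε1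
  exact hind n t ht (by rw [lt_div_iff₀ ht] at hn; exact hn.le)

/-- Take `ε = t^(-1/4)`: the square decays with exponent `3p/2` and the other term with exponent `p
+ ν/4`. Both beat `p` by at least `δ`. The requirement `ε ≤ 1/b` is the reason for the threshold
`b⁴`. -/
theorem rpow_bound_improve (h1 : ∀ t, ψ t ≤ 1) (h0 : ∀ t, 0 ≤ ψ t)
    (hb : 1 < b) (hΛ : 0 ≤ Λ)
    (hrec : ∀ t, 0 < t → ∀ ε, 0 < ε → ε ≤ 1 / b →
      ψ t ≤ ψ (ε * t) ^ 2 + Λ * ε ^ ν * ψ (t / b))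
    {p δ : ℝ} (hp : 0 < p) (hδ0 : 0 < δ) (hδp : δ ≤ p / 2) (hδν : δ ≤ ν / 4)
    (hC : ∃ C, ∀ t, 0 < t → ψ t ≤ C * t ^ (-p)) :
    ∃ C, ∀ t, 0 < t → ψ t ≤ C * t ^ (-(p + δ)) := by
  obtain ⟨C, hC⟩ := hC
  have hb0 : 0 < b := by linarith
  have hC0 : 0 ≤ C := by have := (h0 1).trans (hC 1 one_pos); simpa using this
  have hb4 : (1 : ℝ) ≤ b ^ (4 : ℝ) := Real.one_le_rpow hb.le (by norm_num)
  refine ⟨(b ^ (4 : ℝ)) ^ (p + δ) + (C ^ 2 + Λ * C * b ^ p), fun t ht => ?_⟩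
  have htp : 0 < t ^ (-(p + δ)) := Real.rpow_pos_of_pos ht _
  rcases le_or_gt t (b ^ (4 : ℝ)) with h | h
  · refine (h1 t).trans ?_
    have : 1 ≤ (b ^ (4 : ℝ)) ^ (p + δ) * t ^ (-(p + δ)) := by
      rw [Real.rpow_neg ht.le, ← div_eq_mul_inv, one_le_div (Real.rpow_pos_of_pos ht _)]
      exact Real.rpow_le_rpow ht.le h (by positivity)
    have h3 : 0 ≤ (C ^ 2 + Λ * C * b ^ p) * t ^ (-(p + δ)) := by positivity
    linarith
  · have ht1 : 1 ≤ t := hb4.trans h.le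
    have hε0 : 0 < t ^ (-(1 / 4) : ℝ) := Real.rpow_pos_of_pos ht _
    have hεb : t ^ (-(1 / 4) : ℝ) ≤ 1 / b := by
      rw [Real.rpow_neg ht.le, ← one_div]
      apply one_div_le_one_div_of_le hb0
      calc b = (b ^ (4 : ℝ)) ^ (1 / 4 : ℝ) := by
            rw [← Real.rpow_mul hb0.le]; norm_num
        _ ≤ t ^ (1 / 4 : ℝ) := Real.rpow_le_rpow (by positivity) h.le (by norm_num)
    have h2 := hrec t ht _ hε0 hεb
    have h3 : t ^ (-(1 / 4) : ℝ) * t = t ^ (3 / 4 : ℝ) := by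
      nth_rewrite 2 [← Real.rpow_one t]
      rw [← Real.rpow_add ht]; norm_num
    have h4 : ψ (t ^ (-(1 / 4) : ℝ) * t) ^ 2 ≤ C ^ 2 * t ^ (-(p + δ)) := by
      rw [h3]
      have h5 := hC (t ^ (3 / 4 : ℝ)) (by positivity)
      have h6 : (t ^ (3 / 4 : ℝ)) ^ (-p) = t ^ (-(3 / 4 * p)) := by
        rw [← Real.rpow_mul ht.le]; ring_nf
      rw [h6] at h5
      calc ψ (t ^ (3 / 4 : ℝ)) ^ 2 ≤ (C * t ^ (-(3 / 4 * p))) ^ 2 := by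
            gcongr; exact h0 _
        _ = C ^ 2 * t ^ (-(3 / 2 * p)) := by
            rw [mul_pow, ← Real.rpow_natCast (t ^ (-(3 / 4 * p))) 2, ← Real.rpow_mul ht.le]
            congr 2; push_cast; ring
        _ ≤ _ := by
            gcongr
            linarith
    have h7 : Λ * (t ^ (-(1 / 4) : ℝ)) ^ ν * ψ (t / b) ≤ Λ * C * b ^ p * t ^ (-(p + δ)) := by
      have h8 := hC (t / b) (by positivity)
      have h9 : (t / b) ^ (-p) = b ^ p * t ^ (-p) := by
        rw [Real.div_rpow ht.le hb0.le, Real.rpow_neg hb0.le, div_inv_eq_mul, mul_comm]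
      rw [h9] at h8
      calc Λ * (t ^ (-(1 / 4) : ℝ)) ^ ν * ψ (t / b)
          ≤ Λ * (t ^ (-(1 / 4) : ℝ)) ^ ν * (C * (b ^ p * t ^ (-p))) := by gcongr
        _ = Λ * C * b ^ p * (t ^ (-(ν / 4)) * t ^ (-p)) := by
            rw [← Real.rpow_mul ht.le]; ring_nf
        _ = Λ * C * b ^ p * t ^ (-(ν / 4) + -p) := by rw [Real.rpow_add ht]
        _ ≤ _ := by
            gcongr
            linarith
    have h10 : 0 ≤ (b ^ (4 : ℝ)) ^ (p + δ) * t ^ (-(p + δ)) := by positivity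
    nlinarith

/-- The gain `δ` computed from the first exponent remains admissible as the exponent grows, so
finitely many improvements reach any power. -/
theorem rapid_decay_of_split_ineq (hψ : Antitone ψ) (h0 : ∀ t, 0 ≤ ψ t) (h1 : ∀ t, ψ t ≤ 1)
    (hb : 1 < b) (hν : 0 < ν) (hq : q < 1) (haq : ψ a ≤ q)
    (hΛ : 0 ≤ Λ)
    (hrec : ∀ t, 0 < t → ∀ ε, 0 < ε → ε ≤ 1 / b →
      ψ t ≤ ψ (ε * t) ^ 2 + Λ * ε ^ ν * ψ (t / b)) (k : ℕ) :
    ∃ C, ∀ t, 0 ≤ t → (1 + t) ^ k * ψ t ≤ C := by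
  obtain ⟨p, hp, hC⟩ := rpow_bound_of_split_ineq hψ h0 h1 hb hν hq haq hrec
  set δ := min (p / 2) (ν / 4) with hδ
  have hδ0 : 0 < δ := lt_min (by positivity) (by positivity)
  have hall : ∀ n : ℕ, ∃ C, ∀ t, 0 < t → ψ t ≤ C * t ^ (-(p + n * δ)) := by
    intro n
    induction n with
    | zero => simpa using hC
    | succ n ih =>
      have hn : 0 ≤ n * δ := by positivity
      have := rpow_bound_improve h1 h0 hb hΛ hrec (p := p + n * δ) (δ := δ) (by positivity)
        hδ0 (by have := min_le_left (p / 2) (ν / 4); linarith) (min_le_right _ _) ih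
      push_cast
      rwa [show p + ((n : ℝ) + 1) * δ = p + n * δ + δ by ring]
  obtain ⟨n, hn⟩ := exists_nat_gt ((k : ℝ) / δ)
  obtain ⟨C, hC⟩ := hall n
  have hC0 : 0 ≤ C := by have := (h0 1).trans (hC 1 one_pos); simpa using this
  refine ⟨2 ^ k + 2 ^ k * C, fun t ht => ?_⟩
  rcases le_or_gt t 1 with h | h
  · calc (1 + t) ^ k * ψ t ≤ 2 ^ k * 1 := by
          gcongr
          · exact h0 t
          · linarith
          · exact h1 t
      _ ≤ _ := by rw [mul_one]; have : 0 ≤ 2 ^ k * C := by positivity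
                  linarith
  · have h2 := hC t (by linarith)
    have h3 : t ^ (-(p + n * δ)) ≤ t ^ (-(k : ℝ)) := by
      apply Real.rpow_le_rpow_of_exponent_le h.le
      rw [div_lt_iff₀ hδ0] at hn
      linarith
    calc (1 + t) ^ k * ψ t ≤ (2 * t) ^ k * (C * t ^ (-(k : ℝ))) := by
          gcongr
          · exact h0 t
          · linarith
          · exact h2.trans (by gcongr)
      _ = 2 ^ k * C * (t ^ k * t ^ (-(k : ℝ))) := by rw [mul_pow]; ring
      _ = 2 ^ k * C := by
          rw [← Real.rpow_natCast t k, ← Real.rpow_add (by linarith)]; simp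
      _ ≤ _ := by have : (0 : ℝ) ≤ 2 ^ k := by positivity
                  linarith

theorem exists_eq_iSup_of_mem_stdSimplex {b : ℕ} (hb : 0 < b) {v : Fin b → ℝ}
    (hv : v ∈ stdSimplex ℝ (Fin b)) : (∃ j, v j = ⨆ j, v j) ∧ 1 / (b : ℝ) ≤ ⨆ j, v j := by
  have : Nonempty (Fin b) := ⟨⟨0, hb⟩⟩
  refine ⟨exists_eq_ciSup_of_finite, ?_⟩
  have hb' : (0 : ℝ) < b := by exact_mod_cast hb
  rw [div_le_iff₀ hb', ← hv.2]
  calc ∑ j, v j ≤ ∑ _j : Fin b, ⨆ j, v j :=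
        Finset.sum_le_sum fun j _ => le_ciSup (Set.finite_range v).bddAbove j
    _ = _ := by simp [mul_comm]

theorem prod_le_of_mem_unitInterval {ι : Type*} [Fintype ι] [DecidableEq ι] {f : ι → ℝ}
    (h0 : ∀ i, 0 ≤ f i) (h1 : ∀ i, f i ≤ 1) (j : ι) : ∏ i, f i ≤ f j := by
  rw [← Finset.mul_prod_erase _ f (Finset.mem_univ j)]
  exact mul_le_of_le_one_right (h0 j) (Finset.prod_le_one (fun i _ => h0 i) fun i _ => h1 i)

theorem prod_le_mul_of_mem_unitInterval {ι : Type*} [Fintype ι] [DecidableEq ι] {f : ι → ℝ}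
    (h0 : ∀ i, 0 ≤ f i) (h1 : ∀ i, f i ≤ 1) {j k : ι} (hjk : k ≠ j) :
    ∏ i, f i ≤ f j * f k := by
  rw [← Finset.mul_prod_erase _ f (Finset.mem_univ j),
    ← Finset.mul_prod_erase _ f (Finset.mem_erase.2 ⟨hjk, Finset.mem_univ k⟩)]
  refine mul_le_mul_of_nonneg_left ?_ (h0 j)
  exact mul_le_of_le_one_right (h0 k) (Finset.prod_le_one (fun i _ => h0 i) fun i _ => h1 i)

theorem exists_second_largest {b : ℕ} {v : Fin b → ℝ} (hv : v ∈ stdSimplex ℝ (Fin b))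
    {j : Fin b} {ε : ℝ} (hε : 0 ≤ ε) (hj : v j < 1 - b * ε) : ∃ k ≠ j, ε ≤ v k := by
  by_contra! h
  have h1 : ∑ k ∈ Finset.univ.erase j, v k ≤ ∑ k ∈ Finset.univ.erase j, ε :=
    Finset.sum_le_sum fun k hk => (h k (Finset.ne_of_mem_erase hk)).le
  have h2 := Finset.add_sum_erase Finset.univ v (Finset.mem_univ j)
  rw [hv.2] at h2
  have h3 : ∑ k ∈ Finset.univ.erase j, ε ≤ b * ε := by
    calc ∑ k ∈ Finset.univ.erase j, ε ≤ ∑ k : Fin b, ε :=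
          Finset.sum_le_sum_of_subset_of_nonneg (Finset.erase_subset _ _) fun _ _ _ => hε
      _ = b * ε := by simp
  linarith

theorem le_one_of_mem_stdSimplex {b : ℕ} {v : Fin b → ℝ} (hv : v ∈ stdSimplex ℝ (Fin b))
    (j : Fin b) : v j ≤ 1 := by
  rw [← hv.2]; exact Finset.single_le_sum (fun i _ => hv.1 i) (Finset.mem_univ j)

section SplitInequality

variable {b : ℕ} {σ : Measure (Fin b → ℝ)} [IsProbabilityMeasure σ] {φ : ℝ → ℝ}

theorem ae_iSup_lt_one {lam ν : ℝ} (hν : 0 < ν)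
    (htail : ∀ x : ℝ, 0 ≤ x → σ.real {v | 1 - x ≤ ⨆ j, v j} ≤ lam * x ^ ν) :
    ∀ᵐ v ∂σ, ⨆ j, v j < 1 := by
  have h := htail 0 le_rfl
  rw [Real.zero_rpow hν.ne', mul_zero, sub_zero] at h
  have h2 : σ.real {v | 1 ≤ ⨆ j, v j} = 0 := le_antisymm h measureReal_nonneg
  rw [measureReal_eq_zero_iff] at h2
  have : {v : Fin b → ℝ | ¬ (⨆ j, v j < 1)} = {v | 1 ≤ ⨆ j, v j} := by ext; simp
  rw [ae_iff, this, h2]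

theorem measurable_iSup_coord : Measurable fun v : Fin b → ℝ => ⨆ j, v j :=
  Measurable.iSup fun j => measurable_pi_apply j

/-- A continuous function with values in `[0, 1]` that satisfies the inequality of the
characteristic function of a split fixed point and is `< 1` close to the origin is bounded away
from `1` away from the origin. -/
theorem exists_lt_one_of_split (hb : 2 ≤ b) (hs : ∀ᵐ v ∂σ, v ∈ stdSimplex ℝ (Fin b))
    (hmax : ∀ᵐ v ∂σ, ⨆ j, v j < 1) (hφ : Continuous φ) (h0 : ∀ t, 0 ≤ φ t) (h1 : ∀ t, φ t ≤ 1)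
    (hineq : ∀ t, φ t ≤ ∫ v, ∏ j, φ (t * v j) ∂σ) {t₀ : ℝ} (ht₀ : 0 < t₀)
    (hlt : ∀ t, 0 < t → t ≤ t₀ → φ t < 1) :
    ∃ q < 1, ∀ t, t₀ / b ≤ t → φ t ≤ q := by
  have hb' : (1 : ℝ) < b := by exact_mod_cast hb
  have hb0 : (0 : ℝ) < b := by linarith
  set a := t₀ / b with ha
  have ha0 : 0 < a := by positivity
  have hat : a ≤ t₀ := by rw [ha, div_le_iff₀ hb0]; nlinarith
  obtain ⟨c, hc, hcmax⟩ := isCompact_Icc.exists_isMaxOn (Set.nonempty_Icc.2 hat) hφ.continuousOn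
  refine ⟨φ c, hlt c (ha0.trans_le hc.1) hc.2, fun T hT => ?_⟩
  by_contra! hTq
  have hne : (Set.Icc a T).Nonempty := Set.nonempty_Icc.2 hT
  obtain ⟨d, hd, hdmax⟩ := isCompact_Icc.exists_isMaxOn hne hφ.continuousOn
  have hQ : φ c < φ d := hTq.trans_le (hdmax (Set.right_mem_Icc.2 hT))
  have hS : IsCompact (Set.Icc a T ∩ φ ⁻¹' {φ d}) :=
    isCompact_Icc.inter_right (isClosed_singleton.preimage hφ)
  -- The first point at which the maximum over `[a, T]` is attained; it lies beyond `t₀`. The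
  -- largest entry of the split vector is in `[1/b, 1)`, so it moves `m` strictly to the left but
  -- not below `a = t₀ / b`. There `φ` is strictly smaller than its maximum, and integrating
  -- contradicts the inequality at `m`.
  obtain ⟨m, ⟨hm, hmd⟩, hmin⟩ := hS.exists_isLeast ⟨d, hd, rfl⟩
  have hmd' : φ m = φ d := hmd
  have hmt : t₀ < m := by
    by_contra! h
    have := hcmax (show m ∈ Set.Icc a t₀ from ⟨hm.1, h⟩)
    simp only [Set.mem_ofPred_eq] at this
    linarith
  have hm0 : 0 < m := ht₀.trans hmt
  have hbound : ∀ᵐ v ∂σ, ∏ j, φ (m * v j) < φ d := by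
    filter_upwards [hs, hmax] with v hv hvm
    obtain ⟨⟨j, hj⟩, hM⟩ := exists_eq_iSup_of_mem_stdSimplex (by omega) hv
    rw [← hj] at hM hvm
    refine (prod_le_of_mem_unitInterval (f := fun j => φ (m * v j)) (fun i => h0 _)
      (fun i => h1 _) j).trans_lt ?_
    have hlow : a ≤ m * v j := by
      calc a = t₀ * (1 / b) := by rw [ha]; ring
        _ ≤ m * v j := by gcongr
    have hup : m * v j < m := by nlinarith
    have hmem : m * v j ∈ Set.Icc a T := ⟨hlow, hup.le.trans hm.2⟩
    refine lt_of_le_of_ne (hdmax hmem) fun he => ?_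
    have := hmin ⟨hmem, he⟩
    linarith
  have hInt : Integrable (fun v : Fin b → ℝ => ∏ j, φ (m * v j)) σ := by
    refine Integrable.of_bound (C := 1)
        (by have : Continuous fun v : Fin b → ℝ => ∏ j, φ (m * v j) := by fun_prop
            exact this.aestronglyMeasurable) (ae_of_all _ fun v => ?_)
    rw [Real.norm_of_nonneg (Finset.prod_nonneg fun _ _ => h0 _)]
    exact Finset.prod_le_one (fun _ _ => h0 _) fun _ _ => h1 _
  have h2 : 0 < ∫ v, (φ d - ∏ j, φ (m * v j)) ∂σ := by
    rw [integral_pos_iff_support_of_nonneg_ae]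
    · have : ∀ᵐ v ∂σ, v ∈ Function.support fun v : Fin b → ℝ => φ d - ∏ j, φ (m * v j) := by
        filter_upwards [hbound] with v hv
        exact (sub_pos.2 hv).ne'
      refine (pos_iff_ne_zero).2 fun h => ?_
      have h' : ∀ᵐ v ∂σ, v ∉ Function.support fun v : Fin b → ℝ => φ d - ∏ j, φ (m * v j) :=
        measure_eq_zero_iff_ae_notMem.1 h
      obtain ⟨v, h1, h2⟩ := (this.and h').exists
      exact h2 h1
    · filter_upwards [hbound] with v hv using (sub_pos.2 hv).le
    · exact (integrable_const _).sub hInt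
  rw [integral_sub (integrable_const _) hInt] at h2
  simp only [integral_const, probReal_univ, one_smul] at h2
  have := hineq m
  linarith

/-- Rapid decay of a function that satisfies the inequality of the characteristic function of a
split fixed point. -/
theorem rapid_decay_of_split (hb : 2 ≤ b) (hs : ∀ᵐ v ∂σ, v ∈ stdSimplex ℝ (Fin b))
    {lam ν : ℝ} (hlam : 0 < lam) (hν : 0 < ν)
    (htail : ∀ x : ℝ, 0 ≤ x → σ.real {v | 1 - x ≤ ⨆ j, v j} ≤ lam * x ^ ν)
    (hφ : Continuous φ) (h0 : ∀ t, 0 ≤ φ t) (h1 : ∀ t, φ t ≤ 1) (heven : ∀ t, φ (-t) = φ t)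
    (hineq : ∀ t, φ t ≤ ∫ v, ∏ j, φ (t * v j) ∂σ) {t₀ : ℝ} (ht₀ : 0 < t₀)
    (hlt : ∀ t, 0 < t → t ≤ t₀ → φ t < 1) (k : ℕ) :
    ∃ C, ∀ t, (1 + |t|) ^ k * φ t ≤ C := by
  have hb' : (1 : ℝ) < b := by exact_mod_cast hb
  have hb0 : (0 : ℝ) < b := by linarith
  obtain ⟨q, hq, hqle⟩ := exists_lt_one_of_split hb hs (ae_iSup_lt_one hν htail) hφ h0 h1 hineq
    ht₀ hlt
  -- The least decreasing majorant of `φ`.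
  let ψ : ℝ → ℝ := fun t => ⨆ s : NNReal, φ (t + s)
  have hbdd : ∀ t, BddAbove (Set.range fun s : NNReal => φ (t + s)) := fun t =>
    ⟨1, by rintro _ ⟨s, rfl⟩; exact h1 _⟩
  have hle : ∀ t r, t ≤ r → φ r ≤ ψ t := by
    intro t r htr
    have := le_ciSup (hbdd t) (Real.toNNReal (r - t))
    have e : t + (Real.toNNReal (r - t) : ℝ) = r := by
      rw [Real.coe_toNNReal _ (by linarith)]; ring
    rwa [e] at this
  have hψ : Antitone ψ := fun t t' htt' => ciSup_le fun s => hle _ _ (by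
    have := s.2; linarith [NNReal.coe_nonneg s])
  have hψ0 : ∀ t, 0 ≤ ψ t := fun t => (h0 t).trans (hle t t le_rfl)
  have hψ1 : ∀ t, ψ t ≤ 1 := fun t => ciSup_le fun s => h1 _
  have hψa : ψ (t₀ / b) ≤ q := ciSup_le fun s => hqle _ (by linarith [NNReal.coe_nonneg s])
  have hone : ∀ t, 0 < t → ∀ ε, 0 < ε → ε ≤ 1 / (b : ℝ) →
      φ t ≤ ψ (ε * t) ^ 2 + lam * (b : ℝ) ^ ν * ε ^ ν * ψ (t / b) := by
    intro t ht ε hε hεb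
    -- On `A`, of probability at most `lam (bε)^ν`, only the factor of the largest entry is kept,
    -- and that entry is at least `1/b`. Off `A` some second entry is at least `ε`, so two factors
    -- are at most `ψ(εt)`.
    set A : Set (Fin b → ℝ) := {v | 1 - b * ε ≤ ⨆ j, v j} with hA
    have hAm : MeasurableSet A := measurableSet_le measurable_const measurable_iSup_coord
    have hInt : Integrable (fun v : Fin b → ℝ => ∏ j, φ (t * v j)) σ := by
      refine Integrable.of_bound (C := 1)
        (by have : Continuous fun v : Fin b → ℝ => ∏ j, φ (t * v j) := by fun_prop
            exact this.aestronglyMeasurable) (ae_of_all _ fun v => ?_)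
      rw [Real.norm_of_nonneg (Finset.prod_nonneg fun _ _ => h0 _)]
      exact Finset.prod_le_one (fun _ _ => h0 _) fun _ _ => h1 _
    have hint2 : Integrable (A.indicator fun _ : Fin b → ℝ => ψ (t / b)) σ :=
      (integrable_const _).indicator hAm
    calc φ t ≤ ∫ v, ∏ j, φ (t * v j) ∂σ := hineq t
      _ ≤ ∫ v, (ψ (ε * t) ^ 2 + A.indicator (fun _ => ψ (t / b)) v) ∂σ := by
        refine integral_mono_ae hInt ((integrable_const _).add hint2) ?_
        filter_upwards [hs] with v hv
        obtain ⟨⟨j, hj⟩, hM⟩ := exists_eq_iSup_of_mem_stdSimplex (by omega) hv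
        by_cases hvA : v ∈ A
        · rw [Set.indicator_of_mem hvA]
          refine (prod_le_of_mem_unitInterval (f := fun j => φ (t * v j)) (fun i => h0 _)
            (fun i => h1 _) j).trans ?_
          have : φ (t * v j) ≤ ψ (t / b) := hle _ _ (by
            rw [hj, div_eq_mul_one_div]; gcongr)
          have := sq_nonneg (ψ (ε * t))
          linarith
        · rw [Set.indicator_of_notMem hvA, add_zero]
          have hvj : v j < 1 - b * ε := by rw [hj]; exact not_le.1 hvA
          obtain ⟨k, hk, hεk⟩ := exists_second_largest hv hε.le hvj
          refine (prod_le_mul_of_mem_unitInterval (f := fun j => φ (t * v j)) (fun i => h0 _)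
            (fun i => h1 _) hk).trans ?_
          rw [sq]
          have e1 : φ (t * v j) ≤ ψ (ε * t) := hle _ _ (by
            rw [mul_comm]; gcongr; rw [hj]; exact hεb.trans hM)
          have e2 : φ (t * v k) ≤ ψ (ε * t) := hle _ _ (by rw [mul_comm]; gcongr)
          exact mul_le_mul e1 e2 (h0 _) (hψ0 _)
      _ = ψ (ε * t) ^ 2 + σ.real A * ψ (t / b) := by
        rw [integral_add (integrable_const _) hint2, integral_indicator_const _ hAm]
        simp
      _ ≤ _ := by
        have h2 := htail (b * ε) (by positivity)
        rw [Real.mul_rpow hb0.le hε.le] at h2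
        have h3 := mul_le_mul_of_nonneg_right h2 (hψ0 (t / b))
        rw [← mul_assoc] at h3
        linarith
  have hrec : ∀ t, 0 < t → ∀ ε, 0 < ε → ε ≤ 1 / (b : ℝ) →
      ψ t ≤ ψ (ε * t) ^ 2 + lam * (b : ℝ) ^ ν * ε ^ ν * ψ (t / b) := by
    intro t ht ε hε hεb
    refine ciSup_le fun s => ?_
    have hs0 := NNReal.coe_nonneg s
    refine (hone (t + s) (by linarith) ε hε hεb).trans ?_
    have e1 : ψ (ε * (t + s)) ≤ ψ (ε * t) := hψ (by gcongr; linarith)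
    have e2 : ψ ((t + s) / b) ≤ ψ (t / b) := hψ (by gcongr; linarith)
    have := hψ0 (ε * (t + s))
    gcongr
  obtain ⟨C, hC⟩ := rapid_decay_of_split_ineq hψ hψ0 hψ1 hb' hν hq hψa
    (by positivity) hrec k
  refine ⟨C, fun t => ?_⟩
  have : φ t ≤ ψ |t| := by
    rcases abs_choice t with h | h
    · rw [h]; exact hle _ _ le_rfl
    · rw [h, ← heven]; exact hle _ _ le_rfl
  exact (mul_le_mul_of_nonneg_left this (by positivity)).trans (hC |t| (abs_nonneg t))

end SplitInequality

end Decay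

theorem sq_integral_le_integral_sq {α : Type*} [MeasurableSpace α] {m : Measure α}
    [IsProbabilityMeasure m] {g : α → ℝ} (hg : Integrable g m)
    (hg2 : Integrable (fun x => g x ^ 2) m) : (∫ x, g x ∂m) ^ 2 ≤ ∫ x, g x ^ 2 ∂m := by
  set c := ∫ x, g x ∂m with hc
  have h : 0 ≤ ∫ x, (g x ^ 2 - 2 * c * g x + c ^ 2) ∂m :=
    integral_nonneg fun x => by have := sq_nonneg (g x - c); simp only [Pi.zero_apply]; nlinarith
  have h1 : Integrable (fun x => g x ^ 2 - 2 * c * g x) m := hg2.sub (hg.const_mul _)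
  rw [integral_add h1 (integrable_const _), integral_sub hg2 (hg.const_mul _), integral_const_mul, ← hc] at h
  simp only [integral_const, probReal_univ, one_smul] at h
  nlinarith

/-! ### Multiplicative random walks and asymptotically harmonic functions. -/

section ScaleAverage

/-- Bounded measurable functions. -/
def BddMeas (f : ℝ → ℝ) : Prop := Measurable f ∧ ∃ B, ∀ x, |f x| ≤ B

theorem BddMeas.add {f g : ℝ → ℝ} (hf : BddMeas f) (hg : BddMeas g) :
    BddMeas fun x => f x + g x := by
  obtain ⟨hf, B, hB⟩ := hf
  obtain ⟨hg, C, hC⟩ := hg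
  exact ⟨hf.add hg, B + C, fun x => (abs_add_le _ _).trans (add_le_add (hB x) (hC x))⟩

theorem BddMeas.sub {f g : ℝ → ℝ} (hf : BddMeas f) (hg : BddMeas g) :
    BddMeas fun x => f x - g x := by
  obtain ⟨hf, B, hB⟩ := hf
  obtain ⟨hg, C, hC⟩ := hg
  exact ⟨hf.sub hg, B + C, fun x => (abs_sub _ _).trans (add_le_add (hB x) (hC x))⟩

theorem BddMeas.mul {f g : ℝ → ℝ} (hf : BddMeas f) (hg : BddMeas g) :
    BddMeas fun x => f x * g x := by
  obtain ⟨hf, B, hB⟩ := hf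
  obtain ⟨hg, C, hC⟩ := hg
  refine ⟨hf.mul hg, B * C, fun x => ?_⟩
  rw [abs_mul]
  exact mul_le_mul (hB x) (hC x) (abs_nonneg _) ((abs_nonneg _).trans (hB x))

theorem BddMeas.const (c : ℝ) : BddMeas fun _ => c := ⟨measurable_const, |c|, fun _ => le_rfl⟩

theorem BddMeas.sq {f : ℝ → ℝ} (hf : BddMeas f) : BddMeas fun x => f x ^ 2 := by
  simpa [pow_two] using hf.mul hf

theorem BddMeas.integrable {f : ℝ → ℝ} (hf : BddMeas f) {α : Type*} [MeasurableSpace α]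
    (m : Measure α) [IsFiniteMeasure m] {g : α → ℝ} (hg : Measurable g) :
    Integrable (fun x => f (g x)) m := by
  obtain ⟨hf, B, hB⟩ := hf
  exact Integrable.of_bound (hf.comp hg).aestronglyMeasurable B (ae_of_all _ fun x => hB _)

variable (η : Measure ℝ) [IsProbabilityMeasure η]

/-- The transition operator of the multiplicative random walk with step law `η`. -/
def scaleAvg (f : ℝ → ℝ) (x : ℝ) : ℝ := ∫ z, f (x * z) ∂η

/-- The mean square increment of `f` along one step of the multiplicative random walk. -/
def scaleVar (f : ℝ → ℝ) (x : ℝ) : ℝ := ∫ z, (f (x * z) - f x) ^ 2 ∂η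

variable {η} {f g : ℝ → ℝ}

theorem BddMeas.scaleAvg (hf : BddMeas f) : BddMeas (scaleAvg η f) := by
  have hm : Measurable (SplitTree.scaleAvg η f) := by
    have : StronglyMeasurable fun p : ℝ × ℝ => f (p.1 * p.2) :=
      (hf.1.comp (measurable_fst.mul measurable_snd)).stronglyMeasurable
    exact this.integral_prod_right'.measurable
  obtain ⟨_, B, hB⟩ := hf
  refine ⟨hm, B, fun x => ?_⟩
  have := norm_integral_le_of_norm_le_const (μ := η) (f := fun z => f (x * z))
    (ae_of_all _ fun z => hB (x * z))
  simpa [SplitTree.scaleAvg] using this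

theorem BddMeas.scaleAvg_iterate (hf : BddMeas f) (k : ℕ) :
    BddMeas ((SplitTree.scaleAvg η)^[k] f) := by
  induction k with
  | zero => exact hf
  | succ k ih => rw [Function.iterate_succ_apply']; exact ih.scaleAvg

theorem scaleAvg_add (hf : BddMeas f) (hg : BddMeas g) :
    scaleAvg η (fun x => f x + g x) = fun x => scaleAvg η f x + scaleAvg η g x := by
  ext x
  exact integral_add (hf.integrable η (by fun_prop)) (hg.integrable η (by fun_prop))

theorem scaleAvg_sub (hf : BddMeas f) (hg : BddMeas g) :
    scaleAvg η (fun x => f x - g x) = fun x => scaleAvg η f x - scaleAvg η g x := by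
  ext x
  exact integral_sub (hf.integrable η (by fun_prop)) (hg.integrable η (by fun_prop))

theorem scaleAvg_mono (hf : BddMeas f) (hg : BddMeas g) (h : ∀ x, f x ≤ g x) (x : ℝ) :
    scaleAvg η f x ≤ scaleAvg η g x :=
  integral_mono (hf.integrable η (by fun_prop)) (hg.integrable η (by fun_prop)) fun _ => h _

theorem scaleAvg_iterate_mono (hf : BddMeas f) (hg : BddMeas g) (h : ∀ x, f x ≤ g x) (k : ℕ)
    (x : ℝ) : (scaleAvg η)^[k] f x ≤ (scaleAvg η)^[k] g x := by
  induction k generalizing x with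
  | zero => exact h x
  | succ k ih =>
    rw [Function.iterate_succ_apply', Function.iterate_succ_apply']
    exact scaleAvg_mono (hf.scaleAvg_iterate k) (hg.scaleAvg_iterate k) ih x

theorem scaleAvg_iterate_add (hf : BddMeas f) (hg : BddMeas g) (k : ℕ) :
    (scaleAvg η)^[k] (fun x => f x + g x) =
      fun x => (scaleAvg η)^[k] f x + (scaleAvg η)^[k] g x := by
  induction k with
  | zero => rfl
  | succ k ih =>
    rw [Function.iterate_succ_apply', ih,
      scaleAvg_add (hf.scaleAvg_iterate k) (hg.scaleAvg_iterate k)]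
    simp only [Function.iterate_succ_apply']

theorem scaleAvg_iterate_sub (hf : BddMeas f) (hg : BddMeas g) (k : ℕ) :
    (scaleAvg η)^[k] (fun x => f x - g x) =
      fun x => (scaleAvg η)^[k] f x - (scaleAvg η)^[k] g x := by
  induction k with
  | zero => rfl
  | succ k ih =>
    rw [Function.iterate_succ_apply', ih,
      scaleAvg_sub (hf.scaleAvg_iterate k) (hg.scaleAvg_iterate k)]
    simp only [Function.iterate_succ_apply']

theorem tendsto_scaleAvg (hη : ∀ᵐ z ∂η, 0 < z) (hf : BddMeas f)
    (h : Tendsto f atTop (nhds 0)) : Tendsto (scaleAvg η f) atTop (nhds 0) := by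
  obtain ⟨hm, B, hB⟩ := hf
  have : Tendsto (fun x => ∫ z, f (x * z) ∂η) atTop (nhds (∫ _z, (0 : ℝ) ∂η)) := by
    refine tendsto_integral_filter_of_dominated_convergence (fun _ => B)
      (Eventually.of_forall fun x => (hm.comp (by fun_prop)).aestronglyMeasurable)
      (Eventually.of_forall fun x => ae_of_all _ fun z => hB _) (integrable_const _) ?_
    filter_upwards [hη] with z hz
    exact h.comp (tendsto_id.atTop_mul_const hz)
  rwa [integral_zero] at this

theorem tendsto_scaleAvg_iterate (hη : ∀ᵐ z ∂η, 0 < z) (hf : BddMeas f)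
    (h : Tendsto f atTop (nhds 0)) (k : ℕ) :
    Tendsto ((scaleAvg η)^[k] f) atTop (nhds 0) := by
  induction k with
  | zero => exact h
  | succ k ih =>
    rw [Function.iterate_succ_apply']
    exact tendsto_scaleAvg hη (hf.scaleAvg_iterate k) ih

theorem scaleVar_integrable (hf : BddMeas f) (x : ℝ) :
    Integrable (fun z => (f (x * z) - f x) ^ 2) η :=
  ((hf.sub (BddMeas.const (f x))).sq).integrable η (g := fun z => x * z) (by fun_prop)

/-- Expanding the square shows that the variance is the harmonic defect of `f²` up to a term
proportional to the harmonic defect of `f`. The first part telescopes under iteration and the second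
is asymptotically negligible. -/
theorem scaleVar_eq (hf : BddMeas f) (x : ℝ) :
    scaleVar η f x = scaleAvg η (fun y => f y ^ 2) x - f x ^ 2
      + 2 * f x * (f x - scaleAvg η f x) := by
  have h1 : Integrable (fun z => f (x * z) ^ 2) η := hf.sq.integrable η (by fun_prop)
  have h2 : Integrable (fun z => f (x * z)) η := hf.integrable η (by fun_prop)
  have : scaleVar η f x = ∫ z, (f (x * z) ^ 2 - 2 * f x * f (x * z) + f x ^ 2) ∂η :=
    integral_congr_ae (ae_of_all _ fun z => by ring)
  have h3 : Integrable (fun z => f (x * z) ^ 2 - 2 * f x * f (x * z)) η := h1.sub (h2.const_mul _)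
  rw [this, integral_add h3 (integrable_const _),
    integral_sub h1 (h2.const_mul _), integral_const_mul]
  simp only [integral_const, probReal_univ, one_smul, scaleAvg]
  ring

theorem BddMeas.scaleVar (hf : BddMeas f) : BddMeas (scaleVar η f) := by
  have : SplitTree.scaleVar η f = fun x => SplitTree.scaleAvg η (fun y => f y ^ 2) x - f x ^ 2
      + 2 * f x * (f x - SplitTree.scaleAvg η f x) := funext (scaleVar_eq hf)
  rw [this]
  exact (hf.sq.scaleAvg.sub hf.sq).add (((BddMeas.const 2).mul hf).mul (hf.sub hf.scaleAvg))

/-- Multiplicative steps commute, so an increment of the average is the average of increments;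
Jensen's inequality and Fubini do the rest. -/
theorem scaleVar_scaleAvg_le (hf : BddMeas f) (x : ℝ) :
    scaleVar η (scaleAvg η f) x ≤ scaleAvg η (scaleVar η f) x := by
  have hm : Measurable fun p : ℝ × ℝ => (f (x * p.1 * p.2) - f (x * p.2)) ^ 2 :=
    ((hf.1.comp (by fun_prop)).sub (hf.1.comp (by fun_prop))).pow_const 2
  have hInt : Integrable (fun p : ℝ × ℝ => (f (x * p.1 * p.2) - f (x * p.2)) ^ 2) (η.prod η) := by
    obtain ⟨_, B, hB⟩ := hf
    refine Integrable.of_bound hm.aestronglyMeasurable ((2 * B) ^ 2) (ae_of_all _ fun p => ?_)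
    rw [Real.norm_eq_abs, abs_of_nonneg (sq_nonneg _)]
    refine sq_le_sq' ?_ ?_ <;>
      linarith [abs_le.1 (hB (x * p.1 * p.2)), abs_le.1 (hB (x * p.2))]
  calc scaleVar η (scaleAvg η f) x
      ≤ ∫ z, ∫ y, (f (x * z * y) - f (x * y)) ^ 2 ∂η ∂η := by
        refine integral_mono (scaleVar_integrable hf.scaleAvg x) hInt.integral_prod_left
          fun z => ?_
        have h1 : Integrable (fun y => f (x * z * y)) η := hf.integrable η (by fun_prop)
        have h2 : Integrable (fun y => f (x * y)) η := hf.integrable η (by fun_prop)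
        have h3 : Integrable (fun y => (f (x * z * y) - f (x * y)) ^ 2) η := by
          obtain ⟨_, B, hB⟩ := hf
          refine Integrable.of_bound (hm.comp measurable_prodMk_left).aestronglyMeasurable
            ((2 * B) ^ 2) (ae_of_all _ fun p => ?_)
          rw [Real.norm_eq_abs, abs_of_nonneg (sq_nonneg _)]
          refine sq_le_sq' ?_ ?_ <;>
            linarith [abs_le.1 (hB (x * z * p)), abs_le.1 (hB (x * p))]
        have := sq_integral_le_integral_sq (h1.sub h2) h3
        simp only [Pi.sub_apply] at this
        rwa [integral_sub h1 h2] at this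
    _ = ∫ y, ∫ z, (f (x * z * y) - f (x * y)) ^ 2 ∂η ∂η := integral_integral_swap hInt
    _ = _ := by
        simp only [scaleAvg, scaleVar]
        congr with y
        congr with z
        rw [mul_right_comm]

theorem scaleVar_iterate_le (hf : BddMeas f) (k : ℕ) (x : ℝ) :
    scaleVar η ((scaleAvg η)^[k] f) x ≤ (scaleAvg η)^[k] (scaleVar η f) x := by
  induction k generalizing x with
  | zero => exact le_rfl
  | succ k ih =>
    rw [Function.iterate_succ_apply', Function.iterate_succ_apply']
    exact (scaleVar_scaleAvg_le (hf.scaleAvg_iterate k) x).trans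
      (scaleAvg_mono (hf.scaleAvg_iterate k).scaleVar (hf.scaleVar.scaleAvg_iterate k) ih x)

theorem scaleVar_add_le (hf : BddMeas f) (hg : BddMeas g) (x : ℝ) :
    scaleVar η (fun y => f y + g y) x ≤ 2 * scaleVar η f x + 2 * scaleVar η g x := by
  unfold scaleVar
  rw [← integral_const_mul, ← integral_const_mul, ← integral_add
    ((scaleVar_integrable hf x).const_mul 2) ((scaleVar_integrable hg x).const_mul 2)]
  refine integral_mono (scaleVar_integrable (hf.add hg) x)
    (((scaleVar_integrable hf x).const_mul 2).add ((scaleVar_integrable hg x).const_mul 2))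
    fun z => ?_
  have := sq_nonneg ((f (x * z) - f x) - (g (x * z) - g x))
  simp only
  nlinarith

theorem tendsto_scaleVar_of_tendsto (hη : ∀ᵐ z ∂η, 0 < z) (hf : BddMeas f)
    (h : Tendsto f atTop (nhds 0)) : Tendsto (scaleVar η f) atTop (nhds 0) := by
  have h2 : Tendsto (fun x => f x ^ 2) atTop (nhds 0) := by simpa using h.pow 2
  have := ((tendsto_scaleAvg hη hf.sq h2).sub h2).add
    ((h.const_mul 2).mul (h.sub (tendsto_scaleAvg hη hf h)))
  rw [funext (scaleVar_eq hf)]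
  simpa using this

theorem tendsto_sub_iterate (hη : ∀ᵐ z ∂η, 0 < z) (hf : BddMeas f)
    (h : Tendsto (fun x => f x - scaleAvg η f x) atTop (nhds 0)) (k : ℕ) :
    Tendsto (fun x => f x - (scaleAvg η)^[k] f x) atTop (nhds 0) := by
  induction k with
  | zero => simp
  | succ k ih =>
    have := tendsto_scaleAvg hη (hf.sub (hf.scaleAvg_iterate k)) ih
    rw [scaleAvg_sub hf (hf.scaleAvg_iterate k)] at this
    have h2 := h.add this
    rw [add_zero] at h2
    refine h2.congr fun x => ?_
    rw [Function.iterate_succ_apply']; ring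

/-- **Choquet–Deny**, asymptotic form: a bounded function which is asymptotically harmonic for a
multiplicative random walk is asymptotically constant along its steps. -/
theorem tendsto_scaleVar_of_asymptotically_harmonic (hη : ∀ᵐ z ∂η, 0 < z) (hf : BddMeas f)
    (h : Tendsto (fun x => f x - scaleAvg η f x) atTop (nhds 0)) :
    Tendsto (scaleVar η f) atTop (nhds 0) := by
  have hD0 : ∀ x, 0 ≤ scaleVar η f x := fun x => integral_nonneg fun z => sq_nonneg _
  obtain ⟨B, hB⟩ := hf.2
  have hB0 : 0 ≤ B := (abs_nonneg _).trans (hB 0)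
  set r : ℝ → ℝ := fun x => 2 * f x * (f x - scaleAvg η f x) with hr
  have hrb : BddMeas r := ((BddMeas.const 2).mul hf).mul (hf.sub hf.scaleAvg)
  have hrt : Tendsto r atTop (nhds 0) := by
    refine squeeze_zero_norm (a := fun x => 2 * B * |f x - scaleAvg η f x|) (fun x => ?_) ?_
    · rw [hr, Real.norm_eq_abs, abs_mul, abs_mul, abs_two]
      gcongr
      exact hB x
    · simpa using (h.abs).const_mul (2 * B)
  have hiter : ∀ k x, (scaleAvg η)^[k] (scaleVar η f) x =
      (scaleAvg η)^[k + 1] (fun y => f y ^ 2) x - (scaleAvg η)^[k] (fun y => f y ^ 2) x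
        + (scaleAvg η)^[k] r x := by
    intro k x
    rw [funext (scaleVar_eq hf), scaleAvg_iterate_add (hf.sq.scaleAvg.sub hf.sq) hrb,
      scaleAvg_iterate_sub hf.sq.scaleAvg hf.sq, Function.iterate_succ_apply]
  -- The iterated averages of the variance telescope, so their sum over any number `K` of steps
  -- stays below `B²` up to a vanishing error.
  have hsum : ∀ K x, ∑ k ∈ Finset.range K, (scaleAvg η)^[k] (scaleVar η f) x ≤
      B ^ 2 + ∑ k ∈ Finset.range K, (scaleAvg η)^[k] r x := by
    intro K x
    simp_rw [hiter]
    rw [Finset.sum_add_distrib, Finset.sum_range_sub (fun k => (scaleAvg η)^[k] (fun y => f y ^ 2) x)]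
    have h1 : (scaleAvg η)^[K] (fun y => f y ^ 2) x ≤ B ^ 2 := by
      have hc : ∀ k, (scaleAvg η)^[k] (fun _ => B ^ 2) = fun _ => B ^ 2 := by
        intro k
        induction k with
        | zero => rfl
        | succ k ih =>
          rw [Function.iterate_succ_apply', ih]; ext x; simp [scaleAvg]
      have := scaleAvg_iterate_mono (η := η) hf.sq (BddMeas.const (B ^ 2))
        (fun y => sq_le_sq' (by linarith [(abs_le.1 (hB y)).1]) (abs_le.1 (hB y)).2) K x
      rwa [hc] at this
    have h2 : 0 ≤ f x ^ 2 := sq_nonneg _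
    simp only [Function.iterate_zero, id_eq]
    linarith
  set δ : ℕ → ℝ → ℝ := fun k => scaleVar η (fun x => f x - (scaleAvg η)^[k] f x) with hδ
  have hδt : ∀ k, Tendsto (δ k) atTop (nhds 0) := fun k =>
    tendsto_scaleVar_of_tendsto hη (hf.sub (hf.scaleAvg_iterate k)) (tendsto_sub_iterate hη hf h k)
  -- Split `f` into its `k`-step average and a remainder that tends to zero: the variance of `f` is
  -- at most twice its `k`-step average plus an error. Summing over `k < K` bounds `K` times the
  -- variance by a constant, for arbitrary `K`.
  have hle : ∀ k x, scaleVar η f x ≤ 2 * (scaleAvg η)^[k] (scaleVar η f) x + 2 * δ k x := by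
    intro k x
    have h1 := scaleVar_add_le (η := η) (hf.scaleAvg_iterate (η := η) k)
      (hf.sub (hf.scaleAvg_iterate (η := η) k)) x
    simp only [add_sub_cancel] at h1
    have h2 := scaleVar_iterate_le (η := η) hf k x
    linarith
  have hK : ∀ K : ℕ, ∀ᶠ x in atTop, K * scaleVar η f x ≤ 2 * B ^ 2 + 1 := by
    intro K
    have ht : Tendsto (fun x => 2 * ∑ k ∈ Finset.range K, (scaleAvg η)^[k] r x
        + 2 * ∑ k ∈ Finset.range K, δ k x) atTop (nhds 0) := by
      have t1 := tendsto_finsetSum (Finset.range K)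
        fun k _ => tendsto_scaleAvg_iterate (η := η) hη hrb hrt k
      have t2 := tendsto_finsetSum (Finset.range K) fun k _ => hδt k
      simpa using (t1.const_mul 2).add (t2.const_mul 2)
    filter_upwards [ht.eventually_le_const (show (0 : ℝ) < 1 by norm_num)] with x hx
    have h1 : (K : ℝ) * scaleVar η f x ≤ ∑ k ∈ Finset.range K,
        (2 * (scaleAvg η)^[k] (scaleVar η f) x + 2 * δ k x) := by
      calc (K : ℝ) * scaleVar η f x = ∑ _k ∈ Finset.range K, scaleVar η f x := by simp
        _ ≤ _ := Finset.sum_le_sum fun k _ => hle k x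
    rw [Finset.sum_add_distrib, ← Finset.mul_sum, ← Finset.mul_sum] at h1
    have := hsum K x
    linarith
  rw [Metric.tendsto_nhds]
  intro ε hε
  obtain ⟨K, hKε⟩ := exists_nat_gt ((2 * B ^ 2 + 1) / ε)
  filter_upwards [hK K] with x hx
  rw [dist_zero_right, Real.norm_of_nonneg (hD0 x)]
  have hK0 : (0 : ℝ) < K := lt_of_le_of_lt (by positivity) hKε
  rw [div_lt_iff₀ hε] at hKε
  by_contra! hc
  nlinarith

end ScaleAverage

/-- `x log x` is Hölder continuous of order `1/2` on the unit interval. -/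
theorem abs_mul_log_sub_le {x y : ℝ} (hx0 : 0 ≤ x) (hx1 : x ≤ 1) (hy0 : 0 ≤ y) (hy1 : y ≤ 1) :
    |x * Real.log x - y * Real.log y| ≤ 2 * √|x - y| := by
  wlog hxy : x ≤ y generalizing x y
  · rw [abs_sub_comm, abs_sub_comm x y]
    exact this hy0 hy1 hx0 hx1 (le_of_not_ge hxy)
  rcases hxy.eq_or_lt with rfl | hlt
  · simp
  have hy : 0 < y := hx0.trans_lt hlt
  set h := y - x with hh
  have hh0 : 0 < h := by linarith
  have hh1 : h ≤ 1 := by linarith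
  have hsq : √h ^ 2 = h := Real.sq_sqrt hh0.le
  have hs0 : 0 < √h := Real.sqrt_pos.2 hh0
  have hs1 : √h ≤ 1 := Real.sqrt_le_one.2 hh1
  rw [abs_sub_comm x y, abs_of_pos (by linarith : 0 < y - x), ← hh]
  have hly : Real.log y ≤ 0 := Real.log_nonpos hy0 hy1
  -- The bound `log z ≤ z - 1` at `z = 1/√h`.
  have hlh : -Real.log h ≤ 2 / √h - 2 := by
    have h1 : Real.log (1 / √h) ≤ 1 / √h - 1 := Real.log_le_sub_one_of_pos (by positivity)
    rw [one_div, Real.log_inv, Real.log_sqrt hh0.le] at h1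
    rw [div_eq_mul_inv]; linarith
  have hhl : -(h * Real.log h) ≤ 2 * √h - 2 * h := by
    have := mul_le_mul_of_nonneg_left hlh hh0.le
    have e : h * (2 / √h - 2) = 2 * √h - 2 * h := by
      rw [mul_sub, mul_div_assoc', mul_comm h 2]
      nth_rewrite 1 [← hsq]
      field_simp
    linarith
  have hlhy : Real.log h ≤ Real.log y := Real.log_le_log hh0 (by linarith)
  rw [abs_le]
  rcases hx0.eq_or_lt with rfl | hx
  · simp only [zero_mul, zero_sub]
    have : h = y := by linarith
    rw [← this] at hly ⊢
    constructor <;> nlinarith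
  · have hlxy : Real.log x ≤ Real.log y := Real.log_le_log hx hlt.le
    have h3 : x * (Real.log y - Real.log x) ≤ h := by
      have := Real.log_le_sub_one_of_pos (show 0 < y / x by positivity)
      rw [Real.log_div hy.ne' hx.ne'] at this
      calc x * (Real.log y - Real.log x) ≤ x * (y / x - 1) := by gcongr
        _ = h := by rw [hh]; field_simp
    have hhs : h ≤ √h := by nlinarith
    have h5 : x * Real.log x - y * Real.log y
        = -(x * (Real.log y - Real.log x)) - h * Real.log y := by rw [hh]; ring
    have h6 : 0 ≤ x * (Real.log y - Real.log x) := mul_nonneg hx0 (by linarith)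
    have h7 : h * Real.log h ≤ h * Real.log y := by gcongr
    have h8 : h * Real.log y ≤ 0 := mul_nonpos_of_nonneg_of_nonpos hh0.le hly
    constructor <;> linarith

/-! ### The randomness at a single vertex and the standing assumptions. -/

/-- The randomness at one vertex. -/
abbrev Root (b : ℕ) : Type := (Fin b → ℝ) × (ℕ → ℝ)

/-- The law of the sequence of numbers at one vertex. -/
def unifSeqLaw : Measure (ℕ → ℝ) := Measure.infinitePi fun _ : ℕ => uniformLaw

instance : IsProbabilityMeasure unifSeqLaw := by unfold unifSeqLaw; infer_instance

/-- The law of the randomness at one vertex. -/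
def rootLaw {b : ℕ} (σ : Measure (Fin b → ℝ)) : Measure (Root b) := σ.prod unifSeqLaw

instance {b : ℕ} (σ : Measure (Fin b → ℝ)) [IsProbabilityMeasure σ] :
    IsProbabilityMeasure (rootLaw σ) := by unfold rootLaw; infer_instance

/-- The randomness at a vertex takes sensible values. -/
def Good {b : ℕ} (r : Root b) : Prop :=
  r.1 ∈ stdSimplex ℝ (Fin b) ∧ ∀ k, r.2 k ∈ Set.Ico (0 : ℝ) 1

/-- The standing assumptions on the parameters of the split tree. -/
structure Setting (b s s₀ s₁ : ℕ) (σ : Measure (Fin b → ℝ)) : Prop where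
  two_le : 2 ≤ b
  one_le : 1 ≤ s
  le_s : s₀ ≤ s
  le_succ : b * s₁ + s₀ ≤ s + 1
  simplex : ∀ᵐ v ∂σ, v ∈ stdSimplex ℝ (Fin b)
  max_lt : ∀ᵐ v ∂σ, ⨆ j, v j < 1

/-! ### Routing of a single item. -/

section GoesTo

variable {b : ℕ} {v : Fin b → ℝ} {x : ℝ}

theorem Iic_sum_le_Iio_sum (hv : ∀ j, 0 ≤ v j) {i j : Fin b} (hij : i < j) :
    ∑ k ∈ Finset.Iic i, v k ≤ ∑ k ∈ Finset.Iio j, v k :=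
  Finset.sum_le_sum_of_subset_of_nonneg
    (fun _ hk => Finset.mem_Iio.2 ((Finset.mem_Iic.1 hk).trans_lt hij)) fun k _ _ => hv k

theorem GoesTo.unique (hv : ∀ j, 0 ≤ v j) {i j : Fin b} (hi : GoesTo v x i) (hj : GoesTo v x j) :
    i = j := by
  rcases lt_trichotomy i j with h | h | h
  · linarith [hi.2, hj.1, Iic_sum_le_Iio_sum hv h]
  · exact h
  · linarith [hj.2, hi.1, Iic_sum_le_Iio_sum hv h]

theorem exists_goesTo (hv : v ∈ stdSimplex ℝ (Fin b)) (hx : x ∈ Set.Ico (0 : ℝ) 1) :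
    ∃ i, GoesTo v x i := by
  have hb : 0 < b := by
    rcases Nat.eq_zero_or_pos b with rfl | h
    · have := hv.2; simp at this
    · exact h
  have hne : (Finset.univ.filter fun i : Fin b => x < ∑ k ∈ Finset.Iic i, v k).Nonempty := by
    refine ⟨⟨b - 1, by omega⟩, Finset.mem_filter.2 ⟨Finset.mem_univ _, ?_⟩⟩
    have : Finset.Iic (⟨b - 1, by omega⟩ : Fin b) = Finset.univ := by
      ext k; simp [Fin.le_def]; omega
    rw [this, hv.2]; exact hx.2
  -- The item goes to the first child whose cumulative weight exceeds `x`; minimality gives the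
  -- lower bound through the preceding index.
  set i := Finset.min' _ hne with hi
  have himem := Finset.min'_mem _ hne
  rw [← hi, Finset.mem_filter] at himem
  refine ⟨i, ?_, himem.2⟩
  rcases Nat.eq_zero_or_pos i.1 with h0 | h0
  · have : Finset.Iio i = ∅ := by
      ext k; simp only [Finset.mem_Iio, Finset.notMem_empty, iff_false, Fin.lt_def]; omega
    rw [this]; simpa using hx.1
  · set j : Fin b := ⟨i.1 - 1, by omega⟩ with hj
    have hji : j < i := by rw [Fin.lt_def]; simp only [hj]; omega
    have : Finset.Iio i = Finset.Iic j := by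
      ext k; simp only [Finset.mem_Iio, Finset.mem_Iic, Fin.lt_def, Fin.le_def, hj]; omega
    rw [this]
    by_contra! hc
    have := Finset.min'_le (Finset.univ.filter fun i : Fin b => x < ∑ k ∈ Finset.Iic i, v k) j
      (Finset.mem_filter.2 ⟨Finset.mem_univ j, hc⟩)
    rw [← hi] at this
    exact absurd hji (not_lt.2 this)

open Classical in
/-- The indicator that an item with number `x` goes to child `i`. -/
def chi (v : Fin b → ℝ) (x : ℝ) (i : Fin b) : ℝ := if GoesTo v x i then 1 else 0

theorem chi_nonneg (i : Fin b) : 0 ≤ chi v x i := by unfold chi; split_ifs <;> norm_num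

theorem chi_le_one (i : Fin b) : chi v x i ≤ 1 := by unfold chi; split_ifs <;> norm_num

theorem sum_chi (hv : v ∈ stdSimplex ℝ (Fin b)) (hx : x ∈ Set.Ico (0 : ℝ) 1) :
    ∑ i, chi v x i = 1 := by
  obtain ⟨i, hi⟩ := exists_goesTo hv hx
  rw [Finset.sum_eq_single i]
  · simp [chi, hi]
  · intro j _ hji
    have : ¬ GoesTo v x j := fun h => hji (h.unique hv.1 hi)
    simp [chi, this]
  · simp

theorem measurableSet_goesTo (i : Fin b) :
    MeasurableSet {p : (Fin b → ℝ) × ℝ | GoesTo p.1 p.2 i} := by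
  have h1 : Measurable fun p : (Fin b → ℝ) × ℝ => ∑ j ∈ Finset.Iio i, p.1 j :=
    Finset.measurable_fun_sum _ fun j _ => (measurable_pi_apply j).comp measurable_fst
  have h2 : Measurable fun p : (Fin b → ℝ) × ℝ => ∑ j ∈ Finset.Iic i, p.1 j :=
    Finset.measurable_fun_sum _ fun j _ => (measurable_pi_apply j).comp measurable_fst
  exact (measurableSet_le h1 measurable_snd).inter (measurableSet_lt measurable_snd h2)

theorem measurable_chi (i : Fin b) :
    Measurable fun p : (Fin b → ℝ) × ℝ => chi p.1 p.2 i := by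
  unfold chi
  exact Measurable.ite (measurableSet_goesTo i) measurable_const measurable_const

theorem integral_chi (hv : v ∈ stdSimplex ℝ (Fin b)) (i : Fin b) :
    ∫ x, chi v x i ∂uniformLaw = v i := by
  have hins : Finset.Iic i = insert i (Finset.Iio i) := by
    ext k; simp [le_iff_eq_or_lt]
  have hsplit : ∑ j ∈ Finset.Iic i, v j = v i + ∑ j ∈ Finset.Iio i, v j := by
    rw [hins, Finset.sum_insert (by simp)]
  have h0 : 0 ≤ ∑ j ∈ Finset.Iio i, v j := Finset.sum_nonneg fun j _ => hv.1 j
  have h1 : ∑ j ∈ Finset.Iic i, v j ≤ 1 := by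
    rw [← hv.2]
    exact Finset.sum_le_sum_of_subset_of_nonneg (Finset.subset_univ _) fun j _ _ => hv.1 j
  have hset : (fun x => chi v x i) = (Set.Ico (∑ j ∈ Finset.Iio i, v j)
      (∑ j ∈ Finset.Iic i, v j)).indicator fun _ => (1 : ℝ) := by
    ext x
    simp only [chi, GoesTo, Set.indicator, Set.mem_Ico]
    congr
  rw [hset, integral_indicator_const _ measurableSet_Ico, uniformLaw,
    measureReal_restrict_apply measurableSet_Ico, Set.inter_eq_left.2 (Set.Ico_subset_Ico h0 h1),
    Real.volume_real_Ico, hsplit]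
  have := hv.1 i
  simp [this]

end GoesTo

/-! ### Independent routing of many items. -/

section UnifSeq

variable {b : ℕ} {v : Fin b → ℝ}

theorem measurable_chi_eval (v : Fin b → ℝ) (i : Fin b) : Measurable fun y => chi v y i :=
  (measurable_chi i).comp (measurable_const.prodMk measurable_id)

theorem integral_chi_eval (hv : v ∈ stdSimplex ℝ (Fin b)) (i : Fin b) (k : ℕ) :
    ∫ x, chi v (x k) i ∂unifSeqLaw = v i := by
  have := (measurePreserving_eval_infinitePi (fun _ : ℕ => uniformLaw) k).map_eq
  rw [← integral_chi hv i]
  change _ = ∫ x, chi v x i ∂((fun _ : ℕ => uniformLaw) k)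
  rw [← this, integral_map (measurable_pi_apply k).aemeasurable
    (measurable_chi_eval v i).aestronglyMeasurable]
  rfl

theorem indep_chi (v : Fin b → ℝ) (i : ℕ → Fin b) :
    iIndepFun (fun (k : ℕ) (x : ℕ → ℝ) => chi v (x k) (i k)) unifSeqLaw :=
  iIndepFun_infinitePi (P := fun _ : ℕ => uniformLaw) (X := fun k y => chi v y (i k))
    fun k => measurable_chi_eval v (i k)

theorem memLp_chi (v : Fin b → ℝ) (i : Fin b) (k : ℕ) (p : ENNReal) :
    MemLp (fun x : ℕ → ℝ => chi v (x k) i) p unifSeqLaw :=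
  MemLp.of_bound ((measurable_chi_eval v i).comp (measurable_pi_apply k)).aestronglyMeasurable 1
    (ae_of_all _ fun x => by rw [Real.norm_of_nonneg (chi_nonneg i)]; exact chi_le_one i)

theorem integral_chi_mul_chi (hv : v ∈ stdSimplex ℝ (Fin b)) (i : Fin b) :
    ∫ x, chi v (x 0) i * chi v (x 1) i ∂unifSeqLaw = v i * v i := by
  have h := (indep_chi v fun _ => i).indepFun (show (0 : ℕ) ≠ 1 by norm_num)
  rw [h.integral_fun_mul_eq_mul_integral (memLp_chi v i 0 1).1 (memLp_chi v i 1 1).1,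
    integral_chi_eval hv, integral_chi_eval hv]

/-- The left side is the variance of a sum of independent indicators, each of variance at most
`1/4`; the cruder bound `1` suffices. -/
theorem integral_sq_sum_chi_sub (hv : v ∈ stdSimplex ℝ (Fin b)) (i : Fin b) (m : ℕ) :
    ∫ x, (∑ k ∈ Finset.range m, chi v (x k) i - m * v i) ^ 2 ∂unifSeqLaw ≤ m := by
  have hmean : ∫ x, (∑ k ∈ Finset.range m, fun x : ℕ → ℝ => chi v (x k) i) x ∂unifSeqLaw
      = m * v i := by
    simp only [Finset.sum_apply]
    rw [integral_finsetSum _ fun k _ => (memLp_chi v i k 1).integrable le_rfl]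
    simp [integral_chi_eval hv]
  have hL : MemLp (∑ k ∈ Finset.range m, fun x : ℕ → ℝ => chi v (x k) i) 2 unifSeqLaw :=
    memLp_finsetSum' _ fun k _ => memLp_chi v i k 2
  have hvar := IndepFun.variance_sum (μ := unifSeqLaw)
    (X := fun (k : ℕ) (x : ℕ → ℝ) => chi v (x k) i) (s := Finset.range m)
    (fun k _ => memLp_chi v i k 2)
    fun k _ l _ hkl => (indep_chi v fun _ => i).indepFun hkl
  rw [variance_eq_integral hL.1.aemeasurable, hmean] at hvar
  simp only [Finset.sum_apply] at hvar
  rw [hvar]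
  calc ∑ k ∈ Finset.range m, Var[fun x : ℕ → ℝ => chi v (x k) i; unifSeqLaw]
      ≤ ∑ k ∈ Finset.range m, 1 := by
        refine Finset.sum_le_sum fun k _ => ?_
        refine (variance_le_sq_of_bounded (a := 0) (b := 1)
          (ae_of_all _ fun x => ⟨chi_nonneg i, chi_le_one i⟩)
          (memLp_chi v i k 1).1.aemeasurable).trans ?_
        norm_num
    _ = m := by simp

end UnifSeq

/-! ### Child counts. -/

section Counts

variable {b : ℕ} (s s₀ s₁ : ℕ)

/-- The number of items in the subtree of child `j`, when the root holds `n` items. -/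
def cnt (n : ℕ) (r : Root b) (j : Fin b) : ℕ := childCount b s s₀ s₁ r.1 r.2 n j

variable {s s₀ s₁} {σ : Measure (Fin b → ℝ)}

theorem cnt_of_le {n : ℕ} (hn : n ≤ s) (r : Root b) (j : Fin b) : cnt s s₀ s₁ n r j = 0 := by
  simp [cnt, childCount, hn]

open Classical in
theorem cnt_of_lt {n : ℕ} (hn : s < n) (r : Root b) (j : Fin b) : cnt s s₀ s₁ n r j =
    s₁ + ((Finset.range (n - s₀ - b * s₁)).filter fun k => GoesTo r.1 (r.2 k) j).card := by
  simp [cnt, childCount, not_le.2 hn]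

theorem cast_cnt {n : ℕ} (hn : s < n) (r : Root b) (j : Fin b) : (cnt s s₀ s₁ n r j : ℝ) =
    s₁ + ∑ k ∈ Finset.range (n - s₀ - b * s₁), chi r.1 (r.2 k) j := by
  classical
  rw [cnt_of_lt hn]
  push_cast
  congr 1
  simp only [chi]
  rw [Finset.sum_boole]

theorem measurable_chi_root (k : ℕ) (i : Fin b) :
    Measurable fun r : Root b => chi r.1 (r.2 k) i :=
  (measurable_chi i).comp (measurable_fst.prodMk ((measurable_pi_apply k).comp measurable_snd))

theorem measurable_cnt (n : ℕ) (j : Fin b) : Measurable fun r : Root b => cnt s s₀ s₁ n r j := by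
  classical
  rcases le_or_gt n s with hn | hn
  · simp_rw [cnt_of_le hn]; exact measurable_const
  · simp_rw [cnt_of_lt hn, Finset.card_filter]
    refine measurable_const.add (Finset.measurable_fun_sum _ fun k _ => ?_)
    refine Measurable.ite ?_ measurable_const measurable_const
    have hm : Measurable fun r : Root b => (r.1, r.2 k) :=
      measurable_fst.prodMk ((measurable_pi_apply k).comp measurable_snd)
    exact hm (measurableSet_goesTo j)

theorem Setting.sub_add (H : Setting b s s₀ s₁ σ) {n : ℕ} (hn : s < n) :
    n - s₀ - b * s₁ + s₀ + b * s₁ = n := by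
  have := H.le_succ; omega

theorem Setting.cnt_le (H : Setting b s s₀ s₁ σ) (n : ℕ) (r : Root b) (j : Fin b) :
    cnt s s₀ s₁ n r j ≤ n := by
  classical
  rcases le_or_gt n s with hn | hn
  · rw [cnt_of_le hn]; omega
  · rw [cnt_of_lt hn]
    have h1 := Finset.card_filter_le (Finset.range (n - s₀ - b * s₁))
      (fun k => GoesTo r.1 (r.2 k) j)
    rw [Finset.card_range] at h1
    have h2 := H.sub_add hn
    have h3 : s₁ ≤ b * s₁ := Nat.le_mul_of_pos_left _ (by have := H.two_le; omega)
    omega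

theorem Setting.sum_cnt (H : Setting b s s₀ s₁ σ) {n : ℕ} (hn : s < n) {r : Root b}
    (hr : Good r) : ∑ j, cnt s s₀ s₁ n r j + s₀ = n := by
  have h : (((∑ j, cnt s s₀ s₁ n r j + s₀ : ℕ)) : ℝ) = (n : ℝ) := by
    push_cast
    simp_rw [cast_cnt hn]
    rw [Finset.sum_add_distrib, Finset.sum_comm]
    simp_rw [fun k => sum_chi hr.1 (hr.2 k)]
    have := H.sub_add hn
    simp only [Finset.sum_const, Finset.card_univ, Fintype.card_fin, Finset.card_range,
      nsmul_eq_mul, mul_one]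
    have h2 : ((n - s₀ - b * s₁ + s₀ + b * s₁ : ℕ) : ℝ) = n := by rw [this]
    push_cast at h2
    linarith
  exact_mod_cast h

theorem Setting.sum_cnt_real (H : Setting b s s₀ s₁ σ) {n : ℕ} (hn : s < n) {r : Root b}
    (hr : Good r) : ∑ j, (cnt s s₀ s₁ n r j : ℝ) = n - s₀ := by
  have := H.sum_cnt hn hr
  have h : ((∑ j, cnt s s₀ s₁ n r j + s₀ : ℕ) : ℝ) = n := by rw [this]
  push_cast at h
  linarith

theorem ae_good [IsProbabilityMeasure σ] (hs : ∀ᵐ v ∂σ, v ∈ stdSimplex ℝ (Fin b)) :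
    ∀ᵐ r ∂rootLaw σ, Good r := by
  have h1 : ∀ᵐ r ∂rootLaw σ, r.1 ∈ stdSimplex ℝ (Fin b) :=
    Measure.quasiMeasurePreserving_fst.ae hs
  have h2 : ∀ᵐ x ∂unifSeqLaw, ∀ k, x k ∈ Set.Ico (0 : ℝ) 1 := by
    rw [ae_all_iff]
    intro k
    have h3 : ∀ᵐ y ∂uniformLaw, y ∈ Set.Ico (0 : ℝ) 1 := ae_restrict_mem measurableSet_Ico
    exact (measurePreserving_eval_infinitePi (fun _ : ℕ => uniformLaw) k).quasiMeasurePreserving.ae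
      h3
  have h3 : ∀ᵐ r ∂rootLaw σ, ∀ k, r.2 k ∈ Set.Ico (0 : ℝ) 1 :=
    Measure.quasiMeasurePreserving_snd.ae h2
  filter_upwards [h1, h3] with r h1 h3 using ⟨h1, h3⟩

theorem sum_sq_add_mul_le {N : Fin b → ℕ} {i j : Fin b} (hij : i ≠ j) :
    ∑ k, N k ^ 2 + N i * N j ≤ (∑ k, N k) ^ 2 := by
  have hS : N i + N j ≤ ∑ k, N k := by
    rw [← Finset.sum_pair hij]
    exact Finset.sum_le_sum_of_subset (Finset.subset_univ _)
  calc ∑ k, N k ^ 2 + N i * N j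
      = ∑ k, N k ^ 2 + ∑ k, (if k = i then N i * N j else 0) := by simp
    _ = ∑ k, (N k ^ 2 + if k = i then N i * N j else 0) := by rw [Finset.sum_add_distrib]
    _ ≤ ∑ k, N k * ∑ l, N l := by
        refine Finset.sum_le_sum fun k _ => ?_
        split_ifs with h
        · subst h; nlinarith
        · rw [add_zero, sq]
          exact Nat.mul_le_mul_left _ (Finset.single_le_sum (fun _ _ => Nat.zero_le _)
            (Finset.mem_univ k))
    _ = _ := by rw [← Finset.sum_mul, sq]

/-- The items do not all end up in one child if the first two items are separated. -/
theorem Setting.sum_sq_cnt_le (H : Setting b s s₀ s₁ σ) {n : ℕ} (hn : s < n) {r : Root b}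
    (hr : Good r) : ∑ j, (cnt s s₀ s₁ n r j : ℝ) ^ 2 ≤
      n ^ 2 - 1 + ∑ j, chi r.1 (r.2 0) j * chi r.1 (r.2 1) j := by
  classical
  have hsum := H.sum_cnt hn hr
  have hsq : ∑ j, (cnt s s₀ s₁ n r j) ^ 2 ≤ (∑ j, cnt s s₀ s₁ n r j) ^ 2 :=
    Finset.sum_sq_le_sq_sum_of_nonneg fun _ _ => Nat.zero_le _
  have hchi0 : 0 ≤ ∑ j, chi r.1 (r.2 0) j * chi r.1 (r.2 1) j :=
    Finset.sum_nonneg fun j _ => mul_nonneg (chi_nonneg j) (chi_nonneg j)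
  obtain ⟨i, hi⟩ := exists_goesTo hr.1 (hr.2 0)
  obtain ⟨j, hj⟩ := exists_goesTo hr.1 (hr.2 1)
  by_cases hij : i = j
  · subst hij
    have h1 : 1 ≤ ∑ j, chi r.1 (r.2 0) j * chi r.1 (r.2 1) j := by
      refine le_trans (le_of_eq ?_) (Finset.single_le_sum
        (f := fun j => chi r.1 (r.2 0) j * chi r.1 (r.2 1) j)
        (fun j _ => mul_nonneg (chi_nonneg j) (chi_nonneg j)) (Finset.mem_univ i))
      simp [chi, hi, hj]
    have h2 : ∑ j, (cnt s s₀ s₁ n r j) ^ 2 ≤ n ^ 2 :=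
      hsq.trans (Nat.pow_le_pow_left (by omega) 2)
    have h3 : ∑ j, (cnt s s₀ s₁ n r j : ℝ) ^ 2 ≤ (n : ℝ) ^ 2 := by exact_mod_cast h2
    linarith
  · have h2 : ∑ j, (cnt s s₀ s₁ n r j) ^ 2 + 1 ≤ n ^ 2 := by
      -- If the root keeps an item, the counts sum to at most `n - 1`. Otherwise the cross term `N_i
      -- N_j` supplies the missing unit: both counts are positive, through the `s₁` items given to
      -- every child or, when `s₁ = 0`, through the first two items, which exist because `n > s ≥
      -- 1`.
      rcases Nat.eq_zero_or_pos s₀ with h0 | h0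
      · have h3 := sum_sq_add_mul_le (N := cnt s s₀ s₁ n r) hij
        have hS : ∑ j, cnt s s₀ s₁ n r j = n := by omega
        rw [hS] at h3
        refine le_trans (Nat.add_le_add_left ?_ _) h3
        have hm := H.sub_add hn
        have hone : 1 ≤ s := H.one_le
        suffices 1 ≤ cnt s s₀ s₁ n r i ∧ 1 ≤ cnt s s₀ s₁ n r j by nlinarith [this.1, this.2]
        rcases Nat.eq_zero_or_pos s₁ with h1 | h1
        · subst h0 h1
          simp only [mul_zero, add_zero, Nat.sub_zero] at hm
          rw [cnt_of_lt hn, cnt_of_lt hn]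
          constructor
          · refine le_add_left (Finset.card_pos.2 ⟨0, ?_⟩)
            simp only [Finset.mem_filter, Finset.mem_range, mul_zero, Nat.sub_zero]
            exact ⟨by omega, hi⟩
          · refine le_add_left (Finset.card_pos.2 ⟨1, ?_⟩)
            simp only [Finset.mem_filter, Finset.mem_range, mul_zero, Nat.sub_zero]
            exact ⟨by omega, hj⟩
        · rw [cnt_of_lt hn, cnt_of_lt hn]
          omega
      · have : ∑ j, cnt s s₀ s₁ n r j + 1 ≤ n := by omega
        have h4 := Nat.pow_le_pow_left this 2
        nlinarith [Nat.zero_le (∑ j, cnt s s₀ s₁ n r j)]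
    have h3 : ∑ j, (cnt s s₀ s₁ n r j : ℝ) ^ 2 + 1 ≤ (n : ℝ) ^ 2 := by exact_mod_cast h2
    linarith

end Counts

/-! ### Moments of the child counts and the maximum principle. -/

section Moments

variable {b s s₀ s₁ : ℕ} {σ : Measure (Fin b → ℝ)} [IsProbabilityMeasure σ]

/-- The mean of `∑ⱼ Vⱼ²`. -/
def kappa (σ : Measure (Fin b → ℝ)) : ℝ := ∫ v, ∑ j, v j ^ 2 ∂σ

theorem integral_rootLaw_fst (f : (Fin b → ℝ) → ℝ) :
    ∫ r, f r.1 ∂rootLaw σ = ∫ v, f v ∂σ := by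
  have := integral_fun_fst (μ := σ) (ν := unifSeqLaw) f
  simpa [rootLaw] using this

theorem Setting.integrable_of_le_one (H : Setting b s s₀ s₁ σ) {f : (Fin b → ℝ) → ℝ}
    (hf : Measurable f) {C : ℝ} (h : ∀ v ∈ stdSimplex ℝ (Fin b), |f v| ≤ C) : Integrable f σ :=
  Integrable.of_bound hf.aestronglyMeasurable C (by filter_upwards [H.simplex] with v hv using h v hv)

theorem sum_sq_le_one_of_mem_stdSimplex {v : Fin b → ℝ} (hv : v ∈ stdSimplex ℝ (Fin b)) :
    ∑ j, v j ^ 2 ≤ 1 := by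
  rw [← hv.2]
  exact Finset.sum_le_sum fun j _ => by
    have := hv.1 j; have := le_one_of_mem_stdSimplex hv j; nlinarith

theorem Setting.integrable_sum_sq (H : Setting b s s₀ s₁ σ) :
    Integrable (fun v : Fin b → ℝ => ∑ j, v j ^ 2) σ :=
  H.integrable_of_le_one (by fun_prop) (C := 1) fun v hv => by
    rw [abs_of_nonneg (Finset.sum_nonneg fun _ _ => sq_nonneg _)]
    exact sum_sq_le_one_of_mem_stdSimplex hv

/-- A convex combination of the entries is at most the largest one, which is almost surely less than
`1`. This strict inequality is the source of every contraction below. -/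
theorem Setting.kappa_lt_one (H : Setting b s s₀ s₁ σ) : kappa σ < 1 := by
  have hlt : ∀ᵐ v ∂σ, ∑ j, v j ^ 2 < 1 := by
    filter_upwards [H.simplex, H.max_lt] with v hv hm
    calc ∑ j, v j ^ 2 ≤ ∑ j, v j * ⨆ i, v i := by
          refine Finset.sum_le_sum fun j _ => ?_
          rw [sq]
          exact mul_le_mul_of_nonneg_left (le_ciSup (Set.finite_range v).bddAbove j) (hv.1 j)
      _ = ⨆ i, v i := by rw [← Finset.sum_mul, hv.2, one_mul]
      _ < 1 := hm
  have hInt : Integrable (fun v : Fin b → ℝ => 1 - ∑ j, v j ^ 2) σ :=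
    (integrable_const _).sub H.integrable_sum_sq
  have h2 : 0 < ∫ v, (1 - ∑ j, v j ^ 2) ∂σ := by
    rw [integral_pos_iff_support_of_nonneg_ae _ hInt]
    · refine (pos_iff_ne_zero).2 fun h => ?_
      have h' := measure_eq_zero_iff_ae_notMem.1 h
      obtain ⟨v, h1, h2⟩ := (hlt.and h').exists
      exact h2 (sub_pos.2 h1).ne'
    · filter_upwards [hlt] with v hv using (sub_pos.2 hv).le
  rw [integral_sub (integrable_const _) H.integrable_sum_sq] at h2
  simp only [integral_const, probReal_univ, one_smul] at h2
  unfold kappa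
  linarith

theorem kappa_nonneg : 0 ≤ kappa σ :=
  integral_nonneg fun _ => Finset.sum_nonneg fun _ _ => sq_nonneg _

theorem Setting.abs_le_sum_range (H : Setting b s s₀ s₁ σ) (f : ℕ → ℝ) (n : ℕ) (r : Root b)
    (j : Fin b) : |f (cnt s s₀ s₁ n r j)| ≤ ∑ k ∈ Finset.range (n + 1), |f k| :=
  Finset.single_le_sum (f := fun k => |f k|) (fun _ _ => abs_nonneg _)
    (Finset.mem_range.2 (Nat.lt_succ_of_le (H.cnt_le n r j)))

theorem Setting.integrable_mul_cnt (H : Setting b s s₀ s₁ σ) (f : ℕ → ℝ) (n : ℕ) (j : Fin b)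
    {θ : Root b → ℝ} (hθ : Measurable θ) {c : ℝ} (hc : ∀ᵐ r ∂rootLaw σ, |θ r| ≤ c) :
    Integrable (fun r => θ r * f (cnt s s₀ s₁ n r j)) (rootLaw σ) := by
  refine Integrable.of_bound (hθ.mul
    ((measurable_of_countable f).comp (measurable_cnt n j))).aestronglyMeasurable
    (c * ∑ k ∈ Finset.range (n + 1), |f k|) ?_
  filter_upwards [hc] with r hr
  rw [Real.norm_eq_abs, abs_mul]
  exact mul_le_mul hr (H.abs_le_sum_range f n r j) (abs_nonneg _) ((abs_nonneg _).trans hr)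

theorem Setting.integrable_cnt (H : Setting b s s₀ s₁ σ) (f : ℕ → ℝ) (n : ℕ) (j : Fin b) :
    Integrable (fun r => f (cnt s s₀ s₁ n r j)) (rootLaw σ) := by
  simpa using H.integrable_mul_cnt f n j (θ := fun _ => 1) measurable_const (c := 1) (by simp)

theorem Setting.integrable_sum_cnt (H : Setting b s s₀ s₁ σ) (f : ℕ → ℝ) (n : ℕ) :
    Integrable (fun r => ∑ j, f (cnt s s₀ s₁ n r j)) (rootLaw σ) :=
  integrable_finsetSum _ fun j _ => H.integrable_cnt f n j

theorem Setting.integral_sum_chi_mul_chi (H : Setting b s s₀ s₁ σ) :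
    ∫ r, ∑ j, chi r.1 (r.2 0) j * chi r.1 (r.2 1) j ∂rootLaw σ = kappa σ := by
  have hInt : ∀ j, Integrable (fun r : Root b => chi r.1 (r.2 0) j * chi r.1 (r.2 1) j)
      (rootLaw σ) := fun j =>
    Integrable.of_bound ((measurable_chi_root 0 j).mul
      (measurable_chi_root 1 j)).aestronglyMeasurable 1 (ae_of_all _ fun r => by
        rw [Real.norm_of_nonneg (mul_nonneg (chi_nonneg j) (chi_nonneg j))]
        exact mul_le_one₀ (chi_le_one j) (chi_nonneg j) (chi_le_one j))
  unfold kappa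
  rw [integral_finsetSum _ fun j _ => hInt j, integral_finsetSum]
  · refine Finset.sum_congr rfl fun j _ => ?_
    have := integral_prod _ (hInt j)
    rw [rootLaw, this]
    refine integral_congr_ae ?_
    filter_upwards [H.simplex] with v hv
    rw [sq, ← integral_chi_mul_chi hv]
  · intro j _
    exact H.integrable_of_le_one (by fun_prop) (C := 1) fun v hv => by
      rw [abs_of_nonneg (sq_nonneg _)]
      have := hv.1 j; have := le_one_of_mem_stdSimplex hv j; nlinarith

/-- The first two routing numbers select the same child with probability `κ`. The resulting gap `1 -
κ` holds for every `n > s`, not only asymptotically, and therefore serves recursions that have to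
start at `s + 1`. -/
theorem Setting.integral_sum_sq_cnt_le (H : Setting b s s₀ s₁ σ) {n : ℕ} (hn : s < n) :
    ∫ r, ∑ j, (cnt s s₀ s₁ n r j : ℝ) ^ 2 ∂rootLaw σ ≤ n ^ 2 - (1 - kappa σ) := by
  have hInt : Integrable (fun r : Root b => ∑ j, chi r.1 (r.2 0) j * chi r.1 (r.2 1) j)
      (rootLaw σ) := integrable_finsetSum _ fun j _ =>
    Integrable.of_bound ((measurable_chi_root 0 j).mul
      (measurable_chi_root 1 j)).aestronglyMeasurable 1 (ae_of_all _ fun r => by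
        rw [Real.norm_of_nonneg (mul_nonneg (chi_nonneg j) (chi_nonneg j))]
        exact mul_le_one₀ (chi_le_one j) (chi_nonneg j) (chi_le_one j))
  have h := integral_mono_ae (H.integrable_sum_cnt (fun k => (k : ℝ) ^ 2) n)
    ((integrable_const ((n : ℝ) ^ 2 - 1)).add hInt)
    (by filter_upwards [ae_good H.simplex] with r hr using H.sum_sq_cnt_le hn hr)
  simp only [Pi.add_apply] at h
  rw [integral_add (integrable_const _) hInt, H.integral_sum_chi_mul_chi] at h
  simp only [integral_const, probReal_univ, one_smul] at h
  linarith

/-- The count deviates from `n v_j` by a centred binomial deviation and by the effect of the at most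
`s + 1` items that are not routed at random. -/
theorem Setting.sq_cnt_sub_le (H : Setting b s s₀ s₁ σ) {n : ℕ} (hn : s < n) {r : Root b}
    (hr : r.1 ∈ stdSimplex ℝ (Fin b)) (j : Fin b) :
    (cnt s s₀ s₁ n r j - n * r.1 j : ℝ) ^ 2 ≤
      2 * (∑ k ∈ Finset.range (n - s₀ - b * s₁), chi r.1 (r.2 k) j
        - (n - s₀ - b * s₁ : ℕ) * r.1 j) ^ 2 + 2 * (s + 1) ^ 2 := by
  set m := n - s₀ - b * s₁ with hm
  have hmn : (m : ℝ) + s₀ + b * s₁ = n := by exact_mod_cast H.sub_add hn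
  have h1 : (b : ℝ) * s₁ + s₀ ≤ s + 1 := by exact_mod_cast H.le_succ
  have hv0 := hr.1 j
  have hv1 := le_one_of_mem_stdSimplex hr j
  have hs1 : (s₁ : ℝ) ≤ s + 1 := by
    have : s₁ ≤ b * s₁ := Nat.le_mul_of_pos_left _ (by have := H.two_le; omega)
    have := H.le_succ
    exact_mod_cast (by omega : s₁ ≤ s + 1)
  rw [cast_cnt hn]
  set B := ∑ k ∈ Finset.range m, chi r.1 (r.2 k) j
  have h2 : ((s₁ : ℝ) - (n - m) * r.1 j) ^ 2 ≤ ((s : ℝ) + 1) ^ 2 := by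
    have h3 : (0 : ℝ) ≤ n - m := by rw [← hmn]; have : (0:ℝ) ≤ s₀ + b * s₁ := by positivity
                                    linarith
    have h4 : (n : ℝ) - m ≤ s + 1 := by linarith
    have h5 : (n - m : ℝ) * r.1 j ≤ s + 1 := by nlinarith
    have h6 : 0 ≤ (n - m : ℝ) * r.1 j := mul_nonneg h3 hv0
    have h7 : (0 : ℝ) ≤ s₁ := by positivity
    exact sq_le_sq' (by linarith) (by linarith)
  have h3 : (s₁ + B - n * r.1 j) = (B - m * r.1 j) + (s₁ - (n - m) * r.1 j) := by ring
  rw [h3]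
  nlinarith [sq_nonneg ((B - m * r.1 j) - (s₁ - (n - m) * r.1 j))]

variable (s) in
/-- The constant in the variance bound for the child counts. -/
def varConst : ℝ := 2 + 2 * ((s : ℝ) + 1) ^ 2

theorem varConst_pos : 0 < varConst s := by unfold varConst; positivity

theorem Setting.integrable_sq_cnt_sub (H : Setting b s s₀ s₁ σ) (n : ℕ) (j : Fin b) :
    Integrable (fun r : Root b => (cnt s s₀ s₁ n r j - n * r.1 j : ℝ) ^ 2) (rootLaw σ) := by
  have hm : Measurable fun r : Root b => (cnt s s₀ s₁ n r j - n * r.1 j : ℝ) ^ 2 := by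
    have h1 : Measurable fun r : Root b => (cnt s s₀ s₁ n r j : ℝ) :=
      (measurable_of_countable (fun k : ℕ => (k : ℝ))).comp (measurable_cnt n j)
    have h2 : Measurable fun r : Root b => r.1 j := (measurable_pi_apply j).comp measurable_fst
    exact (h1.sub (h2.const_mul _)).pow_const 2
  refine Integrable.of_bound hm.aestronglyMeasurable ((n : ℝ) ^ 2) ?_
  filter_upwards [ae_good H.simplex] with r hr
  rw [Real.norm_of_nonneg (sq_nonneg _)]
  have h0 := hr.1.1 j
  have h1 := le_one_of_mem_stdSimplex hr.1 j
  have h2 : (cnt s s₀ s₁ n r j : ℝ) ≤ n := by exact_mod_cast H.cnt_le n r j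
  have h3 : (0 : ℝ) ≤ cnt s s₀ s₁ n r j := by positivity
  have h4 : (0 : ℝ) ≤ n := by positivity
  refine sq_le_sq' ?_ ?_ <;> nlinarith

theorem Setting.integral_sq_cnt_sub_le (H : Setting b s s₀ s₁ σ) {n : ℕ} (hn : s < n)
    (j : Fin b) :
    ∫ r, (cnt s s₀ s₁ n r j - n * r.1 j : ℝ) ^ 2 ∂rootLaw σ ≤ varConst s * n := by
  have hInt := H.integrable_sq_cnt_sub n j
  rw [rootLaw] at hInt ⊢
  rw [integral_prod _ hInt]
  have hn1 : (1 : ℝ) ≤ n := by exact_mod_cast (by omega : 1 ≤ n)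
  have hle : ∀ᵐ v ∂σ, ∫ x, (cnt s s₀ s₁ n (v, x) j - n * v j : ℝ) ^ 2 ∂unifSeqLaw ≤
      varConst s * n := by
    filter_upwards [H.simplex, hInt.prod_right_ae] with v hv hvint
    set m := n - s₀ - b * s₁ with hm
    have hL : MemLp (fun x : ℕ → ℝ => ∑ k ∈ Finset.range m, chi v (x k) j - m * v j) 2
        unifSeqLaw := (memLp_finsetSum _ fun k _ => memLp_chi v j k 2).sub (memLp_const _)
    have hi : Integrable (fun x : ℕ → ℝ =>
        2 * (∑ k ∈ Finset.range m, chi v (x k) j - m * v j) ^ 2) unifSeqLaw :=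
      hL.integrable_sq.const_mul 2
    calc ∫ x, (cnt s s₀ s₁ n (v, x) j - n * v j : ℝ) ^ 2 ∂unifSeqLaw
        ≤ ∫ x, (2 * (∑ k ∈ Finset.range m, chi v (x k) j - m * v j) ^ 2
            + 2 * ((s : ℝ) + 1) ^ 2) ∂unifSeqLaw := by
          refine integral_mono hvint (hi.add (integrable_const _)) fun x => ?_
          exact H.sq_cnt_sub_le hn (r := (v, x)) hv j
      _ ≤ 2 * m + 2 * ((s : ℝ) + 1) ^ 2 := by
          rw [integral_add hi (integrable_const _), integral_const_mul]
          simp only [integral_const, probReal_univ, one_smul]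
          have := integral_sq_sum_chi_sub hv j m
          linarith
      _ ≤ varConst s * n := by
          have : (m : ℝ) ≤ n := by exact_mod_cast (by omega : m ≤ n)
          unfold varConst
          nlinarith [sq_nonneg ((s : ℝ) + 1)]
  have h := integral_mono_ae hInt.integral_prod_left (integrable_const (varConst s * n)) hle
  simpa using h

theorem Setting.integrable_abs_cnt_sub (H : Setting b s s₀ s₁ σ) (n : ℕ) (j : Fin b) :
    Integrable (fun r : Root b => |(cnt s s₀ s₁ n r j - n * r.1 j : ℝ)|) (rootLaw σ) := by
  have hm : Measurable fun r : Root b => (cnt s s₀ s₁ n r j - n * r.1 j : ℝ) := by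
    have h1 : Measurable fun r : Root b => (cnt s s₀ s₁ n r j : ℝ) :=
      (measurable_of_countable (fun k : ℕ => (k : ℝ))).comp (measurable_cnt n j)
    have h2 : Measurable fun r : Root b => r.1 j := (measurable_pi_apply j).comp measurable_fst
    exact h1.sub (h2.const_mul _)
  have : MemLp (fun r : Root b => (cnt s s₀ s₁ n r j - n * r.1 j : ℝ)) 2 (rootLaw σ) :=
    (memLp_two_iff_integrable_sq hm.aestronglyMeasurable).2 (H.integrable_sq_cnt_sub n j)
  exact (this.integrable (by norm_num)).abs

theorem Setting.integral_abs_cnt_sub_le (H : Setting b s s₀ s₁ σ) {n : ℕ} (hn : s < n)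
    (j : Fin b) :
    ∫ r, |(cnt s s₀ s₁ n r j - n * r.1 j : ℝ)| ∂rootLaw σ ≤ √(varConst s * n) := by
  refine Real.le_sqrt_of_sq_le ?_
  refine (sq_integral_le_integral_sq (H.integrable_abs_cnt_sub n j) ?_).trans ?_
  · simp_rw [sq_abs]; exact H.integrable_sq_cnt_sub n j
  · simp_rw [sq_abs]; exact H.integral_sq_cnt_sub_le hn j

/-- Replacing each count by `n V_j` gives the leading term `κ n²`; the fluctuations cost only order
`n^(3/2)`. -/
theorem Setting.integral_sum_sq_cnt_le_sqrt (H : Setting b s s₀ s₁ σ) {n : ℕ} (hn : s < n) :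
    ∫ r, ∑ j, (cnt s s₀ s₁ n r j : ℝ) ^ 2 ∂rootLaw σ ≤
      n ^ 2 * kappa σ + 2 * b * n * √(varConst s * n) := by
  have hk : Integrable (fun r : Root b => ∑ j, r.1 j ^ 2) (rootLaw σ) := by
    have := H.integrable_sum_sq.comp_fst unifSeqLaw
    exact this
  have hi : Integrable (fun r : Root b => ∑ j, |(cnt s s₀ s₁ n r j - n * r.1 j : ℝ)|)
      (rootLaw σ) := integrable_finsetSum _ fun j _ => H.integrable_abs_cnt_sub n j
  calc ∫ r, ∑ j, (cnt s s₀ s₁ n r j : ℝ) ^ 2 ∂rootLaw σ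
      ≤ ∫ r, ((n : ℝ) ^ 2 * ∑ j, r.1 j ^ 2
          + 2 * n * ∑ j, |(cnt s s₀ s₁ n r j - n * r.1 j : ℝ)|) ∂rootLaw σ := by
        refine integral_mono_ae (H.integrable_sum_cnt (fun k => (k : ℝ) ^ 2) n)
          ((hk.const_mul _).add (hi.const_mul _)) ?_
        filter_upwards [ae_good H.simplex] with r hr
        simp only [Finset.mul_sum]
        rw [← Finset.sum_add_distrib]
        refine Finset.sum_le_sum fun j _ => ?_
        have h0 := hr.1.1 j
        have h1 := le_one_of_mem_stdSimplex hr.1 j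
        have h2 : (cnt s s₀ s₁ n r j : ℝ) ≤ n := by exact_mod_cast H.cnt_le n r j
        have h3 : (0 : ℝ) ≤ cnt s s₀ s₁ n r j := by positivity
        have h4 : (0 : ℝ) ≤ n := by positivity
        set N : ℝ := ((cnt s s₀ s₁ n r j : ℕ) : ℝ)
        have h5 := le_abs_self (N - n * r.1 j)
        have h6 := abs_nonneg (N - n * r.1 j)
        have h7 : (N - n * r.1 j) * (N + n * r.1 j) ≤ |N - n * r.1 j| * (2 * n) := by
          refine mul_le_mul h5 ?_ (by positivity) h6
          nlinarith
        nlinarith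
    _ = (n : ℝ) ^ 2 * kappa σ + 2 * n * ∑ j,
          ∫ r, |(cnt s s₀ s₁ n r j - n * r.1 j : ℝ)| ∂rootLaw σ := by
        rw [integral_add (hk.const_mul _) (hi.const_mul _), integral_const_mul,
          integral_const_mul, integral_finsetSum _ fun j _ => H.integrable_abs_cnt_sub n j,
          integral_rootLaw_fst (fun v => ∑ j, v j ^ 2)]
        rfl
    _ ≤ (n : ℝ) ^ 2 * kappa σ + 2 * n * ∑ _j : Fin b, √(varConst s * n) := by
        gcongr with j _
        exact H.integral_abs_cnt_sub_le hn j
    _ = _ := by simp; ring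

/-- For `κ < κ'`, eventually the mean of `∑ⱼ Nⱼ²` is at most `κ' n²`. -/
theorem Setting.eventually_integral_sum_sq_cnt_le (H : Setting b s s₀ s₁ σ) {κ' : ℝ}
    (hκ : kappa σ < κ') : ∀ᶠ n : ℕ in atTop,
      ∫ r, ∑ j, (cnt s s₀ s₁ n r j : ℝ) ^ 2 ∂rootLaw σ ≤ κ' * (n : ℝ) ^ 2 := by
  have ht : Tendsto (fun n : ℕ => 2 * b * √(varConst s) / √(n : ℝ)) atTop (nhds 0) :=
    Tendsto.const_div_atTop (Real.tendsto_sqrt_atTop.comp tendsto_natCast_atTop_atTop) _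
  filter_upwards [ht.eventually_le_const (sub_pos.2 hκ), eventually_gt_atTop s] with n hn hns
  refine (H.integral_sum_sq_cnt_le_sqrt hns).trans ?_
  have hn0 : (0 : ℝ) < n := by exact_mod_cast (by omega : 0 < n)
  have hsn : 0 < √(n : ℝ) := Real.sqrt_pos.2 hn0
  rw [div_le_iff₀ hsn] at hn
  rw [Real.sqrt_mul varConst_pos.le]
  have hsq : √(n : ℝ) * √(n : ℝ) = n := Real.mul_self_sqrt hn0.le
  have h1 : 2 * b * n * (√(varConst s) * √(n : ℝ)) ≤ (κ' - kappa σ) * √(n : ℝ) * n * √(n : ℝ) := by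
    calc 2 * b * n * (√(varConst s) * √(n : ℝ)) = (2 * b * √(varConst s)) * (n * √(n : ℝ)) := by ring
      _ ≤ ((κ' - kappa σ) * √(n : ℝ)) * (n * √(n : ℝ)) := by gcongr
      _ = _ := by ring
  have h2 : (κ' - kappa σ) * √(n : ℝ) * n * √(n : ℝ) = (κ' - kappa σ) * n ^ 2 := by
    calc _ = (κ' - kappa σ) * n * (√(n : ℝ) * √(n : ℝ)) := by ring
      _ = _ := by rw [hsq]; ring
  linarith

/-- Maximum principle: a function which is dominated by its weighted averages over the child counts
and is nonpositive at small arguments is nonpositive. -/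
theorem Setting.max_principle (H : Setting b s s₀ s₁ σ) {θ : ℕ → Root b → Fin b → ℝ} {c : ℝ}
    (hθm : ∀ n j, Measurable fun r => θ n r j) (hθ0 : ∀ n r j, 0 ≤ θ n r j)
    (hθc : ∀ n r j, θ n r j ≤ c) {n₀ : ℕ} (hn₀ : 0 < n₀)
    (hself : ∀ n, n₀ ≤ n → c * ∫ r, ∑ j, (cnt s s₀ s₁ n r j : ℝ) ^ 2 ∂rootLaw σ < (n : ℝ) ^ 2)
    {u : ℕ → ℝ} (hbase : ∀ n < n₀, u n ≤ 0)
    (hu : ∀ n, n₀ ≤ n → u n ≤ ∫ r, ∑ j, θ n r j * u (cnt s s₀ s₁ n r j) ∂rootLaw σ) (n : ℕ) :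
    u n ≤ 0 := by
  induction n using Nat.strong_induction_on with
  | _ n ih =>
    rcases lt_or_ge n n₀ with hn | hn
    · exact hbase n hn
    by_contra! hpos
    have hn0 : (0 : ℝ) < n := by exact_mod_cast (by omega : 0 < n)
    have hb : ∀ n r j, |θ n r j| ≤ c := fun n r j => by
      rw [abs_of_nonneg (hθ0 n r j)]; exact hθc n r j
    have h1 := hu n hn
    -- By induction only a child that receives all `n` items contributes positively, and then at
    -- most `c * u n`. Bounding the indicator of `N = n` by `(N/n)²` turns `hself` into the
    -- contradiction `u n < u n`.
    have h2 : ∫ r, ∑ j, θ n r j * u (cnt s s₀ s₁ n r j) ∂rootLaw σ ≤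
        ∫ r, c * (u n / n ^ 2) * ∑ j, (cnt s s₀ s₁ n r j : ℝ) ^ 2 ∂rootLaw σ := by
      refine integral_mono (integrable_finsetSum _ fun j _ =>
        H.integrable_mul_cnt u n j (hθm n j) (ae_of_all _ fun r => hb n r j))
        ((H.integrable_sum_cnt (fun k => (k : ℝ) ^ 2) n).const_mul _) fun r => ?_
      simp only [Finset.mul_sum]
      refine Finset.sum_le_sum fun j _ => ?_
      have hc0 : 0 ≤ c := (hθ0 n r j).trans (hθc n r j)
      rcases (H.cnt_le n r j).lt_or_eq with hlt | heq
      · have h3 := ih _ hlt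
        have h4 : θ n r j * u (cnt s s₀ s₁ n r j) ≤ 0 :=
          mul_nonpos_of_nonneg_of_nonpos (hθ0 n r j) h3
        have h5 : 0 ≤ c * (u n / n ^ 2) * (cnt s s₀ s₁ n r j : ℝ) ^ 2 := by positivity
        linarith
      · rw [heq]
        have : c * (u n / n ^ 2) * (n : ℝ) ^ 2 = c * u n := by field_simp
        rw [this]
        exact mul_le_mul_of_nonneg_right (hθc n r j) hpos.le
    rw [integral_const_mul] at h2
    have h3 := hself n hn
    have h4 : c * (u n / n ^ 2) * ∫ r, ∑ j, (cnt s s₀ s₁ n r j : ℝ) ^ 2 ∂rootLaw σ < u n := by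
      calc c * (u n / n ^ 2) * ∫ r, ∑ j, (cnt s s₀ s₁ n r j : ℝ) ^ 2 ∂rootLaw σ
          = (u n / n ^ 2) * (c * ∫ r, ∑ j, (cnt s s₀ s₁ n r j : ℝ) ^ 2 ∂rootLaw σ) := by ring
        _ < (u n / n ^ 2) * n ^ 2 := by
            have : 0 < u n / n ^ 2 := by positivity
            exact mul_lt_mul_of_pos_left h3 this
        _ = u n := by field_simp
    linarith

end Moments

/-! ### Decomposition of the environment at the root. -/

section Join

variable {b : ℕ}

/-- The environment with root randomness `r` whose subtree at child `j` is `e j`. -/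
def join (p : Root b × (Fin b → Env b)) : Env b := fun u =>
  if h : u = [] then p.1 else p.2 (u.getLast h) u.dropLast

@[simp]
theorem join_nil (p : Root b × (Fin b → Env b)) : join p [] = p.1 := by simp [join]

@[simp]
theorem join_append (p : Root b × (Fin b → Env b)) (u : Vertex b) (j : Fin b) :
    join p (u ++ [j]) = p.2 j u := by simp [join]

theorem measurable_join : Measurable (join (b := b)) := by
  rw [measurable_pi_iff]
  intro u
  rcases List.eq_nil_or_concat' u with rfl | ⟨u, j, rfl⟩
  · simp only [join_nil]; exact measurable_fst
  · simp only [join_append]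
    exact (measurable_pi_apply u).comp ((measurable_pi_apply j).comp measurable_snd)

/-- A vertex is the root or is in the subtree of a unique child of the root. -/
def vertexEquiv (b : ℕ) : Vertex b ≃ Unit ⊕ (Fin b × Vertex b) where
  toFun u := if h : u = [] then .inl () else .inr (u.getLast h, u.dropLast)
  invFun o := o.elim (fun _ => []) fun p => p.2 ++ [p.1]
  left_inv u := by
    rcases List.eq_nil_or_concat' u with rfl | ⟨u, j, rfl⟩ <;> simp
  right_inv o := by rcases o with _ | ⟨j, u⟩ <;> simp

variable {σ : Measure (Fin b → ℝ)} [IsProbabilityMeasure σ]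

/-- Product measures are determined on cylinders, and the preimage of a cylinder is a root condition
times one cylinder per child. Children are formed by prepending, so the subtree of the root to which
a vertex belongs is read off from its last letter. -/
theorem map_join :
    ((rootLaw σ).prod (Measure.pi fun _ : Fin b => envLaw σ)).map join = envLaw σ := by
  classical
  have henv : envLaw σ = Measure.infinitePi fun _ : Vertex b => rootLaw σ := rfl
  nth_rewrite 2 [henv]
  refine Measure.eq_infinitePi _ fun S t ht => ?_
  rw [Measure.map_apply measurable_join (MeasurableSet.pi S.countable_toSet fun u _ => ht u)]
  let t' : Vertex b → Set (Root b) := fun u => if u ∈ S then t u else Set.univ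
  have ht' : ∀ u, MeasurableSet (t' u) := fun u => by
    simp only [t']; split_ifs; exacts [ht u, MeasurableSet.univ]
  -- The vertices of `S` below child `j`, in the coordinates of that subtree.
  let S' : Fin b → Finset (Vertex b) := fun j =>
    (S.filter fun u => ∃ w, u = w ++ [j]).image List.dropLast
  have hpre : join ⁻¹' (Set.pi S t) = t' [] ×ˢ Set.pi Set.univ
      fun j => Set.pi (S' j) fun w => t' (w ++ [j]) := by
    ext p
    simp only [Set.mem_preimage, Set.mem_pi, Finset.mem_coe, Set.mem_prod, Set.mem_univ,
      true_implies]
    constructor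
    · intro h
      refine ⟨?_, fun j w hw => ?_⟩
      · by_cases h0 : ([] : Vertex b) ∈ S
        · have := h [] h0; simpa [t', h0] using this
        · simp [t', h0]
      · by_cases h0 : w ++ [j] ∈ S
        · have := h _ h0; simpa [t', h0] using this
        · simp [t', h0]
    · rintro ⟨h1, h2⟩ u hu
      rcases List.eq_nil_or_concat' u with rfl | ⟨w, j, rfl⟩
      · simpa [t', hu] using h1
      · have hw : w ∈ S' j := Finset.mem_image.2
          ⟨w ++ [j], Finset.mem_filter.2 ⟨hu, w, rfl⟩, by simp⟩
        have := h2 j w hw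
        simpa [t', hu] using this
  rw [hpre, Measure.prod_prod, Measure.pi_pi]
  simp_rw [fun j => show envLaw σ (Set.pi (S' j) fun w => t' (w ++ [j])) =
    ∏ w ∈ S' j, rootLaw σ (t' (w ++ [j])) from by
      rw [henv]; exact Measure.infinitePi_pi _ fun w _ => ht' _]
  have h1 : rootLaw σ (t' []) = ∏ u ∈ S.filter (fun u => u = []), rootLaw σ (t u) := by
    by_cases h0 : ([] : Vertex b) ∈ S
    · have : S.filter (fun u => u = []) = {[]} := by
        ext u; simp only [Finset.mem_filter, Finset.mem_singleton]
        exact ⟨fun h => h.2, fun h => ⟨h ▸ h0, h⟩⟩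
      rw [this]; simp [t', h0]
    · have : S.filter (fun u => u = []) = ∅ := by
        ext u; simp only [Finset.mem_filter, Finset.notMem_empty, iff_false]
        rintro ⟨h, rfl⟩; exact h0 h
      rw [this]; simp [t', h0]
  have h2 : ∀ j, ∏ w ∈ S' j, rootLaw σ (t' (w ++ [j])) =
      ∏ u ∈ S.filter (fun u => ∃ w, u = w ++ [j]), rootLaw σ (t u) := by
    intro j
    rw [Finset.prod_image]
    · refine Finset.prod_congr rfl fun u hu => ?_
      obtain ⟨hu, w, rfl⟩ := Finset.mem_filter.1 hu
      simp [t', hu]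
    · intro u hu u' hu' h
      obtain ⟨_, w, rfl⟩ := Finset.mem_filter.1 hu
      obtain ⟨_, w', rfl⟩ := Finset.mem_filter.1 hu'
      simp only [List.dropLast_concat] at h
      rw [h]
  rw [h1, Finset.prod_congr rfl fun j _ => h2 j, ← Finset.prod_biUnion]
  · rw [← Finset.prod_filter_mul_prod_filter_not S (fun u => u = [])]
    congr 2
    ext u
    simp only [Finset.mem_biUnion, Finset.mem_univ, true_and, Finset.mem_filter]
    constructor
    · rintro ⟨j, hu, w, rfl⟩; exact ⟨hu, by simp⟩
    · rintro ⟨hu, hne⟩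
      rcases List.eq_nil_or_concat' u with rfl | ⟨w, j, rfl⟩
      · exact absurd rfl hne
      · exact ⟨j, hu, w, rfl⟩
  · intro i _ j _ hij
    rw [Function.onFun, Finset.disjoint_left]
    intro u hu hu'
    obtain ⟨_, w, rfl⟩ := Finset.mem_filter.1 hu
    obtain ⟨_, w', h⟩ := Finset.mem_filter.1 hu'
    have := (List.append_inj' h rfl).2
    simp at this
    exact hij this

theorem measurePreserving_join : MeasurePreserving (join (b := b))
    ((rootLaw σ).prod (Measure.pi fun _ : Fin b => envLaw σ)) (envLaw σ) :=
  ⟨measurable_join, map_join⟩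

end Join

/-! ### Recursions, via truncation in depth, and finiteness of the first two moments. -/

section Recursion

variable {b s s₀ s₁ : ℕ}

theorem subtreeCount_join (n : ℕ) (p : Root b × (Fin b → Env b)) (u : Vertex b) (j : Fin b) :
    subtreeCount b s s₀ s₁ n (join p) (u ++ [j]) =
      subtreeCount b s s₀ s₁ (cnt s s₀ s₁ n p.1 j) (p.2 j) u := by
  induction u with
  | nil => simp [subtreeCount, cnt]
  | cons i u ih => simp [subtreeCount, ih]

theorem itemCount_join (n : ℕ) (p : Root b × (Fin b → Env b)) (u : Vertex b) (j : Fin b) :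
    itemCount b s s₀ s₁ n (join p) (u ++ [j]) =
      itemCount b s s₀ s₁ (cnt s s₀ s₁ n p.1 j) (p.2 j) u := by
  simp [itemCount, subtreeCount_join]

theorem itemCount_nil (n : ℕ) (e : Env b) :
    itemCount b s s₀ s₁ n e [] = if n ≤ s then n else s₀ := rfl

theorem join_split (e : Env b) : join (e [], fun j u => e (u ++ [j])) = e := by
  ext1 u
  rcases List.eq_nil_or_concat' u with rfl | ⟨u, j, rfl⟩ <;> simp

theorem tsum_vertex (f : Vertex b → ENNReal) :
    ∑' u, f u = f [] + ∑ j, ∑' u, f (u ++ [j]) := by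
  rw [← (vertexEquiv b).symm.tsum_eq, Summable.tsum_sum ENNReal.summable ENNReal.summable,
    tsum_fintype]
  have h : ∑' p : Fin b × Vertex b, f ((vertexEquiv b).symm (Sum.inr p)) =
      ∑' (j : Fin b) (u : Vertex b), f (u ++ [j]) :=
    ENNReal.tsum_prod (f := fun j u => f (u ++ [j]))
  rw [h, tsum_fintype]
  simp [vertexEquiv]

variable (b s s₀ s₁)

/-- The number of items stored at depth less than `K`. -/
def itemsTo (K n : ℕ) (e : Env b) : ENNReal :=
  ∑' u : Vertex b, if u.length < K then (itemCount b s s₀ s₁ n e u : ENNReal) else 0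

/-- The part of the path length contributed by depths less than `K`. -/
def pathTo (K n : ℕ) (e : Env b) : ENNReal :=
  ∑' u : Vertex b, if u.length < K then
    (u.length : ENNReal) * (itemCount b s s₀ s₁ n e u : ENNReal) else 0

/-- The number of items that are stored in the tree. -/
def items (n : ℕ) (e : Env b) : ENNReal := ∑' u : Vertex b, (itemCount b s s₀ s₁ n e u : ENNReal)

variable {b s s₀ s₁}

theorem itemsTo_zero (n : ℕ) (e : Env b) : itemsTo b s s₀ s₁ 0 n e = 0 := by simp [itemsTo]

theorem pathTo_zero (n : ℕ) (e : Env b) : pathTo b s s₀ s₁ 0 n e = 0 := by simp [pathTo]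

theorem itemsTo_succ (K n : ℕ) (p : Root b × (Fin b → Env b)) :
    itemsTo b s s₀ s₁ (K + 1) n (join p) = ((if n ≤ s then n else s₀ : ℕ) : ENNReal) +
      ∑ j, itemsTo b s s₀ s₁ K (cnt s s₀ s₁ n p.1 j) (p.2 j) := by
  rw [itemsTo, tsum_vertex]
  simp [itemCount_join, itemCount_nil, itemsTo]

theorem pathTo_succ (K n : ℕ) (p : Root b × (Fin b → Env b)) :
    pathTo b s s₀ s₁ (K + 1) n (join p) =
      ∑ j, (pathTo b s s₀ s₁ K (cnt s s₀ s₁ n p.1 j) (p.2 j)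
        + itemsTo b s s₀ s₁ K (cnt s s₀ s₁ n p.1 j) (p.2 j)) := by
  rw [pathTo, tsum_vertex]
  simp only [List.length_nil, Nat.cast_zero, zero_mul, ite_self, zero_add, List.length_append,
    List.length_singleton, itemCount_join, add_lt_add_iff_right]
  refine Finset.sum_congr rfl fun j _ => ?_
  rw [pathTo, itemsTo, ← ENNReal.tsum_add]
  refine tsum_congr fun u => ?_
  split_ifs
  · push_cast; ring
  · simp

theorem items_join (n : ℕ) (p : Root b × (Fin b → Env b)) :
    items b s s₀ s₁ n (join p) = ((if n ≤ s then n else s₀ : ℕ) : ENNReal) +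
      ∑ j, items b s s₀ s₁ (cnt s s₀ s₁ n p.1 j) (p.2 j) := by
  rw [items, tsum_vertex]
  simp [itemCount_join, itemCount_nil, items]

theorem pathLength_join (n : ℕ) (p : Root b × (Fin b → Env b)) :
    pathLength b s s₀ s₁ n (join p) =
      ∑ j, (pathLength b s s₀ s₁ (cnt s s₀ s₁ n p.1 j) (p.2 j)
        + items b s s₀ s₁ (cnt s s₀ s₁ n p.1 j) (p.2 j)) := by
  rw [pathLength, tsum_vertex]
  simp only [List.length_nil, Nat.cast_zero, zero_mul, zero_add, List.length_append,
    List.length_singleton, itemCount_join]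
  refine Finset.sum_congr rfl fun j _ => ?_
  rw [pathLength, items, ← ENNReal.tsum_add]
  refine tsum_congr fun u => ?_
  push_cast; ring

theorem tsum_eq_iSup_length (f : Vertex b → ENNReal) :
    ∑' u, f u = ⨆ K, ∑' u : Vertex b, if u.length < K then f u else 0 := by
  refine le_antisymm ?_ (iSup_le fun K => ENNReal.tsum_le_tsum fun u => by split_ifs <;> simp)
  rw [ENNReal.tsum_eq_iSup_sum]
  refine iSup_le fun S => ?_
  set K := S.sup List.length + 1 with hK
  refine le_trans ?_ (le_iSup _ K)
  refine le_trans (le_of_eq ?_) (ENNReal.sum_le_tsum S)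
  refine Finset.sum_congr rfl fun u hu => ?_
  have : u.length < K := Nat.lt_succ_of_le (Finset.le_sup (f := List.length) hu)
  simp [this]

theorem monotone_trunc (f : Vertex b → ENNReal) :
    Monotone fun K => ∑' u : Vertex b, if u.length < K then f u else 0 := by
  intro K K' h
  refine ENNReal.tsum_le_tsum fun u => ?_
  split_ifs with h1 h2
  · exact le_rfl
  · omega
  · exact zero_le
  · exact le_rfl

theorem items_eq_iSup (n : ℕ) (e : Env b) :
    items b s s₀ s₁ n e = ⨆ K, itemsTo b s s₀ s₁ K n e := tsum_eq_iSup_length _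

theorem pathLength_eq_iSup (n : ℕ) (e : Env b) :
    pathLength b s s₀ s₁ n e = ⨆ K, pathTo b s s₀ s₁ K n e := tsum_eq_iSup_length _

theorem measurable_subtreeCount (n : ℕ) (u : Vertex b) :
    Measurable fun e : Env b => subtreeCount b s s₀ s₁ n e u := by
  induction u with
  | nil => exact measurable_const
  | cons i u ih =>
    have h : Measurable fun q : ℕ × Root b => cnt s s₀ s₁ q.1 q.2 i :=
      measurable_from_prod_countable_right fun m => measurable_cnt m i
    exact h.comp (ih.prodMk (measurable_pi_apply u))

theorem measurable_itemCount (n : ℕ) (u : Vertex b) :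
    Measurable fun e : Env b => itemCount b s s₀ s₁ n e u :=
  (measurable_of_countable fun m : ℕ => if m ≤ s then m else s₀).comp (measurable_subtreeCount n u)

theorem measurable_itemCount' (n : ℕ) (u : Vertex b) :
    Measurable fun e : Env b => (itemCount b s s₀ s₁ n e u : ENNReal) :=
  (measurable_of_countable fun m : ℕ => (m : ENNReal)).comp (measurable_itemCount n u)

theorem measurable_pathTo (K n : ℕ) : Measurable (pathTo b s s₀ s₁ K n) := by
  refine Measurable.tsum fun u => ?_
  split_ifs
  · exact (measurable_itemCount' n u).const_mul _
  · exact measurable_const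

theorem measurable_items (n : ℕ) : Measurable (items b s s₀ s₁ n) :=
  Measurable.tsum fun u => measurable_itemCount' n u

theorem measurable_pathLength (n : ℕ) : Measurable (pathLength b s s₀ s₁ n) :=
  Measurable.tsum fun u => (measurable_itemCount' n u).const_mul _

variable {σ : Measure (Fin b → ℝ)} [IsProbabilityMeasure σ]

theorem ae_env_good (H : Setting b s s₀ s₁ σ) : ∀ᵐ e ∂envLaw σ, ∀ u, Good (e u) := by
  rw [ae_all_iff]
  intro u
  exact (measurePreserving_eval_infinitePi (fun _ : Vertex b => rootLaw σ)
    u).quasiMeasurePreserving.ae (ae_good H.simplex)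

theorem Setting.itemsTo_le (H : Setting b s s₀ s₁ σ) (K n : ℕ) {e : Env b}
    (he : ∀ u, Good (e u)) : itemsTo b s s₀ s₁ K n e ≤ n := by
  induction K generalizing n e with
  | zero => simp [itemsTo_zero]
  | succ K ih =>
    rw [← join_split e, itemsTo_succ]
    have h1 : ∀ j, itemsTo b s s₀ s₁ K (cnt s s₀ s₁ n (e []) j) (fun u => e (u ++ [j])) ≤
        (cnt s s₀ s₁ n (e []) j : ENNReal) := fun j => ih _ fun u => he _
    rcases le_or_gt n s with hn | hn
    · have : ∑ j, itemsTo b s s₀ s₁ K (cnt s s₀ s₁ n (e []) j) (fun u => e (u ++ [j])) = 0 :=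
        Finset.sum_eq_zero fun j _ => by
          have := h1 j
          rw [cnt_of_le hn] at this ⊢
          simpa using this
      simp [hn, this]
    · simp only [not_le.2 hn, if_false]
      have h2 := H.sum_cnt hn (he [])
      calc (s₀ : ENNReal) + ∑ j, itemsTo b s s₀ s₁ K (cnt s s₀ s₁ n (e []) j)
              (fun u => e (u ++ [j]))
          ≤ s₀ + ∑ j, (cnt s s₀ s₁ n (e []) j : ENNReal) := by
            gcongr with j _; exact h1 j
        _ = ((∑ j, cnt s s₀ s₁ n (e []) j + s₀ : ℕ) : ENNReal) := by push_cast; ring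
        _ = n := by rw [h2]

theorem Setting.items_le (H : Setting b s s₀ s₁ σ) (n : ℕ) {e : Env b}
    (he : ∀ u, Good (e u)) : items b s s₀ s₁ n e ≤ n := by
  rw [items_eq_iSup]; exact iSup_le fun K => H.itemsTo_le K n he

/-- Integration over the environment: first the root, then the subtrees. -/
theorem lintegral_env {F : Env b → ENNReal} (hF : Measurable F) :
    ∫⁻ e, F e ∂envLaw σ =
      ∫⁻ r, ∫⁻ ē, F (join (r, ē)) ∂(Measure.pi fun _ : Fin b => envLaw σ) ∂rootLaw σ := by
  rw [← measurePreserving_join.lintegral_comp hF,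
    lintegral_prod (fun p => F (join p)) (hF.comp measurable_join).aemeasurable]

theorem lintegral_pi_eval {G : Env b → ENNReal} (hG : Measurable G) (j : Fin b) :
    ∫⁻ ē, G (ē j) ∂(Measure.pi fun _ : Fin b => envLaw σ) = ∫⁻ e, G e ∂envLaw σ :=
  (measurePreserving_eval (fun _ : Fin b => envLaw σ) j).lintegral_comp hG

theorem ae_pi_good (H : Setting b s s₀ s₁ σ) :
    ∀ᵐ ē ∂(Measure.pi fun _ : Fin b => envLaw σ), ∀ j u, Good (ē j u) := by
  rw [ae_all_iff]
  intro j
  exact (measurePreserving_eval (fun _ : Fin b => envLaw σ) j).quasiMeasurePreserving.ae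
    (ae_env_good H)

/-- A supersolution of the recursion of the tree costs bounds all truncated costs. -/
theorem Setting.bounded_of_recursion (H : Setting b s s₀ s₁ σ) {f : ℕ → ℕ → ENNReal}
    {R : ℕ → ENNReal} (hR : ∀ n, R n ≠ ⊤) (h0 : ∀ n, f 0 n = 0) (hs : ∀ K n, n ≤ s → f K n = 0)
    (hrec : ∀ K n, s < n → f (K + 1) n ≤ R n + ∫⁻ r, ∑ j, f K (cnt s s₀ s₁ n r j) ∂rootLaw σ)
    (n : ℕ) : ∃ C : ENNReal, C ≠ ⊤ ∧ ∀ K, f K n ≤ C := by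
  have hκ : 0 < 1 - kappa σ := by linarith [H.kappa_lt_one]
  -- The supersolution is `A k²`. Averaging it over the child counts releases at least `A (1 - κ)`,
  -- and this choice pays for every cost `R k` with `k ≤ n`. Larger arguments never occur, as child
  -- counts do not exceed the parent's.
  set A : ℝ := (∑ k ∈ Finset.range (n + 1), (R k).toReal) / (1 - kappa σ) with hA
  have hA0 : 0 ≤ A := by positivity
  have hAR : ∀ k ≤ n, R k ≤ ENNReal.ofReal (A * (1 - kappa σ)) := by
    intro k hk
    rw [← ENNReal.ofReal_toReal (hR k), hA, div_mul_cancel₀ _ hκ.ne']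
    exact ENNReal.ofReal_le_ofReal (Finset.single_le_sum (f := fun k => (R k).toReal)
      (fun _ _ => ENNReal.toReal_nonneg) (Finset.mem_range.2 (by omega)))
  refine ⟨ENNReal.ofReal (A * n ^ 2), ENNReal.ofReal_ne_top, fun K => ?_⟩
  suffices ∀ k ≤ n, f K k ≤ ENNReal.ofReal (A * k ^ 2) from this n le_rfl
  induction K with
  | zero => intro k _; simp [h0]
  | succ K ih =>
    intro k hk
    rcases le_or_gt k s with hks | hks
    · simp [hs _ _ hks]
    have hk1 : (1 : ℝ) ≤ (k : ℝ) ^ 2 := by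
      have : (1 : ℝ) ≤ k := by exact_mod_cast (by omega : 1 ≤ k)
      nlinarith
    calc f (K + 1) k ≤ R k + ∫⁻ r, ∑ j, f K (cnt s s₀ s₁ k r j) ∂rootLaw σ := hrec K k hks
      _ ≤ R k + ∫⁻ r, ENNReal.ofReal (A * ∑ j, (cnt s s₀ s₁ k r j : ℝ) ^ 2) ∂rootLaw σ := by
          gcongr with r
          rw [Finset.mul_sum, ENNReal.ofReal_sum_of_nonneg fun j _ => by positivity]
          exact Finset.sum_le_sum fun j _ => ih _ ((H.cnt_le k r j).trans hk)
      _ = R k + ENNReal.ofReal (A * ∫ r, ∑ j, (cnt s s₀ s₁ k r j : ℝ) ^ 2 ∂rootLaw σ) := by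
          rw [← integral_const_mul, ← ofReal_integral_eq_lintegral_ofReal
            ((H.integrable_sum_cnt (fun i => (i : ℝ) ^ 2) k).const_mul A)
            (ae_of_all _ fun r => by simp only [Pi.zero_apply]; positivity)]
      _ ≤ ENNReal.ofReal (A * (1 - kappa σ)) +
            ENNReal.ofReal (A * (k ^ 2 - (1 - kappa σ))) := by
          gcongr
          · exact hAR k hk
          · exact H.integral_sum_sq_cnt_le hks
      _ = ENNReal.ofReal (A * k ^ 2) := by
          rw [← ENNReal.ofReal_add (by positivity)]
          · congr 1; ring
          · have := kappa_nonneg (σ := σ)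
            exact mul_nonneg hA0 (by linarith)

theorem itemsTo_zero_right (K : ℕ) (e : Env b) : itemsTo b s s₀ s₁ K 0 e = 0 := by
  induction K generalizing e with
  | zero => exact itemsTo_zero 0 e
  | succ K ih => rw [← join_split e, itemsTo_succ]; simp [cnt_of_le (Nat.zero_le s), ih]

theorem pathTo_of_le (K : ℕ) {n : ℕ} (hn : n ≤ s) (e : Env b) :
    pathTo b s s₀ s₁ K n e = 0 := by
  induction K generalizing n e with
  | zero => exact pathTo_zero n e
  | succ K ih =>
    rw [← join_split e, pathTo_succ]
    simp [cnt_of_le hn, itemsTo_zero_right, ih (Nat.zero_le s)]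

theorem pathLength_of_le {n : ℕ} (hn : n ≤ s) (e : Env b) : pathLength b s s₀ s₁ n e = 0 := by
  rw [pathLength_eq_iSup]; simp [pathTo_of_le _ hn]

theorem items_of_le {n : ℕ} (hn : n ≤ s) (e : Env b) : items b s s₀ s₁ n e = n := by
  rw [← join_split e, items_join]
  simp [hn, cnt_of_le hn, items_eq_iSup, itemsTo_zero_right]

theorem Setting.pathTo_succ_le (H : Setting b s s₀ s₁ σ) (K : ℕ) {n : ℕ} (hn : s < n)
    {p : Root b × (Fin b → Env b)} (h1 : Good p.1) (h2 : ∀ j u, Good (p.2 j u)) :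
    pathTo b s s₀ s₁ (K + 1) n (join p) ≤
      n + ∑ j, pathTo b s s₀ s₁ K (cnt s s₀ s₁ n p.1 j) (p.2 j) := by
  rw [pathTo_succ, Finset.sum_add_distrib, add_comm]
  gcongr
  calc ∑ j, itemsTo b s s₀ s₁ K (cnt s s₀ s₁ n p.1 j) (p.2 j)
      ≤ ∑ j, (cnt s s₀ s₁ n p.1 j : ENNReal) :=
        Finset.sum_le_sum fun j _ => H.itemsTo_le _ _ (h2 j)
    _ ≤ n := by
        have := H.sum_cnt hn h1
        rw [← Nat.cast_sum]
        exact_mod_cast (by omega)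

theorem Setting.exists_bound_lintegral_pathTo (H : Setting b s s₀ s₁ σ) (n : ℕ) :
    ∃ C : ENNReal, C ≠ ⊤ ∧ ∀ K, ∫⁻ e, pathTo b s s₀ s₁ K n e ∂envLaw σ ≤ C := by
  refine H.bounded_of_recursion (f := fun K n => ∫⁻ e, pathTo b s s₀ s₁ K n e ∂envLaw σ)
    (R := fun n => n) (fun n => ENNReal.natCast_ne_top n) (fun n => by simp [pathTo_zero])
    (fun K n hn => by simp [pathTo_of_le K hn]) (fun K n hn => ?_) n
  rw [lintegral_env (measurable_pathTo _ _)]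
  calc ∫⁻ r, ∫⁻ ē, pathTo b s s₀ s₁ (K + 1) n (join (r, ē))
          ∂(Measure.pi fun _ : Fin b => envLaw σ) ∂rootLaw σ
      ≤ ∫⁻ r, ((n : ENNReal) + ∑ j, ∫⁻ e, pathTo b s s₀ s₁ K (cnt s s₀ s₁ n r j) e ∂envLaw σ)
          ∂rootLaw σ := by
        refine lintegral_mono_ae ?_
        filter_upwards [ae_good H.simplex] with r hr
        calc ∫⁻ ē, pathTo b s s₀ s₁ (K + 1) n (join (r, ē))
              ∂(Measure.pi fun _ : Fin b => envLaw σ)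
            ≤ ∫⁻ ē, ((n : ENNReal) + ∑ j, pathTo b s s₀ s₁ K (cnt s s₀ s₁ n r j) (ē j))
              ∂(Measure.pi fun _ : Fin b => envLaw σ) := by
              refine lintegral_mono_ae ?_
              filter_upwards [ae_pi_good H] with ē hē
              exact H.pathTo_succ_le K hn (p := (r, ē)) hr hē
          _ = _ := by
              have hm : ∀ j, Measurable fun ē : Fin b → Env b =>
                  pathTo b s s₀ s₁ K (cnt s s₀ s₁ n r j) (ē j) := fun j =>
                (measurable_pathTo _ _).comp (measurable_pi_apply j)
              rw [lintegral_add_left measurable_const, lintegral_finsetSum _ fun j _ => hm j]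
              simp [lintegral_pi_eval (measurable_pathTo _ _)]
    _ = _ := by
        rw [lintegral_add_left measurable_const]
        simp

/-- In the square of the one-step recursion the subtrees are independent, so cross terms are
products of means that are already bounded. The diagonal terms reproduce the recursion for second
moments. -/
theorem Setting.exists_bound_lintegral_sq_pathTo (H : Setting b s s₀ s₁ σ) (n : ℕ) :
    ∃ C : ENNReal, C ≠ ⊤ ∧ ∀ K, ∫⁻ e, pathTo b s s₀ s₁ K n e ^ 2 ∂envLaw σ ≤ C := by
  choose C hC hCK using H.exists_bound_lintegral_pathTo
  set M : ℕ → ENNReal := fun n => ∑ k ∈ Finset.range (n + 1), C k with hM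
  have hMt : ∀ n, M n ≠ ⊤ := fun n => ENNReal.sum_ne_top.2 fun k _ => hC k
  have hMle : ∀ K n r j,
      ∫⁻ e, pathTo b s s₀ s₁ K (cnt s s₀ s₁ n r j) e ∂envLaw σ ≤ M n := fun K n r j =>
    (hCK _ K).trans (Finset.single_le_sum (fun _ _ => zero_le)
      (Finset.mem_range.2 (Nat.lt_succ_of_le (H.cnt_le n r j))))
  refine H.bounded_of_recursion (f := fun K n => ∫⁻ e, pathTo b s s₀ s₁ K n e ^ 2 ∂envLaw σ)
    (R := fun n => (n : ENNReal) ^ 2 + 2 * n * (b * M n) + b * (b * (M n * M n)))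
    (fun n => ?_) (fun n => by simp [pathTo_zero])
    (fun K n hn => by simp [pathTo_of_le K hn]) (fun K n hn => ?_) n
  · have := hMt n
    finiteness
  rw [lintegral_env ((measurable_pathTo _ _).pow_const 2)]
  set π := Measure.pi fun _ : Fin b => envLaw σ with hπ
  have hone : ∀ᵐ r ∂rootLaw σ, ∫⁻ ē, pathTo b s s₀ s₁ (K + 1) n (join (r, ē)) ^ 2 ∂π ≤
      ((n : ENNReal) ^ 2 + 2 * n * (b * M n) + b * (b * (M n * M n))) +
        ∑ j, ∫⁻ e, pathTo b s s₀ s₁ K (cnt s s₀ s₁ n r j) e ^ 2 ∂envLaw σ := by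
    filter_upwards [ae_good H.simplex] with r hr
    set P : Fin b → (Fin b → Env b) → ENNReal :=
      fun j ē => pathTo b s s₀ s₁ K (cnt s s₀ s₁ n r j) (ē j) with hP
    have hPm : ∀ j, Measurable (P j) := fun j =>
      (measurable_pathTo _ _).comp (measurable_pi_apply j)
    have hPi : ∀ j, ∫⁻ ē, P j ē ∂π ≤ M n := fun j => by
      rw [hP, hπ]
      simp only
      rw [lintegral_pi_eval (measurable_pathTo _ _)]
      exact hMle K n r j
    have hind : iIndepFun P π := by
      have := iIndepFun_pi (μ := fun _ : Fin b => envLaw σ)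
        (X := fun j e => pathTo b s s₀ s₁ K (cnt s s₀ s₁ n r j) e)
        (fun j => (measurable_pathTo _ _).aemeasurable)
      exact this
    have hcross : ∀ i j, ∫⁻ ē, P i ē * P j ē ∂π ≤
        (if i = j then ∫⁻ ē, P i ē ^ 2 ∂π else 0) + M n * M n := by
      intro i j
      split_ifs with hij
      · subst hij
        simp_rw [sq]
        exact le_self_add
      · rw [zero_add]
        have := lintegral_mul_eq_lintegral_mul_lintegral_of_indepFun (hPm i) (hPm j)
          (hind.indepFun hij)
        simp only [Pi.mul_apply] at this
        rw [this]
        exact mul_le_mul' (hPi i) (hPi j)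
    calc ∫⁻ ē, pathTo b s s₀ s₁ (K + 1) n (join (r, ē)) ^ 2 ∂π
        ≤ ∫⁻ ē, ((n : ENNReal) ^ 2 + 2 * n * ∑ j, P j ē + ∑ i, ∑ j, P i ē * P j ē) ∂π := by
          refine lintegral_mono_ae ?_
          filter_upwards [ae_pi_good H] with ē hē
          have h := H.pathTo_succ_le K hn (p := (r, ē)) hr hē
          refine (pow_le_pow_left' h 2).trans (le_of_eq ?_)
          rw [← Finset.sum_mul_sum]
          simp only [hP]
          ring
      _ = (n : ENNReal) ^ 2 + 2 * n * ∑ j, ∫⁻ ē, P j ē ∂π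
            + ∑ i, ∑ j, ∫⁻ ē, P i ē * P j ē ∂π := by
          have m1 : Measurable fun ē => ∑ j, P j ē := Finset.measurable_fun_sum _ fun j _ => hPm j
          have m2 : ∀ i, Measurable fun ē => ∑ j, P i ē * P j ē := fun i =>
            Finset.measurable_fun_sum _ fun j _ => (hPm i).mul (hPm j)
          have m4 : ∀ i, ∫⁻ ē, ∑ j, P i ē * P j ē ∂π = ∑ j, ∫⁻ ē, P i ē * P j ē ∂π := fun i =>
            lintegral_finsetSum _ fun j _ => (hPm i).mul (hPm j)
          have m3 : Measurable fun ē => (n : ENNReal) ^ 2 + 2 * n * ∑ j, P j ē :=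
            measurable_const.add (m1.const_mul _)
          rw [lintegral_add_left m3, lintegral_add_left measurable_const, lintegral_const_mul _ m1,
            lintegral_finsetSum _ fun j _ => hPm j, lintegral_finsetSum _ fun i _ => m2 i]
          simp_rw [m4]
          simp
      _ ≤ (n : ENNReal) ^ 2 + 2 * n * ∑ _j : Fin b, M n
            + ∑ i, ∑ j, ((if i = j then ∫⁻ ē, P i ē ^ 2 ∂π else 0) + M n * M n) := by
          gcongr with j _ i _ j _
          · exact hPi j
          · exact hcross i j
      _ = _ := by
          simp only [Finset.sum_add_distrib, Finset.sum_ite_eq, Finset.mem_univ, if_true,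
            Finset.sum_const, Finset.card_univ, Fintype.card_fin, nsmul_eq_mul]
          have : ∀ j, ∫⁻ ē, P j ē ^ 2 ∂π =
              ∫⁻ e, pathTo b s s₀ s₁ K (cnt s s₀ s₁ n r j) e ^ 2 ∂envLaw σ := fun j =>
            lintegral_pi_eval ((measurable_pathTo _ _).pow_const 2) j
          simp_rw [this]
          ring
  refine (lintegral_mono_ae hone).trans (le_of_eq ?_)
  rw [lintegral_add_left measurable_const]
  simp

end Recursion

/-! ### The path length as a square integrable variable, and its mean. -/

section PathLength

variable {b s s₀ s₁ : ℕ} {σ : Measure (Fin b → ℝ)} [IsProbabilityMeasure σ]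

theorem Setting.lintegral_pathLength_lt_top (H : Setting b s s₀ s₁ σ) (n : ℕ) :
    ∫⁻ e, pathLength b s s₀ s₁ n e ∂envLaw σ < ⊤ := by
  obtain ⟨C, hC, hK⟩ := H.exists_bound_lintegral_pathTo n
  simp_rw [pathLength_eq_iSup]
  rw [lintegral_iSup (fun K => measurable_pathTo K n) fun K K' h e => monotone_trunc _ h]
  exact (iSup_le hK).trans_lt hC.lt_top

theorem Setting.lintegral_sq_pathLength_lt_top (H : Setting b s s₀ s₁ σ) (n : ℕ) :
    ∫⁻ e, pathLength b s s₀ s₁ n e ^ 2 ∂envLaw σ < ⊤ := by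
  obtain ⟨C, hC, hK⟩ := H.exists_bound_lintegral_sq_pathTo n
  have hsq : ∀ e : Env b, pathLength b s s₀ s₁ n e ^ 2 = ⨆ K, pathTo b s s₀ s₁ K n e ^ 2 := by
    intro e
    have ht : Tendsto (fun K => pathTo b s s₀ s₁ K n e) atTop
        (nhds (pathLength b s s₀ s₁ n e)) := by
      rw [pathLength_eq_iSup]; exact tendsto_atTop_iSup (monotone_trunc _)
    refine tendsto_nhds_unique ((ENNReal.continuous_pow 2).continuousAt.tendsto.comp ht)
      (tendsto_atTop_iSup fun K K' h => ?_)
    exact pow_le_pow_left' (monotone_trunc _ h) 2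
  simp_rw [hsq]
  rw [lintegral_iSup (fun K => (measurable_pathTo K n).pow_const 2)
    fun K K' h e => pow_le_pow_left' (monotone_trunc _ h) 2]
  exact (iSup_le hK).trans_lt hC.lt_top

variable (b s s₀ s₁) in
/-- The path length as a real number. -/
def pathReal (n : ℕ) (e : Env b) : ℝ := (pathLength b s s₀ s₁ n e).toReal

theorem measurable_pathReal (n : ℕ) : Measurable (pathReal b s s₀ s₁ n) :=
  (measurable_pathLength n).ennreal_toReal

theorem pathReal_of_le {n : ℕ} (hn : n ≤ s) (e : Env b) : pathReal b s s₀ s₁ n e = 0 := by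
  simp [pathReal, pathLength_of_le hn]

theorem Setting.memLp_pathReal (H : Setting b s s₀ s₁ σ) (n : ℕ) :
    MemLp (pathReal b s s₀ s₁ n) 2 (envLaw σ) := by
  rw [memLp_two_iff_integrable_sq (measurable_pathReal n).aestronglyMeasurable]
  have := integrable_toReal_of_lintegral_ne_top
    ((measurable_pathLength (b := b) (s := s) (s₀ := s₀) (s₁ := s₁) n).pow_const 2).aemeasurable
    (H.lintegral_sq_pathLength_lt_top n).ne
  simpa [pathReal] using this

theorem Setting.integrable_pathReal (H : Setting b s s₀ s₁ σ) (n : ℕ) :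
    Integrable (pathReal b s s₀ s₁ n) (envLaw σ) := (H.memLp_pathReal n).integrable (by norm_num)

variable (b s s₀ s₁ σ) in
/-- The mean path length. -/
def meanPath (n : ℕ) : ℝ := ∫ e, pathReal b s s₀ s₁ n e ∂envLaw σ

theorem meanPath_of_le {n : ℕ} (hn : n ≤ s) : meanPath b s s₀ s₁ σ n = 0 := by
  simp [meanPath, pathReal_of_le hn]

/-- No item escapes to infinite depth. The stored number is at most `n`, and the mean deficit solves
the homogeneous recursion, since the `s₀` items at the root cancel, and vanishes for `n ≤ s`. The
maximum principle makes it zero, and an upper bound with the right mean is attained almost surely.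
-/
theorem Setting.ae_items_eq (H : Setting b s s₀ s₁ σ) (n : ℕ) :
    ∀ᵐ e ∂envLaw σ, items b s s₀ s₁ n e = n := by
  have hle : ∀ n, ∀ᵐ e ∂envLaw σ, items b s s₀ s₁ n e ≤ n := fun n => by
    filter_upwards [ae_env_good H] with e he using H.items_le n he
  set i : ℕ → ENNReal := fun n => ∫⁻ e, items b s s₀ s₁ n e ∂envLaw σ with hi
  have hin : ∀ n, i n ≤ n := fun n => by
    calc i n ≤ ∫⁻ _e, (n : ENNReal) ∂envLaw σ := lintegral_mono_ae (hle n)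
      _ = n := by simp
  have hit : ∀ n, i n ≠ ⊤ := fun n => ((hin n).trans_lt (ENNReal.natCast_lt_top n)).ne
  have hrec : ∀ n, s < n → i n = s₀ + ∫⁻ r, ∑ j, i (cnt s s₀ s₁ n r j) ∂rootLaw σ := by
    intro n hn
    rw [hi]
    simp only
    rw [lintegral_env (measurable_items n)]
    simp_rw [items_join]
    have h1 : ∀ r : Root b, ∫⁻ ē, (((if n ≤ s then n else s₀ : ℕ) : ENNReal) +
        ∑ j, items b s s₀ s₁ (cnt s s₀ s₁ n r j) (ē j)) ∂(Measure.pi fun _ : Fin b => envLaw σ)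
        = s₀ + ∑ j, i (cnt s s₀ s₁ n r j) := by
      intro r
      have hm : ∀ j, Measurable fun ē : Fin b → Env b =>
          items b s s₀ s₁ (cnt s s₀ s₁ n r j) (ē j) := fun j =>
        (measurable_items _).comp (measurable_pi_apply j)
      rw [lintegral_add_left measurable_const, lintegral_finsetSum _ fun j _ => hm j]
      simp [lintegral_pi_eval (measurable_items _), not_le.2 hn, hi]
    simp_rw [h1]
    rw [lintegral_add_left measurable_const]
    simp [hi]
  have hu : ∀ n : ℕ, (n : ℝ) - (i n).toReal ≤ 0 := by
    refine H.max_principle (θ := fun _ _ _ => 1) (c := 1) (n₀ := s + 1)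
      (fun _ _ => measurable_const) (fun _ _ _ => zero_le_one) (fun _ _ _ => le_rfl)
      (Nat.succ_pos s) (fun n hn => ?_) (fun n hn => ?_) (fun n hn => ?_)
    · rw [one_mul]
      have := H.integral_sum_sq_cnt_le (n := n) (by omega)
      linarith [H.kappa_lt_one]
    · have : i n = n := by simp [hi, items_of_le (by omega : n ≤ s)]
      simp [this]
    · have hn' : s < n := by omega
      have h2 : (i n).toReal = s₀ + ∫ r, ∑ j, (i (cnt s s₀ s₁ n r j)).toReal ∂rootLaw σ := by
        have hfin : ∫⁻ r, ∑ j, i (cnt s s₀ s₁ n r j) ∂rootLaw σ ≠ ⊤ := by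
          have h3 := hrec n hn'
          intro h; rw [h] at h3; exact hit n (by simp [h3])
        rw [hrec n hn', ENNReal.toReal_add (ENNReal.natCast_ne_top _) hfin, ENNReal.toReal_natCast,
          ← integral_toReal]
        · simp_rw [fun r => ENNReal.toReal_sum (s := Finset.univ)
            (f := fun j => i (cnt s s₀ s₁ n r j)) fun j _ => hit _]
        · exact (Finset.measurable_fun_sum _ fun j _ =>
            (measurable_of_countable i).comp (measurable_cnt n j)).aemeasurable
        · exact ae_of_all _ fun r => ENNReal.sum_lt_top.2 fun j _ => (hit _).lt_top
      simp only [one_mul]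
      have h3 : ∫ r, ∑ j, ((cnt s s₀ s₁ n r j : ℝ) - (i (cnt s s₀ s₁ n r j)).toReal) ∂rootLaw σ
          = (n - s₀ : ℝ) - ∫ r, ∑ j, (i (cnt s s₀ s₁ n r j)).toReal ∂rootLaw σ := by
        simp only [Finset.sum_sub_distrib]
        rw [integral_sub (H.integrable_sum_cnt (fun k => (k : ℝ)) n)
          (H.integrable_sum_cnt (fun k => (i k).toReal) n)]
        congr 1
        rw [integral_congr_ae (g := fun _ => (n - s₀ : ℝ))]
        · simp
        · filter_upwards [ae_good H.simplex] with r hr using H.sum_cnt_real hn' hr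
      rw [h3, h2]
      linarith
  have hieq : i n = n := by
    refine le_antisymm (hin n) ?_
    rw [← ENNReal.ofReal_toReal (hit n), ← ENNReal.ofReal_natCast]
    exact ENNReal.ofReal_le_ofReal (by linarith [hu n])
  refine ae_eq_of_ae_le_of_lintegral_le (g := fun _ => (n : ENNReal)) (hle n) (hit n)
    aemeasurable_const ?_
  simp only [lintegral_const, measure_univ, mul_one]
  exact hieq.ge

theorem ae_prod_of_ae_root {p : Root b → Prop} (h : ∀ᵐ r ∂rootLaw σ, p r) :
    ∀ᵐ q ∂(rootLaw σ).prod (Measure.pi fun _ : Fin b => envLaw σ), p q.1 :=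
  Measure.quasiMeasurePreserving_fst.ae h

theorem ae_prod_of_ae_env {p : Env b → Prop} (h : ∀ᵐ e ∂envLaw σ, p e) :
    ∀ᵐ q ∂(rootLaw σ).prod (Measure.pi fun _ : Fin b => envLaw σ), ∀ j, p (q.2 j) := by
  rw [ae_all_iff]
  intro j
  exact ((measurePreserving_eval (fun _ : Fin b => envLaw σ) j).quasiMeasurePreserving.comp
    Measure.quasiMeasurePreserving_snd).ae h

/-- Every item that is not kept at the root gains one unit of depth, whence the toll `n - s₀`.
Conservation of items is what makes this an exact identity. -/
theorem Setting.pathReal_join (H : Setting b s s₀ s₁ σ) {n : ℕ} (hn : s < n) :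
    ∀ᵐ p ∂(rootLaw σ).prod (Measure.pi fun _ : Fin b => envLaw σ),
      pathReal b s s₀ s₁ n (join p) =
        (n - s₀ : ℝ) + ∑ j, pathReal b s s₀ s₁ (cnt s s₀ s₁ n p.1 j) (p.2 j) := by
  have h1 : ∀ᵐ e ∂envLaw σ, ∀ n, items b s s₀ s₁ n e = n := ae_all_iff.2 H.ae_items_eq
  have h2 : ∀ᵐ e ∂envLaw σ, ∀ n, pathLength b s s₀ s₁ n e < ⊤ := ae_all_iff.2 fun n =>
    ae_lt_top (measurable_pathLength n) (H.lintegral_pathLength_lt_top n).ne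
  filter_upwards [ae_prod_of_ae_root (ae_good H.simplex), ae_prod_of_ae_env h1,
    ae_prod_of_ae_env h2] with p hp hi hf
  rw [pathReal, pathLength_join, ENNReal.toReal_sum]
  · rw [← H.sum_cnt_real hn hp, ← Finset.sum_add_distrib]
    refine Finset.sum_congr rfl fun j _ => ?_
    rw [hi j, ENNReal.toReal_add (hf j _).ne (ENNReal.natCast_ne_top _), ENNReal.toReal_natCast,
      add_comm]
    rfl
  · intro j _
    rw [hi j]
    exact ENNReal.add_ne_top.2 ⟨(hf j _).ne, ENNReal.natCast_ne_top _⟩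

theorem integral_env {F : Env b → ℝ} (hF : Integrable F (envLaw σ)) :
    ∫ e, F e ∂envLaw σ =
      ∫ r, ∫ ē, F (join (r, ē)) ∂(Measure.pi fun _ : Fin b => envLaw σ) ∂rootLaw σ := by
  have h1 : Integrable (fun p => F (join p))
      ((rootLaw σ).prod (Measure.pi fun _ : Fin b => envLaw σ)) :=
    measurePreserving_join.integrable_comp_of_integrable hF
  rw [← integral_prod _ h1]
  have := map_join (σ := σ)
  nth_rewrite 1 [← this]
  exact integral_map measurable_join.aemeasurable (by rw [this]; exact hF.1)

theorem integrable_pi_eval {G : Env b → ℝ} (hG : Integrable G (envLaw σ)) (j : Fin b) :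
    Integrable (fun ē => G (ē j)) (Measure.pi fun _ : Fin b => envLaw σ) :=
  (measurePreserving_eval (fun _ : Fin b => envLaw σ) j).integrable_comp_of_integrable hG

theorem integral_pi_eval {G : Env b → ℝ} (hG : AEStronglyMeasurable G (envLaw σ)) (j : Fin b) :
    ∫ ē, G (ē j) ∂(Measure.pi fun _ : Fin b => envLaw σ) = ∫ e, G e ∂envLaw σ := by
  have := (measurePreserving_eval (fun _ : Fin b => envLaw σ) j).map_eq
  nth_rewrite 2 [← this]
  rw [integral_map (measurable_pi_apply j).aemeasurable (by rw [this]; exact hG)]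

theorem Setting.meanPath_rec (H : Setting b s s₀ s₁ σ) {n : ℕ} (hn : s < n) :
    meanPath b s s₀ s₁ σ n =
      (n - s₀ : ℝ) + ∫ r, ∑ j, meanPath b s s₀ s₁ σ (cnt s s₀ s₁ n r j) ∂rootLaw σ := by
  rw [meanPath, integral_env (H.integrable_pathReal n)]
  have h1 : ∀ᵐ r ∂rootLaw σ, ∫ ē, pathReal b s s₀ s₁ n (join (r, ē))
      ∂(Measure.pi fun _ : Fin b => envLaw σ) =
      (n - s₀ : ℝ) + ∑ j, meanPath b s s₀ s₁ σ (cnt s s₀ s₁ n r j) := by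
    filter_upwards [Measure.ae_ae_of_ae_prod (H.pathReal_join hn)] with r hr
    rw [integral_congr_ae hr, integral_add (integrable_const _)
      (integrable_finsetSum _ fun j _ => integrable_pi_eval (H.integrable_pathReal _) j),
      integral_finsetSum _ fun j _ => integrable_pi_eval (H.integrable_pathReal _) j]
    simp [integral_pi_eval (H.integrable_pathReal _).1, meanPath]
  rw [integral_congr_ae h1, integral_add (integrable_const _) (H.integrable_sum_cnt _ n)]
  simp

end PathLength

/-! ### The entropy and the toll function. -/

section Entropy

variable {b s s₀ s₁ : ℕ} {σ : Measure (Fin b → ℝ)} [IsProbabilityMeasure σ]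

theorem abs_mul_log_le_two {x : ℝ} (h0 : 0 ≤ x) (h1 : x ≤ 1) : |x * Real.log x| ≤ 2 := by
  have := abs_mul_log_sub_le h0 h1 le_rfl zero_le_one
  simp only [zero_mul, sub_zero, abs_of_nonneg h0] at this
  refine this.trans ?_
  have := Real.sqrt_le_one.2 h1
  linarith

theorem measurable_mul_log : Measurable fun x : ℝ => x * Real.log x :=
  measurable_id.mul Real.measurable_log

theorem Setting.integrable_mul_log (H : Setting b s s₀ s₁ σ) (j : Fin b) :
    Integrable (fun v : Fin b → ℝ => v j * Real.log (v j)) σ :=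
  H.integrable_of_le_one (measurable_mul_log.comp (measurable_pi_apply j)) (C := 2) fun _ hv =>
    abs_mul_log_le_two (hv.1 j) (le_one_of_mem_stdSimplex hv j)

theorem Setting.integrable_sum_mul_log (H : Setting b s s₀ s₁ σ) :
    Integrable (fun v : Fin b → ℝ => ∑ j, v j * Real.log (v j)) σ :=
  integrable_finsetSum _ fun j _ => H.integrable_mul_log j

/-- From `log x ≤ x - 1` one gets `-v log v ≥ v - v²`, so the entropy is at least `1 - κ`. -/
theorem Setting.entropy_pos (H : Setting b s s₀ s₁ σ) : 0 < entropy σ := by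
  have h : 1 - kappa σ ≤ entropy σ := by
    unfold entropy kappa
    rw [← integral_neg]
    have : ∫ v, (1 - ∑ j, v j ^ 2) ∂σ = 1 - ∫ v, ∑ j, v j ^ 2 ∂σ := by
      rw [integral_sub (integrable_const _) H.integrable_sum_sq]; simp
    rw [← this]
    refine integral_mono_ae ((integrable_const _).sub H.integrable_sum_sq)
      H.integrable_sum_mul_log.neg ?_
    filter_upwards [H.simplex] with v hv
    rw [← hv.2, ← Finset.sum_sub_distrib, ← Finset.sum_neg_distrib]
    refine Finset.sum_le_sum fun j _ => ?_
    rcases (hv.1 j).eq_or_lt with h | h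
    · simp [← h]
    · have := Real.log_le_sub_one_of_pos h
      nlinarith
  linarith [H.kappa_lt_one]

theorem measurable_toll (μ : ℝ) : Measurable (toll (b := b) μ) := by
  unfold toll
  exact measurable_const.add (measurable_const.mul (Finset.measurable_fun_sum _ fun j _ =>
    measurable_mul_log.comp (measurable_pi_apply j)))

/-- Division by the entropy is the normalization that centres the toll. -/
theorem Setting.integral_toll (H : Setting b s s₀ s₁ σ) :
    ∫ v, toll (entropy σ) v ∂σ = 0 := by
  unfold toll
  rw [integral_add (integrable_const _) (H.integrable_sum_mul_log.const_mul _),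
    integral_const_mul]
  have h : ∫ v, ∑ j, v j * Real.log (v j) ∂σ = -entropy σ := by simp [entropy]
  have := H.entropy_pos.ne'
  rw [h]
  simp
  field_simp
  simp

/-- A bound for the toll function on the simplex. -/
theorem exists_toll_bound (b : ℕ) (μ : ℝ) :
    ∃ M, ∀ v ∈ stdSimplex ℝ (Fin b), |toll μ v| ≤ M := by
  refine ⟨1 + |1 / μ| * (b * 2), fun v hv => ?_⟩
  unfold toll
  refine (abs_add_le _ _).trans ?_
  rw [abs_one, abs_mul]
  gcongr
  refine (Finset.abs_sum_le_sum_abs _ _).trans ?_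
  calc ∑ j, |v j * Real.log (v j)| ≤ ∑ _j : Fin b, (2 : ℝ) := Finset.sum_le_sum fun j _ =>
        abs_mul_log_le_two (hv.1 j) (le_one_of_mem_stdSimplex hv j)
    _ = b * 2 := by simp

end Entropy

/-! ### Increments of the mean path length. -/

section Increments

variable {b s s₀ s₁ : ℕ} {σ : Measure (Fin b → ℝ)} [IsProbabilityMeasure σ]

/-- The same numbers route the items for `n` and for `n + 1`, so the additional item changes the
count of just one child. -/
theorem Setting.cnt_succ (H : Setting b s s₀ s₁ σ) {n : ℕ} (hn : s < n) (r : Root b) (j : Fin b)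
    (f : ℕ → ℝ) : f (cnt s s₀ s₁ (n + 1) r j) - f (cnt s s₀ s₁ n r j) =
      chi r.1 (r.2 (n - s₀ - b * s₁)) j *
        (f (cnt s s₀ s₁ n r j + 1) - f (cnt s s₀ s₁ n r j)) := by
  classical
  have h1 := H.sub_add hn
  have hm : n + 1 - s₀ - b * s₁ = (n - s₀ - b * s₁) + 1 := by omega
  rw [cnt_of_lt (by omega : s < n + 1), cnt_of_lt hn, hm, Finset.range_add_one,
    Finset.filter_insert]
  unfold chi
  split_ifs with h
  · rw [Finset.card_insert_of_notMem (by simp), one_mul, ← add_assoc]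
  · simp

theorem Setting.integral_sum_chi_mul (H : Setting b s s₀ s₁ σ) (m : ℕ) :
    ∫ r, ∑ j, chi r.1 (r.2 m) j * r.1 j ∂rootLaw σ = kappa σ := by
  have hInt : ∀ j, Integrable (fun r : Root b => chi r.1 (r.2 m) j * r.1 j)
      (rootLaw σ) := fun j =>
    Integrable.of_bound ((measurable_chi_root m j).mul
      ((measurable_pi_apply j).comp measurable_fst)).aestronglyMeasurable 1 (by
        filter_upwards [ae_good H.simplex] with r hr
        rw [Real.norm_of_nonneg (mul_nonneg (chi_nonneg j) (hr.1.1 j))]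
        exact mul_le_one₀ (chi_le_one j) (hr.1.1 j) (le_one_of_mem_stdSimplex hr.1 j))
  unfold kappa
  rw [integral_finsetSum _ fun j _ => hInt j, integral_finsetSum]
  · refine Finset.sum_congr rfl fun j _ => ?_
    have := integral_prod _ (hInt j)
    rw [rootLaw, this]
    refine integral_congr_ae ?_
    filter_upwards [H.simplex] with v hv
    rw [integral_mul_const, integral_chi_eval hv, sq]
  · intro j _
    exact H.integrable_of_le_one (by fun_prop) (C := 1) fun v hv => by
      rw [abs_of_nonneg (sq_nonneg _)]
      have := hv.1 j; have := le_one_of_mem_stdSimplex hv j; nlinarith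

/-- The child selected by one further item is a size-biased choice, so its mean count is about `κ
n`. Comparing counts with `n V_j` avoids any independence between the selecting number and the
counts. -/
theorem Setting.integral_sum_chi_mul_cnt_le (H : Setting b s s₀ s₁ σ) {n : ℕ} (hn : s < n)
    (m : ℕ) : ∫ r, ∑ j, chi r.1 (r.2 m) j * (cnt s s₀ s₁ n r j : ℝ) ∂rootLaw σ ≤
      n * kappa σ + b * √(varConst s * n) := by
  have hi : Integrable (fun r : Root b => ∑ j, |(cnt s s₀ s₁ n r j - n * r.1 j : ℝ)|)
      (rootLaw σ) := integrable_finsetSum _ fun j _ => H.integrable_abs_cnt_sub n j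
  have hInt : Integrable (fun r : Root b => ∑ j, chi r.1 (r.2 m) j * r.1 j)
      (rootLaw σ) := integrable_finsetSum _ fun j _ =>
    Integrable.of_bound ((measurable_chi_root m j).mul
      ((measurable_pi_apply j).comp measurable_fst)).aestronglyMeasurable 1 (by
        filter_upwards [ae_good H.simplex] with r hr
        rw [Real.norm_of_nonneg (mul_nonneg (chi_nonneg j) (hr.1.1 j))]
        exact mul_le_one₀ (chi_le_one j) (hr.1.1 j) (le_one_of_mem_stdSimplex hr.1 j))
  calc ∫ r, ∑ j, chi r.1 (r.2 m) j * (cnt s s₀ s₁ n r j : ℝ) ∂rootLaw σ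
      ≤ ∫ r, (n * ∑ j, chi r.1 (r.2 m) j * r.1 j
          + ∑ j, |(cnt s s₀ s₁ n r j - n * r.1 j : ℝ)|) ∂rootLaw σ := by
        refine integral_mono (integrable_finsetSum _ fun j _ =>
          H.integrable_mul_cnt (fun k => (k : ℝ)) n j (measurable_chi_root m j) (c := 1)
            (ae_of_all _ fun r => by rw [abs_of_nonneg (chi_nonneg j)]; exact chi_le_one j))
          ((hInt.const_mul _).add hi) fun r => ?_
        simp only [Finset.mul_sum]
        rw [← Finset.sum_add_distrib]
        refine Finset.sum_le_sum fun j _ => ?_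
        have h0 := chi_nonneg (v := r.1) (x := r.2 m) j
        have h1 := chi_le_one (v := r.1) (x := r.2 m) j
        have h2 := le_abs_self (cnt s s₀ s₁ n r j - n * r.1 j : ℝ)
        have h3 := abs_nonneg (cnt s s₀ s₁ n r j - n * r.1 j : ℝ)
        nlinarith
    _ = n * kappa σ + ∑ j, ∫ r, |(cnt s s₀ s₁ n r j - n * r.1 j : ℝ)| ∂rootLaw σ := by
        rw [integral_add (hInt.const_mul _) hi, integral_const_mul, H.integral_sum_chi_mul,
          integral_finsetSum _ fun j _ => H.integrable_abs_cnt_sub n j]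
    _ ≤ n * kappa σ + ∑ _j : Fin b, √(varConst s * n) := by
        gcongr with j _
        exact H.integral_abs_cnt_sub_le hn j
    _ = _ := by simp

/-- The increments of the mean path length grow at most logarithmically. -/
theorem Setting.exists_bound_increment (H : Setting b s s₀ s₁ σ) :
    ∃ A A', 0 ≤ A ∧ 0 ≤ A' ∧ ∀ n : ℕ,
      |meanPath b s s₀ s₁ σ (n + 1) - meanPath b s s₀ s₁ σ n| ≤ A * Real.log (n + 1) + A' := by
  set a := meanPath b s s₀ s₁ σ with ha
  set d : ℕ → ℝ := fun n => a (n + 1) - a n with hd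
  have hκ := H.kappa_lt_one
  have hκ0 := kappa_nonneg (σ := σ)
  set c : ℝ := (1 - kappa σ) / 2 with hc
  have hc0 : 0 < c := by rw [hc]; linarith
  have hev : ∀ᶠ n : ℕ in atTop, s < n ∧
      ∫ r, ∑ j, (cnt s s₀ s₁ n r j : ℝ) ^ 2 ∂rootLaw σ ≤ (1 + kappa σ) / 2 * (n : ℝ) ^ 2 ∧
      n * kappa σ + b * √(varConst s * n) ≤ n - c * (n + 1) := by
    refine (eventually_gt_atTop s).and
      ((H.eventually_integral_sum_sq_cnt_le (by linarith)).and ?_)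
    have ht : Tendsto (fun n : ℕ => b * √(varConst s) / √(n : ℝ) + c / n) atTop (nhds (0 + 0)) :=
      (Tendsto.const_div_atTop (Real.tendsto_sqrt_atTop.comp tendsto_natCast_atTop_atTop) _).add
        (tendsto_const_div_atTop_nhds_zero_nat c)
    rw [add_zero] at ht
    filter_upwards [ht.eventually_le_const hc0, eventually_gt_atTop 0] with n hn hn0
    have hn0 : (0 : ℝ) < n := by exact_mod_cast hn0
    have hsn : 0 < √(n : ℝ) := Real.sqrt_pos.2 hn0
    have hsq : √(n : ℝ) * √(n : ℝ) = n := Real.mul_self_sqrt hn0.le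
    have h1 := mul_le_mul_of_nonneg_left hn hn0.le
    rw [mul_add, mul_div_cancel₀ _ hn0.ne'] at h1
    have h2 : (n : ℝ) * (b * √(varConst s) / √(n : ℝ)) = b * √(varConst s * n) := by
      rw [Real.sqrt_mul varConst_pos.le]
      nth_rewrite 1 [← hsq]
      field_simp
    rw [h2] at h1
    have : kappa σ = 1 - 2 * c := by rw [hc]; ring
    rw [this]
    linarith
  obtain ⟨n₀, hn₀⟩ := eventually_atTop.1 hev
  -- The increment satisfies `d(n) = 1 + E d(N)` with `N` the count of the child taking the new
  -- item. Since `log(N+1)` is on average at least `c` below `log(n+1)`, slope `1/c` pays for the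
  -- unit cost. The constant `A'` takes care of small `n`.
  set A := 1 / c with hA
  set A' := ∑ k ∈ Finset.range (n₀ + 1), |d k| with hA'
  have hA0 : 0 ≤ A := by positivity
  have hA'0 : 0 ≤ A' := by positivity
  refine ⟨A, A', hA0, hA'0, fun n => ?_⟩
  set w : ℕ → ℝ := fun n => A * Real.log (n + 1) + A' with hw
  have hlog0 : ∀ n : ℕ, 0 ≤ Real.log ((n : ℝ) + 1) := fun n =>
    Real.log_nonneg (by have : (0 : ℝ) ≤ n := by positivity
                        linarith)
  suffices h : |d n| - w n ≤ 0 by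
    have : |d n| ≤ w n := by linarith
    exact this
  refine H.max_principle (u := fun n => |d n| - w n)
    (θ := fun n r j => chi r.1 (r.2 (n - s₀ - b * s₁)) j) (c := 1) (n₀ := n₀ + 1)
    (fun n j => measurable_chi_root _ j) (fun _ _ j => chi_nonneg j) (fun _ _ j => chi_le_one j)
    (Nat.succ_pos _) (fun n hn => ?_) (fun n hn => ?_) (fun n hn => ?_) n
  · obtain ⟨h1, h2, -⟩ := hn₀ n (by omega)
    have hn0 : (0 : ℝ) < n := by exact_mod_cast (by omega : 0 < n)
    rw [one_mul]
    have : (0 : ℝ) < (n : ℝ) ^ 2 := by positivity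
    nlinarith
  · have h1 : |d n| ≤ A' := Finset.single_le_sum (f := fun k => |d k|)
      (fun _ _ => abs_nonneg _) (Finset.mem_range.2 hn)
    have h2 : 0 ≤ A * Real.log (n + 1) := mul_nonneg hA0 (hlog0 n)
    simp only [hw]
    linarith
  · obtain ⟨h1, h2, h3⟩ := hn₀ n (by omega)
    set χ : Root b → Fin b → ℝ := fun r j => chi r.1 (r.2 (n - s₀ - b * s₁)) j with hχ
    have hInt : ∀ f : ℕ → ℝ, Integrable (fun r => ∑ j, χ r j * f (cnt s s₀ s₁ n r j))
        (rootLaw σ) := fun f => integrable_finsetSum _ fun j _ =>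
      H.integrable_mul_cnt f n j (measurable_chi_root _ j) (c := 1)
        (ae_of_all _ fun r => by rw [abs_of_nonneg (chi_nonneg j)]; exact chi_le_one j)
    -- The difference of the recursions at `n + 1` and `n`, under the coupling `Setting.cnt_succ`.
    have hdn : d n = 1 + ∫ r, ∑ j, χ r j * d (cnt s s₀ s₁ n r j) ∂rootLaw σ := by
      have e1 : a (n + 1) = _ := H.meanPath_rec (n := n + 1) (by omega)
      have e2 : a n = _ := H.meanPath_rec h1
      simp only [hd]
      rw [e1, e2]
      have e3 : ∫ r, ∑ j, χ r j * (a (cnt s s₀ s₁ n r j + 1) - a (cnt s s₀ s₁ n r j)) ∂rootLaw σ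
          = ∫ r, ∑ j, a (cnt s s₀ s₁ (n + 1) r j) ∂rootLaw σ
            - ∫ r, ∑ j, a (cnt s s₀ s₁ n r j) ∂rootLaw σ := by
        rw [← integral_sub (H.integrable_sum_cnt a (n + 1)) (H.integrable_sum_cnt a n)]
        congr with r
        rw [← Finset.sum_sub_distrib]
        exact Finset.sum_congr rfl fun j _ => (H.cnt_succ h1 r j a).symm
      rw [e3]
      push_cast
      ring
    have habs : |d n| ≤ 1 + ∫ r, ∑ j, χ r j * |d (cnt s s₀ s₁ n r j)| ∂rootLaw σ := by
      rw [hdn]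
      refine (abs_add_le _ _).trans ?_
      rw [abs_one]
      gcongr
      refine (abs_integral_le_integral_abs).trans (integral_mono (hInt d).abs
        (hInt fun k => |d k|) fun r => ?_)
      refine (Finset.abs_sum_le_sum_abs _ _).trans (Finset.sum_le_sum fun j _ => ?_)
      rw [abs_mul, abs_of_nonneg (chi_nonneg j)]
    have hsub : ∫ r, ∑ j, χ r j * (|d (cnt s s₀ s₁ n r j)| - w (cnt s s₀ s₁ n r j)) ∂rootLaw σ
        = ∫ r, ∑ j, χ r j * |d (cnt s s₀ s₁ n r j)| ∂rootLaw σ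
          - ∫ r, ∑ j, χ r j * w (cnt s s₀ s₁ n r j) ∂rootLaw σ := by
      rw [← integral_sub (hInt fun k => |d k|) (hInt w)]
      congr with r
      rw [← Finset.sum_sub_distrib]
      exact Finset.sum_congr rfl fun j _ => by ring
    have hn1 : (0 : ℝ) < n + 1 := by positivity
    have hwle : ∫ r, ∑ j, χ r j * w (cnt s s₀ s₁ n r j) ∂rootLaw σ ≤ w n - 1 := by
      have e4 : ∫ r, ∑ j, χ r j * w (cnt s s₀ s₁ n r j) ∂rootLaw σ ≤
          ∫ r, ((w n - A * n / (n + 1)) + A / (n + 1) *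
            ∑ j, χ r j * (cnt s s₀ s₁ n r j : ℝ)) ∂rootLaw σ := by
        refine integral_mono_ae (hInt w) ((integrable_const _).add
          ((hInt fun k => (k : ℝ)).const_mul _)) ?_
        filter_upwards [ae_good H.simplex] with r hr
        have hs1 : ∑ j, χ r j = 1 := sum_chi hr.1 (hr.2 _)
        calc ∑ j, χ r j * w (cnt s s₀ s₁ n r j)
            ≤ ∑ j, χ r j * ((w n - A * n / (n + 1)) + A / (n + 1) * cnt s s₀ s₁ n r j) := by
              refine Finset.sum_le_sum fun j _ => mul_le_mul_of_nonneg_left ?_ (chi_nonneg j)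
              simp only [hw]
              set N : ℝ := ((cnt s s₀ s₁ n r j : ℕ) : ℝ) with hN
              have hN1 : 0 < N + 1 := by positivity
              have h5 := Real.log_le_sub_one_of_pos (div_pos hN1 hn1)
              rw [Real.log_div hN1.ne' hn1.ne'] at h5
              have h6 : A * (Real.log (N + 1) - Real.log (n + 1)) ≤ A * ((N + 1) / (n + 1) - 1) :=
                mul_le_mul_of_nonneg_left h5 hA0
              have h7 : A * ((N + 1) / (n + 1) - 1) = A / (n + 1) * N - A * n / (n + 1) := by
                field_simp; ring
              linarith
          _ = _ := by
              simp only [mul_add, Finset.sum_add_distrib]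
              rw [← Finset.sum_mul, hs1, one_mul, Finset.mul_sum]
              congr 1
              exact Finset.sum_congr rfl fun j _ => by ring
      rw [integral_add (integrable_const _) ((hInt fun k => (k : ℝ)).const_mul _),
        integral_const_mul] at e4
      simp only [integral_const, probReal_univ, one_smul] at e4
      have e5 := (H.integral_sum_chi_mul_cnt_le h1 (n - s₀ - b * s₁)).trans h3
      have e6 : A / (n + 1) * ∫ r, ∑ j, χ r j * (cnt s s₀ s₁ n r j : ℝ) ∂rootLaw σ ≤
          A / (n + 1) * (n - c * (n + 1)) := mul_le_mul_of_nonneg_left e5 (by positivity)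
      have e7 : A / (n + 1) * (n - c * (n + 1)) = A * n / (n + 1) - 1 := by
        rw [hA]; field_simp
      linarith
    rw [hsub]
    linarith

end Increments

/-! ### Fourth roots, the scale in which error terms are measured. -/

section FourthRoot

/-- The fourth root. -/
def qrt (x : ℝ) : ℝ := √(√x)

theorem qrt_nonneg (x : ℝ) : 0 ≤ qrt x := Real.sqrt_nonneg _

theorem qrt_sq (x : ℝ) : qrt x ^ 2 = √x := Real.sq_sqrt (Real.sqrt_nonneg _)

theorem qrt_pow_four {x : ℝ} (hx : 0 ≤ x) : qrt x ^ 4 = x := by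
  rw [show (4 : ℕ) = 2 * 2 from rfl, pow_mul, qrt_sq, Real.sq_sqrt hx]

theorem qrt_mono {x y : ℝ} (h : x ≤ y) : qrt x ≤ qrt y :=
  Real.sqrt_le_sqrt (Real.sqrt_le_sqrt h)

theorem one_le_qrt {x : ℝ} (hx : 1 ≤ x) : 1 ≤ qrt x := by
  have := qrt_mono hx
  simpa [qrt] using this

theorem log_le_qrt {x : ℝ} (hx : 1 ≤ x) : Real.log x ≤ 4 * qrt x := by
  have h := one_le_qrt hx
  have h1 := Real.log_le_sub_one_of_pos (by linarith : 0 < qrt x)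
  have h2 : Real.log x = 4 * Real.log (qrt x) := by
    nth_rewrite 1 [← qrt_pow_four (by linarith : 0 ≤ x)]
    rw [Real.log_pow]; norm_num
  linarith

theorem tendsto_qrt : Tendsto qrt atTop atTop :=
  Real.tendsto_sqrt_atTop.comp Real.tendsto_sqrt_atTop

theorem qrt_pow_three_le {x : ℝ} (hx : 1 ≤ x) : qrt x ^ 3 ≤ x := by
  have h := one_le_qrt hx
  calc qrt x ^ 3 ≤ qrt x ^ 4 := pow_le_pow_right₀ h (by norm_num)
    _ = x := qrt_pow_four (by linarith)

/-- A quantitative form of the concavity of `x ↦ x ^ (3 / 4)`. -/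
theorem qrt_pow_three_ge {x y : ℝ} (hx : 0 ≤ x) (hxy : x ≤ y) (hy : 0 < y) :
    qrt y ^ 3 * (5 / 4 * (x / y) - (x / y) ^ 2 / 4) ≤ qrt x ^ 3 := by
  have hp : 0 < qrt y := Real.sqrt_pos.2 (Real.sqrt_pos.2 hy)
  set t := qrt x / qrt y with ht
  have ht0 : 0 ≤ t := div_nonneg (qrt_nonneg x) hp.le
  have ht1 : t ≤ 1 := (div_le_one hp).2 (qrt_mono hxy)
  have e1 : x / y = t ^ 4 := by
    rw [ht, div_pow, qrt_pow_four hx, qrt_pow_four hy.le]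
  have e2 : qrt x ^ 3 = qrt y ^ 3 * t ^ 3 := by
    rw [ht, div_pow]; field_simp
  rw [e1, e2]
  refine mul_le_mul_of_nonneg_left ?_ (by positivity)
  have h3 : 0 ≤ t ^ 3 := by positivity
  have h4 : t * (1 + t + t ^ 2 + t ^ 3) ≤ 4 := by
    have a2 : t ^ 2 ≤ 1 := pow_le_one₀ ht0 ht1
    have a3 : t ^ 3 ≤ 1 := pow_le_one₀ ht0 ht1
    have : (1 + t + t ^ 2 + t ^ 3) ≤ 4 := by linarith
    calc t * (1 + t + t ^ 2 + t ^ 3) ≤ 1 * 4 := mul_le_mul ht1 this (by positivity) zero_le_one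
      _ = 4 := by norm_num
  -- This is the factorization of `4t³ - 5t⁴ + t⁸`, that is, four times the gap in the inequality at
  -- `x / y = t⁴`.
  have h5 : 0 ≤ t ^ 3 * ((1 - t) * (4 - t * (1 + t + t ^ 2 + t ^ 3))) :=
    mul_nonneg h3 (mul_nonneg (by linarith) (by linarith))
  nlinarith

end FourthRoot

/-! ### One-step expansion of the mean path length. -/

section SecondOrder

variable {b s s₀ s₁ : ℕ} {σ : Measure (Fin b → ℝ)} [IsProbabilityMeasure σ]

variable (b s s₀ s₁ σ) in
/-- The mean path length without its leading term. -/
def meanRest (n : ℕ) : ℝ := meanPath b s s₀ s₁ σ n - n * Real.log n / entropy σ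

theorem meanRest_zero : meanRest b s s₀ s₁ σ 0 = 0 := by
  simp [meanRest, meanPath_of_le (Nat.zero_le s)]

theorem abs_succ_mul_log_sub_le (n : ℕ) :
    |((n + 1 : ℕ) : ℝ) * Real.log (n + 1 : ℕ) - n * Real.log n| ≤ Real.log (n + 1) + 1 := by
  rcases Nat.eq_zero_or_pos n with rfl | hn
  · simp
  have hn0 : (0 : ℝ) < n := by exact_mod_cast hn
  have h1 := Real.log_le_sub_one_of_pos (by positivity : (0 : ℝ) < (n + 1) / n)
  rw [Real.log_div (by positivity) hn0.ne'] at h1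
  have h2 : (n : ℝ) * (Real.log (n + 1) - Real.log n) ≤ 1 := by
    calc (n : ℝ) * (Real.log (n + 1) - Real.log n) ≤ n * ((n + 1) / n - 1) :=
          mul_le_mul_of_nonneg_left h1 hn0.le
      _ = 1 := by field_simp; ring
  have h3 : Real.log n ≤ Real.log (n + 1) := Real.log_le_log hn0 (by linarith)
  have h4 : 0 ≤ Real.log ((n : ℝ) + 1) := Real.log_nonneg (by linarith)
  push_cast
  rw [abs_le]
  constructor <;> nlinarith

/-- Both `meanPath` and `n log n` have logarithmic increments. Weakening `log n` to `n^(1/4)` keeps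
all later errors powers of `qrt`, and leaves room for fluctuations of order `√n`: the product is
`n^(3/4)`, still `o(n)`. -/
theorem Setting.exists_lipschitz_meanRest (H : Setting b s s₀ s₁ σ) :
    ∃ L, 0 ≤ L ∧ ∀ n k m : ℕ, k ≤ n → m ≤ n →
      |meanRest b s s₀ s₁ σ m - meanRest b s s₀ s₁ σ k| ≤ L * qrt n * |(m : ℝ) - k| := by
  obtain ⟨A, A', hA, hA', hinc⟩ := H.exists_bound_increment
  have hμ := H.entropy_pos
  set μ := entropy σ with hμd
  set f := meanRest b s s₀ s₁ σ with hf
  set L := 4 * (A + 1 / μ) + (A' + 1 / μ) with hL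
  have hL0 : 0 ≤ L := by positivity
  have hstep : ∀ n k : ℕ, k + 1 ≤ n → |f (k + 1) - f k| ≤ L * qrt n := by
    intro n k hk
    have h1 := hinc k
    have h2 := abs_succ_mul_log_sub_le k
    have hk1 : (1 : ℝ) ≤ (k : ℝ) + 1 := by
      have : (0 : ℝ) ≤ k := by positivity
      linarith
    have h3 := log_le_qrt hk1
    have h4 := one_le_qrt hk1
    have h5 : qrt ((k : ℝ) + 1) ≤ qrt n := qrt_mono (by exact_mod_cast hk)
    have e : f (k + 1) - f k = (meanPath b s s₀ s₁ σ (k + 1) - meanPath b s s₀ s₁ σ k) -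
        1 / μ * (((k + 1 : ℕ) : ℝ) * Real.log (k + 1 : ℕ) - k * Real.log k) := by
      simp only [hf, meanRest]; ring
    rw [e]
    refine (abs_sub _ _).trans ?_
    rw [abs_mul, abs_of_pos (by positivity : 0 < 1 / μ)]
    have h6 := mul_le_mul_of_nonneg_left h2 (by positivity : 0 ≤ 1 / μ)
    have h7 : (A + 1 / μ) * Real.log (k + 1) ≤ (A + 1 / μ) * (4 * qrt (k + 1)) :=
      mul_le_mul_of_nonneg_left h3 (by positivity)
    have h8 : (A' + 1 / μ) * 1 ≤ (A' + 1 / μ) * qrt (k + 1) :=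
      mul_le_mul_of_nonneg_left h4 (by positivity)
    have h9 : L * qrt (k + 1) ≤ L * qrt n := mul_le_mul_of_nonneg_left h5 hL0
    have h10 : L * qrt (k + 1) = (A + 1 / μ) * (4 * qrt (k + 1)) + (A' + 1 / μ) * qrt (k + 1) := by
      rw [hL]; ring
    linarith
  have hle : ∀ n k m : ℕ, k ≤ m → m ≤ n → |f m - f k| ≤ L * qrt n * |(m : ℝ) - k| := by
    intro n k m hkm
    induction m, hkm using Nat.le_induction with
    | base => simp
    | succ m hkm ih =>
      intro hmn
      have h1 := ih (by omega)
      have h2 := hstep n m hmn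
      have hkm' : (k : ℝ) ≤ m := by exact_mod_cast hkm
      rw [abs_of_nonneg (by linarith : (0 : ℝ) ≤ (m : ℝ) - k)] at h1
      push_cast
      rw [abs_of_nonneg (by linarith : (0 : ℝ) ≤ (m : ℝ) + 1 - k)]
      calc |f (m + 1) - f k| = |(f (m + 1) - f m) + (f m - f k)| := by ring_nf
        _ ≤ _ := abs_add_le _ _
        _ ≤ L * qrt n + L * qrt n * (m - k) := add_le_add h2 h1
        _ = _ := by ring
  refine ⟨L, hL0, fun n k m hk hm => ?_⟩
  rcases le_total k m with h | h
  · exact hle n k m h hm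
  · rw [abs_sub_comm, abs_sub_comm (m : ℝ)]; exact hle n m k h hk

variable (s s₀ s₁) in
/-- The deterministic error in the one-step expansion of the path length at a root. -/
def stepErr (μ : ℝ) (n : ℕ) (r : Root b) : ℝ :=
  -s₀ - s₀ / μ * Real.log n + n / μ *
    ∑ j, ((cnt s s₀ s₁ n r j : ℝ) / n * Real.log ((cnt s s₀ s₁ n r j : ℝ) / n)
      - r.1 j * Real.log (r.1 j))

/-- With `∑ N_j = n - s₀` and `N log N = n (N/n) log (N/n) + N log n`, the terms `n log n` almost
cancel. What remains is the entropy of the empirical split `N_j / n`; exchanging it for that of `V`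
produces the toll and the main part of `stepErr`. -/
theorem Setting.step_eq (H : Setting b s s₀ s₁ σ) {n : ℕ} (hn : s < n) {r : Root b}
    (hr : Good r) :
    (n - s₀ : ℝ) + ∑ j, meanPath b s s₀ s₁ σ (cnt s s₀ s₁ n r j) - meanPath b s s₀ s₁ σ n =
      n * toll (entropy σ) r.1 + stepErr s s₀ s₁ (entropy σ) n r +
        (∑ j, meanRest b s s₀ s₁ σ (cnt s s₀ s₁ n r j) - meanRest b s s₀ s₁ σ n) := by
  have hμ := H.entropy_pos.ne'
  set μ := entropy σ with hμd
  have hn0 : (n : ℝ) ≠ 0 := by exact_mod_cast (by omega : n ≠ 0)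
  have hs := H.sum_cnt_real hn hr
  have e1 : ∀ j, (cnt s s₀ s₁ n r j : ℝ) * Real.log (cnt s s₀ s₁ n r j) =
      n * ((cnt s s₀ s₁ n r j : ℝ) / n * Real.log ((cnt s s₀ s₁ n r j : ℝ) / n)) +
        cnt s s₀ s₁ n r j * Real.log n := by
    intro j
    rcases eq_or_ne (cnt s s₀ s₁ n r j : ℝ) 0 with h | h
    · simp [h]
    · rw [Real.log_div h hn0]; field_simp; ring
  have e2 : ∑ j, (cnt s s₀ s₁ n r j : ℝ) * Real.log (cnt s s₀ s₁ n r j) =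
      n * ∑ j, ((cnt s s₀ s₁ n r j : ℝ) / n * Real.log ((cnt s s₀ s₁ n r j : ℝ) / n)) +
        (n - s₀) * Real.log n := by
    rw [← hs, Finset.sum_mul, Finset.mul_sum, ← Finset.sum_add_distrib]
    exact Finset.sum_congr rfl fun j _ => e1 j
  have e3 : ∑ j, meanRest b s s₀ s₁ σ (cnt s s₀ s₁ n r j) =
      ∑ j, meanPath b s s₀ s₁ σ (cnt s s₀ s₁ n r j) -
        (∑ j, (cnt s s₀ s₁ n r j : ℝ) * Real.log (cnt s s₀ s₁ n r j)) / μ := by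
    rw [Finset.sum_div, ← Finset.sum_sub_distrib]; rfl
  rw [e3, e2]
  simp only [stepErr, toll, meanRest, Finset.sum_sub_distrib]
  rw [← hμd]
  field_simp
  ring

theorem measurable_stepErr (μ : ℝ) (n : ℕ) :
    Measurable fun r : Root b => stepErr s s₀ s₁ μ n r := by
  unfold stepErr
  refine measurable_const.add (measurable_const.mul (Finset.measurable_fun_sum _ fun j _ => ?_))
  refine Measurable.sub ?_ ?_
  · exact (measurable_of_countable
      (fun k : ℕ => (k : ℝ) / n * Real.log ((k : ℝ) / n))).comp (measurable_cnt n j)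
  · exact measurable_mul_log.comp ((measurable_pi_apply j).comp measurable_fst)

/-- Hölder continuity of order `1/2` of `x log x` means that the square of the entropy difference is
linear in `|N_j - n V_j|`, whose mean is known. The other part of the error is logarithmic. -/
theorem Setting.sq_stepErr_le (H : Setting b s s₀ s₁ σ) {n : ℕ} (hn : s < n) {r : Root b}
    (hr : Good r) : stepErr s s₀ s₁ (entropy σ) n r ^ 2 ≤
      2 * (s₀ + 4 * s₀ / entropy σ) ^ 2 * √n + 8 * b / entropy σ ^ 2 * n *
        ∑ j, |(cnt s s₀ s₁ n r j - n * r.1 j : ℝ)| := by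
  have hμ := H.entropy_pos
  set μ := entropy σ with hμd
  have hn1 : (1 : ℝ) ≤ n := by exact_mod_cast (by omega : 1 ≤ n)
  have hn0 : (0 : ℝ) < n := by linarith
  set A : ℝ := s₀ + s₀ / μ * Real.log n with hA
  set S := ∑ j, ((cnt s s₀ s₁ n r j : ℝ) / n * Real.log ((cnt s s₀ s₁ n r j : ℝ) / n)
      - r.1 j * Real.log (r.1 j)) with hS
  have e : stepErr s s₀ s₁ μ n r = -A + n / μ * S := by simp only [stepErr, hA, ← hS]; ring
  have hAle : A ≤ (s₀ + 4 * s₀ / μ) * qrt n := by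
    have h1 := one_le_qrt hn1
    have h2 := log_le_qrt hn1
    have h3 : (s₀ : ℝ) / μ * Real.log n ≤ s₀ / μ * (4 * qrt n) :=
      mul_le_mul_of_nonneg_left h2 (by positivity)
    have h4 : (s₀ : ℝ) * 1 ≤ s₀ * qrt n := mul_le_mul_of_nonneg_left h1 (by positivity)
    have h5 : (s₀ + 4 * s₀ / μ) * qrt n = s₀ * qrt n + s₀ / μ * (4 * qrt n) := by ring
    linarith
  have hA0 : 0 ≤ A := by
    have := Real.log_nonneg hn1
    positivity
  have hA2 : A ^ 2 ≤ (s₀ + 4 * s₀ / μ) ^ 2 * √n := by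
    rw [← qrt_sq, ← mul_pow]
    exact pow_le_pow_left₀ hA0 hAle 2
  have hS2 : S ^ 2 ≤ 4 * b / n * ∑ j, |(cnt s s₀ s₁ n r j - n * r.1 j : ℝ)| := by
    refine (sq_sum_le_card_mul_sum_sq).trans ?_
    rw [Finset.card_univ, Fintype.card_fin]
    have : ∑ j, ((cnt s s₀ s₁ n r j : ℝ) / n * Real.log ((cnt s s₀ s₁ n r j : ℝ) / n)
        - r.1 j * Real.log (r.1 j)) ^ 2 ≤
        ∑ j, 4 / n * |(cnt s s₀ s₁ n r j - n * r.1 j : ℝ)| := by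
      refine Finset.sum_le_sum fun j _ => ?_
      have h1 : (cnt s s₀ s₁ n r j : ℝ) / n ≤ 1 :=
        (div_le_one hn0).2 (by exact_mod_cast H.cnt_le n r j)
      have h2 := abs_mul_log_sub_le (by positivity) h1 (hr.1.1 j)
        (le_one_of_mem_stdSimplex hr.1 j)
      rw [← sq_abs]
      refine (pow_le_pow_left₀ (abs_nonneg _) h2 2).trans (le_of_eq ?_)
      rw [mul_pow, Real.sq_sqrt (abs_nonneg _)]
      have : (cnt s s₀ s₁ n r j : ℝ) / n - r.1 j = (cnt s s₀ s₁ n r j - n * r.1 j : ℝ) / n := by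
        field_simp
      rw [this, abs_div, abs_of_pos hn0]
      ring
    calc (b : ℝ) * _ ≤ b * ∑ j, 4 / n * |(cnt s s₀ s₁ n r j - n * r.1 j : ℝ)| :=
          mul_le_mul_of_nonneg_left this (by positivity)
      _ = _ := by rw [← Finset.mul_sum]; ring
  rw [e]
  have h6 : (n / μ * S) ^ 2 ≤ 4 * b / μ ^ 2 * n * ∑ j, |(cnt s s₀ s₁ n r j - n * r.1 j : ℝ)| := by
    rw [mul_pow]
    refine (mul_le_mul_of_nonneg_left hS2 (by positivity)).trans (le_of_eq ?_)
    field_simp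
  have h7 : 8 * b / μ ^ 2 * n * ∑ j, |(cnt s s₀ s₁ n r j - n * r.1 j : ℝ)| =
    2 * (4 * b / μ ^ 2 * n * ∑ j, |(cnt s s₀ s₁ n r j - n * r.1 j : ℝ)|) := by ring
  rw [h7]
  nlinarith [sq_nonneg (A + n / μ * S)]

theorem Setting.integrable_sq_stepErr (H : Setting b s s₀ s₁ σ) {n : ℕ} (hn : s < n) :
    Integrable (fun r : Root b => stepErr s s₀ s₁ (entropy σ) n r ^ 2) (rootLaw σ) := by
  refine Integrable.mono' ((integrable_const (2 * (s₀ + 4 * s₀ / entropy σ) ^ 2 * √n)).add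
    ((integrable_finsetSum Finset.univ fun j _ => H.integrable_abs_cnt_sub n j).const_mul
      (8 * b / entropy σ ^ 2 * n)))
    ((measurable_stepErr _ n).pow_const 2).aestronglyMeasurable ?_
  filter_upwards [ae_good H.simplex] with r hr
  rw [Real.norm_of_nonneg (sq_nonneg _)]
  exact H.sq_stepErr_le hn hr

theorem Setting.integrable_stepErr (H : Setting b s s₀ s₁ σ) {n : ℕ} (hn : s < n) :
    Integrable (fun r : Root b => stepErr s s₀ s₁ (entropy σ) n r) (rootLaw σ) :=
  (MemLp.integrable one_le_two ((memLp_two_iff_integrable_sq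
    (measurable_stepErr _ n).aestronglyMeasurable).2 (H.integrable_sq_stepErr hn)))

/-- The mean deviation of a count is of order `√n`, hence the mean square error has order `n^(3/2) =
qrt n ^ 6`, which is `o(n²)`. -/
theorem Setting.exists_bound_sq_stepErr (H : Setting b s s₀ s₁ σ) :
    ∃ K, 0 ≤ K ∧ ∀ n : ℕ, s < n →
      ∫ r, stepErr s s₀ s₁ (entropy σ) n r ^ 2 ∂rootLaw σ ≤ K * qrt n ^ 6 := by
  have hμ := H.entropy_pos
  set μ := entropy σ with hμd
  refine ⟨2 * (s₀ + 4 * s₀ / μ) ^ 2 + 8 * b / μ ^ 2 * (b * √(varConst s)), by positivity,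
    fun n hn => ?_⟩
  have hn1 : (1 : ℝ) ≤ n := by exact_mod_cast (by omega : 1 ≤ n)
  have hi := integrable_finsetSum Finset.univ fun j _ => H.integrable_abs_cnt_sub n j
  calc ∫ r, stepErr s s₀ s₁ μ n r ^ 2 ∂rootLaw σ
      ≤ ∫ r, (2 * (s₀ + 4 * s₀ / μ) ^ 2 * √n + 8 * b / μ ^ 2 * n *
        ∑ j, |(cnt s s₀ s₁ n r j - n * r.1 j : ℝ)|) ∂rootLaw σ := by
        refine integral_mono_ae (H.integrable_sq_stepErr hn)
          ((integrable_const _).add (hi.const_mul _)) ?_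
        filter_upwards [ae_good H.simplex] with r hr using H.sq_stepErr_le hn hr
    _ = 2 * (s₀ + 4 * s₀ / μ) ^ 2 * √n + 8 * b / μ ^ 2 * n *
        ∑ j, ∫ r, |(cnt s s₀ s₁ n r j - n * r.1 j : ℝ)| ∂rootLaw σ := by
        rw [integral_add (integrable_const _) (hi.const_mul _), integral_const,
          integral_const_mul, integral_finsetSum _ fun j _ => H.integrable_abs_cnt_sub n j]
        simp
    _ ≤ 2 * (s₀ + 4 * s₀ / μ) ^ 2 * √n + 8 * b / μ ^ 2 * n *
        ∑ _j : Fin b, √(varConst s * n) := by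
        gcongr with j _
        exact H.integral_abs_cnt_sub_le hn j
    _ = 2 * (s₀ + 4 * s₀ / μ) ^ 2 * qrt n ^ 2 +
          8 * b / μ ^ 2 * (b * √(varConst s)) * (qrt n ^ 4 * qrt n ^ 2) := by
        rw [qrt_sq, qrt_pow_four (by linarith), Real.sqrt_mul varConst_pos.le]
        simp
        ring
    _ ≤ 2 * (s₀ + 4 * s₀ / μ) ^ 2 * qrt n ^ 6 +
          8 * b / μ ^ 2 * (b * √(varConst s)) * (qrt n ^ 4 * qrt n ^ 2) := by
        gcongr
        · exact one_le_qrt hn1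
        · norm_num
    _ = _ := by ring

/-- Taking means in `Setting.step_eq` removes the toll, because it is centred; the left side
vanishes by the recursion for the mean. -/
theorem Setting.meanRest_sub (H : Setting b s s₀ s₁ σ) {n : ℕ} (hn : s < n) :
    meanRest b s s₀ s₁ σ n =
      ∫ r, stepErr s s₀ s₁ (entropy σ) n r ∂rootLaw σ +
        ∫ r, ∑ j, meanRest b s s₀ s₁ σ (cnt s s₀ s₁ n r j) ∂rootLaw σ := by
  have h1 := H.meanPath_rec hn
  have hi1 := H.integrable_sum_cnt (meanPath b s s₀ s₁ σ) n
  have hi2 := H.integrable_sum_cnt (meanRest b s s₀ s₁ σ) n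
  have hit : Integrable (fun r : Root b => n * toll (entropy σ) r.1) (rootLaw σ) := by
    obtain ⟨M, hM⟩ := exists_toll_bound b (entropy σ)
    exact ((H.integrable_of_le_one (measurable_toll _) hM).comp_fst unifSeqLaw).const_mul _
  have h2 : ∫ r, ((n - s₀ : ℝ) + ∑ j, meanPath b s s₀ s₁ σ (cnt s s₀ s₁ n r j)
      - meanPath b s s₀ s₁ σ n) ∂rootLaw σ = ∫ r, (n * toll (entropy σ) r.1
        + stepErr s s₀ s₁ (entropy σ) n r +
        (∑ j, meanRest b s s₀ s₁ σ (cnt s s₀ s₁ n r j) - meanRest b s s₀ s₁ σ n)) ∂rootLaw σ := by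
    refine integral_congr_ae ?_
    filter_upwards [ae_good H.simplex] with r hr using H.step_eq hn hr
  have hi3 : Integrable (fun r : Root b => (n - s₀ : ℝ) +
      ∑ j, meanPath b s s₀ s₁ σ (cnt s s₀ s₁ n r j)) (rootLaw σ) := (integrable_const _).add hi1
  have hi4 : Integrable (fun r : Root b => n * toll (entropy σ) r.1
      + stepErr s s₀ s₁ (entropy σ) n r) (rootLaw σ) := hit.add (H.integrable_stepErr hn)
  have hi5 : Integrable (fun r : Root b => ∑ j, meanRest b s s₀ s₁ σ (cnt s s₀ s₁ n r j) -
      meanRest b s s₀ s₁ σ n) (rootLaw σ) := hi2.sub (integrable_const _)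
  rw [integral_sub hi3 (integrable_const _), integral_add (integrable_const _) hi1,
    integral_add hi4 hi5,
    integral_add hit (H.integrable_stepErr hn), integral_sub hi2 (integrable_const _),
    integral_const_mul, integral_rootLaw_fst (toll (entropy σ)), H.integral_toll] at h2
  simp at h2
  linarith

end SecondOrder

/-! ### Linear growth of the second order term. -/

section LinearBound

variable {b s s₀ s₁ : ℕ} {σ : Measure (Fin b → ℝ)} [IsProbabilityMeasure σ]

theorem Setting.exists_bound_meanRest_sub (H : Setting b s s₀ s₁ σ) :
    ∃ K, 0 ≤ K ∧ ∀ n : ℕ, s < n → |meanRest b s s₀ s₁ σ n -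
      ∫ r, ∑ j, meanRest b s s₀ s₁ σ (cnt s s₀ s₁ n r j) ∂rootLaw σ| ≤ K * qrt n ^ 3 := by
  obtain ⟨K, hK, h⟩ := H.exists_bound_sq_stepErr
  refine ⟨√K, Real.sqrt_nonneg _, fun n hn => ?_⟩
  rw [H.meanRest_sub hn, add_sub_cancel_right]
  refine abs_le_of_sq_le_sq ?_ (mul_nonneg (Real.sqrt_nonneg _) (pow_nonneg (qrt_nonneg _) _))
  refine (sq_integral_le_integral_sq (H.integrable_stepErr hn) (H.integrable_sq_stepErr hn)).trans
    ((h n hn).trans (le_of_eq ?_))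
  rw [mul_pow, Real.sq_sqrt hK]
  ring

/-- The function `n ^ (3 / 4)` grows by a constant factor under averaging over the subtrees. -/
theorem Setting.exists_qrt_growth (H : Setting b s s₀ s₁ σ) :
    ∃ δ : ℝ, 0 < δ ∧ ∀ᶠ n : ℕ in atTop, (1 + δ) * qrt n ^ 3 ≤
      ∫ r, ∑ j, qrt (cnt s s₀ s₁ n r j) ^ 3 ∂rootLaw σ := by
  have hκ := H.kappa_lt_one
  set κ' := (1 + kappa σ) / 2 with hκ'
  -- Summing `qrt_pow_three_ge` gives a factor of at least `5/4 - κ'/4 = 1 + (1 - κ')/4`, up to a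
  -- term of order `s₀ / n`; half of the gain is kept for that term.
  refine ⟨(1 - κ') / 8, by linarith, ?_⟩
  have ht : Tendsto (fun n : ℕ => 5 / 4 * (s₀ : ℝ) / n) atTop (nhds 0) :=
    tendsto_const_div_atTop_nhds_zero_nat _
  filter_upwards [H.eventually_integral_sum_sq_cnt_le (by linarith : kappa σ < κ'),
    ht.eventually_le_const (by linarith : 0 < (1 - κ') / 8), eventually_gt_atTop s] with n h1 h2 hn
  have hn0 : (0 : ℝ) < n := by exact_mod_cast (by omega : 0 < n)
  have hq : 0 ≤ qrt n ^ 3 := pow_nonneg (qrt_nonneg _) _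
  have hi := H.integrable_sum_cnt (fun k => (k : ℝ) ^ 2) n
  have h3 : ∫ r, (qrt n ^ 3 * (5 / 4 * (1 - s₀ / n)) - qrt n ^ 3 / (4 * n ^ 2) *
      ∑ j, (cnt s s₀ s₁ n r j : ℝ) ^ 2) ∂rootLaw σ ≤
      ∫ r, ∑ j, qrt (cnt s s₀ s₁ n r j) ^ 3 ∂rootLaw σ := by
    refine integral_mono_ae ((integrable_const _).sub (hi.const_mul _))
      (H.integrable_sum_cnt (fun k => qrt k ^ 3) n) ?_
    filter_upwards [ae_good H.simplex] with r hr
    have hs := H.sum_cnt_real hn hr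
    calc qrt n ^ 3 * (5 / 4 * (1 - s₀ / n)) - qrt n ^ 3 / (4 * n ^ 2) *
          ∑ j, (cnt s s₀ s₁ n r j : ℝ) ^ 2
        = ∑ j, qrt n ^ 3 * (5 / 4 * ((cnt s s₀ s₁ n r j : ℝ) / n)
            - ((cnt s s₀ s₁ n r j : ℝ) / n) ^ 2 / 4) := by
          rw [← Finset.mul_sum, Finset.sum_sub_distrib, ← Finset.mul_sum, ← Finset.sum_div, hs]
          simp_rw [div_pow]
          rw [← Finset.sum_div, ← Finset.sum_div]
          field_simp
      _ ≤ _ := Finset.sum_le_sum fun j _ => qrt_pow_three_ge (by positivity)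
          (by exact_mod_cast H.cnt_le n r j) hn0
  refine le_trans ?_ h3
  rw [integral_sub (integrable_const _) (hi.const_mul _), integral_const,
    integral_const_mul]
  simp only [probReal_univ, one_smul]
  have h4 : qrt n ^ 3 / (4 * n ^ 2) * ∫ r, ∑ j, (cnt s s₀ s₁ n r j : ℝ) ^ 2 ∂rootLaw σ ≤
      qrt n ^ 3 / (4 * n ^ 2) * (κ' * (n : ℝ) ^ 2) :=
    mul_le_mul_of_nonneg_left h1 (by positivity)
  have h5 : qrt n ^ 3 / (4 * n ^ 2) * (κ' * (n : ℝ) ^ 2) = qrt n ^ 3 * (κ' / 4) := by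
    field_simp
  have h6 : qrt n ^ 3 * (5 / 4 * (s₀ : ℝ) / n) ≤ qrt n ^ 3 * ((1 - κ') / 8) :=
    mul_le_mul_of_nonneg_left h2 hq
  have h7 : qrt n ^ 3 * (5 / 4 * (1 - (s₀ : ℝ) / n)) =
    qrt n ^ 3 * (5 / 4) - qrt n ^ 3 * (5 / 4 * (s₀ : ℝ) / n) := by ring
  rw [h7]
  linarith

/-- The barrier is `A n - B n^(3/4)`. Averaging over children never increases the linear part, and
it enlarges `n^(3/4)` by a factor of at least `1 + δ`. With `B = K / δ` this surplus absorbs the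
error `K n^(3/4)` of the recursion, and `A` handles small arguments. -/
theorem Setting.exists_linear_bound_meanRest (H : Setting b s s₀ s₁ σ) :
    ∃ A, 0 ≤ A ∧ ∀ n : ℕ, |meanRest b s s₀ s₁ σ n| ≤ A * n := by
  obtain ⟨K, hK, hsub⟩ := H.exists_bound_meanRest_sub
  obtain ⟨δ, hδ, hgrow⟩ := H.exists_qrt_growth
  set f := meanRest b s s₀ s₁ σ with hf
  have hκ := H.kappa_lt_one
  obtain ⟨n₀, hn₀⟩ := eventually_atTop.1 (hgrow.and ((eventually_gt_atTop s).and
    (H.eventually_integral_sum_sq_cnt_le (by linarith : kappa σ < (1 + kappa σ) / 2))))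
  set B := K / δ with hB
  have hB0 : 0 ≤ B := by positivity
  set A := B + ∑ k ∈ Finset.range (n₀ + 1), |f k| with hA
  have hA0 : 0 ≤ A := by positivity
  set w : ℕ → ℝ := fun n => A * n - B * qrt n ^ 3 with hw
  refine ⟨A, hA0, fun n => ?_⟩
  suffices h : |f n| - w n ≤ 0 by
    have h1 : 0 ≤ B * qrt n ^ 3 := mul_nonneg hB0 (pow_nonneg (qrt_nonneg _) _)
    simp only [hw] at h
    linarith
  refine H.max_principle (u := fun n => |f n| - w n) (θ := fun _ _ _ => 1) (c := 1)
    (n₀ := n₀ + 1) (fun _ _ => measurable_const) (fun _ _ _ => zero_le_one) (fun _ _ _ => le_rfl)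
    (Nat.succ_pos _) (fun n hn => ?_) (fun n hn => ?_) (fun n hn => ?_) n
  · obtain ⟨-, h1, h2⟩ := hn₀ n (by omega)
    have hn0 : (0 : ℝ) < n := by exact_mod_cast (by omega : 0 < n)
    rw [one_mul]
    have : (0 : ℝ) < (n : ℝ) ^ 2 := by positivity
    nlinarith
  · rcases Nat.eq_zero_or_pos n with rfl | hn0
    · simp [hw, hf, meanRest_zero, qrt]
    · have h1 : |f n| ≤ A - B := by
        rw [hA, add_sub_cancel_left]
        exact Finset.single_le_sum (f := fun k => |f k|)
          (fun _ _ => abs_nonneg _) (Finset.mem_range.2 hn)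
      have hn1 : (1 : ℝ) ≤ n := by exact_mod_cast hn0
      have h2 : B * qrt n ^ 3 ≤ B * n := mul_le_mul_of_nonneg_left (qrt_pow_three_le hn1) hB0
      have h3 : (A - B) * 1 ≤ (A - B) * n :=
        mul_le_mul_of_nonneg_left hn1 ((abs_nonneg _).trans h1)
      simp only [hw]
      linarith
  · obtain ⟨h1, h2, -⟩ := hn₀ n (by omega)
    have h3 := hsub n h2
    have hi1 := H.integrable_sum_cnt (fun k => |f k|) n
    have hi2 := H.integrable_sum_cnt f n
    have hi3 := H.integrable_sum_cnt (fun k => (k : ℝ)) n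
    have hi4 := H.integrable_sum_cnt (fun k => qrt k ^ 3) n
    have h4 : |∫ r, ∑ j, f (cnt s s₀ s₁ n r j) ∂rootLaw σ| ≤
        ∫ r, ∑ j, |f (cnt s s₀ s₁ n r j)| ∂rootLaw σ :=
      abs_integral_le_integral_abs.trans (integral_mono hi2.abs hi1 fun r =>
        Finset.abs_sum_le_sum_abs _ _)
    have h5 : ∫ r, ∑ j, (cnt s s₀ s₁ n r j : ℝ) ∂rootLaw σ = n - s₀ := by
      rw [integral_congr_ae (g := fun _ => (n - s₀ : ℝ))]
      · simp
      · filter_upwards [ae_good H.simplex] with r hr using H.sum_cnt_real h2 hr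
    have h6 : ∫ r, ∑ j, 1 * (|f (cnt s s₀ s₁ n r j)| - w (cnt s s₀ s₁ n r j)) ∂rootLaw σ =
        ∫ r, ∑ j, |f (cnt s s₀ s₁ n r j)| ∂rootLaw σ - (A * (n - s₀) -
          B * ∫ r, ∑ j, qrt (cnt s s₀ s₁ n r j) ^ 3 ∂rootLaw σ) := by
      have hi5 : Integrable (fun r : Root b => A * ∑ j, (cnt s s₀ s₁ n r j : ℝ) -
          B * ∑ j, qrt (cnt s s₀ s₁ n r j) ^ 3) (rootLaw σ) :=
        (hi3.const_mul A).sub (hi4.const_mul B)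
      rw [← h5, ← integral_const_mul, ← integral_const_mul,
        ← integral_sub (hi3.const_mul A) (hi4.const_mul B), ← integral_sub hi1 hi5]
      congr with r
      simp only [hw, one_mul, Finset.sum_sub_distrib, Finset.mul_sum]
    rw [h6]
    have h7 : |f n| ≤ |f n - ∫ r, ∑ j, f (cnt s s₀ s₁ n r j) ∂rootLaw σ| +
        |∫ r, ∑ j, f (cnt s s₀ s₁ n r j) ∂rootLaw σ| := by
      have := abs_add_le (f n - ∫ r, ∑ j, f (cnt s s₀ s₁ n r j) ∂rootLaw σ)
        (∫ r, ∑ j, f (cnt s s₀ s₁ n r j) ∂rootLaw σ)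
      rwa [sub_add_cancel] at this
    have h8 := mul_le_mul_of_nonneg_left h1 hB0
    have h9 : B * δ = K := by rw [hB]; field_simp
    have h10 : 0 ≤ A * s₀ := by positivity
    have h11 : B * ((1 + δ) * qrt n ^ 3) = B * qrt n ^ 3 + K * qrt n ^ 3 := by rw [← h9]; ring
    simp only [hw]
    linarith

end LinearBound

/-! ### The size-biased split law. -/

section SizeBiased

variable {b s s₀ s₁ : ℕ} {σ : Measure (Fin b → ℝ)} [IsProbabilityMeasure σ]

variable (σ) in
/-- The size-biased law of an entry of the split vector. -/
def sizeBiased : Measure ℝ :=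
  ∑ j, (σ.withDensity fun v => ENNReal.ofReal (v j)).map fun v => v j

theorem lintegral_sizeBiased {f : ℝ → ENNReal} (hf : Measurable f) :
    ∫⁻ z, f z ∂sizeBiased σ = ∑ j, ∫⁻ v, ENNReal.ofReal (v j) * f (v j) ∂σ := by
  rw [sizeBiased, lintegral_finsetSum_measure]
  refine Finset.sum_congr rfl fun j _ => ?_
  have hg : Measurable fun v : Fin b → ℝ => f (v j) := hf.comp (measurable_pi_apply j)
  rw [lintegral_map hf (measurable_pi_apply j),
    lintegral_withDensity_eq_lintegral_mul _ (by fun_prop) hg]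
  rfl

theorem Setting.isProbabilityMeasure_sizeBiased (H : Setting b s s₀ s₁ σ) :
    IsProbabilityMeasure (sizeBiased σ) := by
  constructor
  have h := lintegral_sizeBiased (σ := σ) (f := fun _ => 1) measurable_const
  rw [lintegral_one] at h
  rw [h, ← lintegral_finsetSum _ (fun j _ => by fun_prop)]
  rw [lintegral_congr_ae (g := fun _ => 1)]
  · simp
  · filter_upwards [H.simplex] with v hv
    simp only [mul_one]
    rw [← ENNReal.ofReal_sum_of_nonneg fun j _ => hv.1 j, hv.2, ENNReal.ofReal_one]

theorem ae_sizeBiased_pos : ∀ᵐ z ∂sizeBiased σ, 0 < z := by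
  have hm : MeasurableSet {z : ℝ | ¬ 0 < z} := by
    simp only [not_lt]; exact measurableSet_Iic
  rw [ae_iff, ← lintegral_indicator_one hm,
    lintegral_sizeBiased (measurable_one.indicator hm)]
  refine Finset.sum_eq_zero fun j _ => ?_
  rw [lintegral_eq_zero_iff (by
    exact (by fun_prop : Measurable fun v : Fin b → ℝ => ENNReal.ofReal (v j)).mul
      ((measurable_one.indicator hm).comp (measurable_pi_apply j)))]
  refine ae_of_all _ fun v => ?_
  by_cases h : 0 < v j
  · simp [h]
  · simp [ENNReal.ofReal_of_nonpos (not_lt.1 h)]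

/-- This rewrites a weighted sum over the children as one step of a multiplicative random walk. -/
theorem Setting.integral_sizeBiased (H : Setting b s s₀ s₁ σ) {f : ℝ → ℝ} (hf : BddMeas f) :
    ∫ z, f z ∂sizeBiased σ = ∫ v, ∑ j, v j * f (v j) ∂σ := by
  have := H.isProbabilityMeasure_sizeBiased
  obtain ⟨hm, B, hB⟩ := hf
  have hB0 : 0 ≤ B := (abs_nonneg _).trans (hB 0)
  have hfin : ∀ j, IsFiniteMeasure (σ.withDensity fun v => ENNReal.ofReal (v j)) := fun j => by
    refine isFiniteMeasure_withDensity_ofReal ?_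
    exact (H.integrable_of_le_one (by fun_prop) (C := 1) fun v hv => by
      rw [abs_of_nonneg (hv.1 j)]; exact le_one_of_mem_stdSimplex hv j).2
  rw [integral_finsetSum]
  · rw [sizeBiased, integral_finsetSum_measure]
    · refine Finset.sum_congr rfl fun j _ => ?_
      rw [integral_map (measurable_pi_apply j).aemeasurable hm.aestronglyMeasurable,
        integral_withDensity_eq_integral_toReal_smul (by fun_prop)
          (ae_of_all _ fun _ => ENNReal.ofReal_lt_top)]
      refine integral_congr_ae ?_
      filter_upwards [H.simplex] with v hv
      rw [ENNReal.toReal_ofReal (hv.1 j), smul_eq_mul]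
    · intro j _
      exact Integrable.of_bound hm.aestronglyMeasurable B (ae_of_all _ hB)
  · intro j _
    refine H.integrable_of_le_one ((measurable_pi_apply j).mul
      (hm.comp (measurable_pi_apply j))) (C := B) fun v hv => ?_
    rw [abs_mul, abs_of_nonneg (hv.1 j)]
    calc v j * |f (v j)| ≤ 1 * B :=
          mul_le_mul (le_one_of_mem_stdSimplex hv j) (hB _) (abs_nonneg _) zero_le_one
      _ = B := one_mul B

end SizeBiased

/-! ### Mean square convergence of the tolls. -/

section TollLimit

variable {b s s₀ s₁ : ℕ} {σ : Measure (Fin b → ℝ)} [IsProbabilityMeasure σ]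

variable (b s s₀ s₁ σ) in
/-- The lower order part of the mean path length, relative to the number of items. -/
def relRest (x : ℝ) : ℝ := meanRest b s s₀ s₁ σ ⌊x⌋₊ / x

theorem Setting.bddMeas_relRest (H : Setting b s s₀ s₁ σ) : BddMeas (relRest b s s₀ s₁ σ) := by
  obtain ⟨A, hA, h⟩ := H.exists_linear_bound_meanRest
  refine ⟨((measurable_of_countable (meanRest b s s₀ s₁ σ)).comp Nat.measurable_floor).div
    measurable_id, A, fun x => ?_⟩
  rcases le_or_gt x 0 with hx | hx
  · simp [relRest, Nat.floor_of_nonpos hx, meanRest_zero, hA]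
  · rw [relRest, abs_div, abs_of_pos hx, div_le_iff₀ hx]
    exact (h _).trans (mul_le_mul_of_nonneg_left (Nat.floor_le hx.le) hA)

theorem mul_relRest {x : ℝ} (hx : 0 ≤ x) :
    x * relRest b s s₀ s₁ σ x = meanRest b s s₀ s₁ σ ⌊x⌋₊ := by
  rcases hx.eq_or_lt with rfl | hx
  · simp [meanRest_zero]
  · rw [relRest]; field_simp

/-- The Lipschitz bound applied to a count and `⌊x v_j⌋`; the summand `2` covers the rounding of `x`
and of `x v_j`. -/
theorem Setting.abs_meanRest_cnt_sub_le (H : Setting b s s₀ s₁ σ) {L : ℝ} (hL : 0 ≤ L)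
    (hlip : ∀ n k m : ℕ, k ≤ n → m ≤ n →
      |meanRest b s s₀ s₁ σ m - meanRest b s s₀ s₁ σ k| ≤ L * qrt n * |(m : ℝ) - k|)
    {x : ℝ} (hx : 0 ≤ x) {r : Root b} (hr : Good r) (j : Fin b) :
    |meanRest b s s₀ s₁ σ (cnt s s₀ s₁ ⌊x⌋₊ r j) - meanRest b s s₀ s₁ σ ⌊x * r.1 j⌋₊| ≤
      L * qrt ⌊x⌋₊ * (|(cnt s s₀ s₁ ⌊x⌋₊ r j - ⌊x⌋₊ * r.1 j : ℝ)| + 2) := by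
  have hv0 := hr.1.1 j
  have hv1 := le_one_of_mem_stdSimplex hr.1 j
  have h1 : ⌊x * r.1 j⌋₊ ≤ ⌊x⌋₊ := Nat.floor_le_floor (by nlinarith)
  refine (hlip ⌊x⌋₊ _ _ h1 (H.cnt_le _ r j)).trans
    (mul_le_mul_of_nonneg_left ?_ (mul_nonneg hL (qrt_nonneg _)))
  have h2 := Nat.floor_le hx
  have h3 := Nat.lt_floor_add_one x
  have h4 := Nat.floor_le (mul_nonneg hx hv0)
  have h5 := Nat.lt_floor_add_one (x * r.1 j)
  set N : ℝ := ((cnt s s₀ s₁ ⌊x⌋₊ r j : ℕ) : ℝ)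
  set k : ℝ := ((⌊x⌋₊ : ℕ) : ℝ)
  set l : ℝ := ((⌊x * r.1 j⌋₊ : ℕ) : ℝ)
  have h6 : 0 ≤ (x - k) * r.1 j := mul_nonneg (by linarith) hv0
  have h7 : (x - k) * r.1 j ≤ 1 := by
    calc (x - k) * r.1 j ≤ 1 * 1 := mul_le_mul (by linarith) hv1 hv0 zero_le_one
      _ = 1 := one_mul 1
  rw [show N - l = (N - k * r.1 j) + (k * r.1 j - l) by ring]
  refine (abs_add_le _ _).trans ?_
  gcongr
  rw [abs_le]
  constructor <;> linarith

/-- In the recursion for `meanRest`, replacing `N_j` by `⌊x V_j⌋` costs Lipschitz constant `n^(1/4)`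
times fluctuation `n^(1/2)`. As `f ⌊x V_j⌋ = x V_j h(x V_j)`, the sum over the children becomes `x`
times a step of the size-biased walk. Dividing the total error `O(x^(3/4))` by `x` leaves
`O(x^(-1/4))`. -/
theorem Setting.tendsto_relRest_sub_scaleAvg (H : Setting b s s₀ s₁ σ) :
    Tendsto (fun x => relRest b s s₀ s₁ σ x - scaleAvg (sizeBiased σ) (relRest b s s₀ s₁ σ) x)
      atTop (nhds 0) := by
  obtain ⟨K, hK, hsub⟩ := H.exists_bound_meanRest_sub
  obtain ⟨L, hL, hlip⟩ := H.exists_lipschitz_meanRest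
  have hb := H.bddMeas_relRest
  set f := meanRest b s s₀ s₁ σ with hf
  set h := relRest b s s₀ s₁ σ with hh
  set C := K + L * (b * (√(varConst s) + 2)) with hC
  have hC0 : 0 ≤ C := by positivity
  have hbound : ∀ x : ℝ, (s : ℝ) + 1 ≤ x →
      |h x - scaleAvg (sizeBiased σ) h x| ≤ C / qrt x := by
    intro x hx
    have hs0 : (0 : ℝ) ≤ s := by positivity
    have hx0 : 0 < x := by linarith
    set n := ⌊x⌋₊ with hn
    have hsn : s < n := Nat.le_floor (by push_cast; exact hx)
    have hn1 : (1 : ℝ) ≤ n := by exact_mod_cast (by omega : 1 ≤ n)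
    have e1 : scaleAvg (sizeBiased σ) h x = ∫ r, ∑ j, r.1 j * h (x * r.1 j) ∂rootLaw σ := by
      rw [integral_rootLaw_fst fun v => ∑ j, v j * h (x * v j)]
      exact H.integral_sizeBiased (f := fun z => h (x * z))
        ⟨hb.1.comp (by fun_prop), hb.2.imp fun B hB z => hB _⟩
    have e2 : x * scaleAvg (sizeBiased σ) h x = ∫ r, ∑ j, f ⌊x * r.1 j⌋₊ ∂rootLaw σ := by
      rw [e1, ← integral_const_mul]
      refine integral_congr_ae ?_
      filter_upwards [ae_good H.simplex] with r hr
      rw [Finset.mul_sum]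
      refine Finset.sum_congr rfl fun j _ => ?_
      rw [← mul_assoc, mul_relRest (mul_nonneg hx0.le (hr.1.1 j))]
    have e3 : x * h x = f n := mul_relRest hx0.le
    have hi1 := H.integrable_sum_cnt f n
    have hi3 := fun j => H.integrable_abs_cnt_sub n j
    have hi2 : Integrable (fun r : Root b => ∑ j, f ⌊x * r.1 j⌋₊) (rootLaw σ) := by
      refine integrable_finsetSum _ fun j _ => ?_
      obtain ⟨B, hB⟩ := hb.2
      have hm : Measurable fun r : Root b => x * r.1 j :=
        measurable_const.mul ((measurable_pi_apply j).comp measurable_fst)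
      have hm' : Measurable fun r : Root b => f ⌊x * r.1 j⌋₊ :=
        (measurable_of_countable f).comp (Nat.measurable_floor.comp hm)
      refine Integrable.of_bound (C := x * B) hm'.aestronglyMeasurable ?_
      filter_upwards [ae_good H.simplex] with r hr
      have hv1 := le_one_of_mem_stdSimplex hr.1 j
      rw [hf, ← mul_relRest (mul_nonneg hx0.le (hr.1.1 j)), Real.norm_eq_abs, abs_mul,
        abs_of_nonneg (mul_nonneg hx0.le (hr.1.1 j))]
      exact mul_le_mul (mul_le_of_le_one_right hx0.le hv1) (hB _) (abs_nonneg _) hx0.le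
    have h1 : |∫ r, (∑ j, f (cnt s s₀ s₁ n r j) - ∑ j, f ⌊x * r.1 j⌋₊) ∂rootLaw σ| ≤
        L * qrt n * (b * (√(varConst s * n) + 2)) := by
      calc |∫ r, (∑ j, f (cnt s s₀ s₁ n r j) - ∑ j, f ⌊x * r.1 j⌋₊) ∂rootLaw σ|
          ≤ ∫ r, ∑ j, L * qrt n * (|(cnt s s₀ s₁ n r j - n * r.1 j : ℝ)| + 2) ∂rootLaw σ := by
            refine abs_integral_le_integral_abs.trans (integral_mono_ae (hi1.sub hi2).abs
              (integrable_finsetSum _ fun j _ =>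
                ((hi3 j).add (integrable_const 2)).const_mul _) ?_)
            filter_upwards [ae_good H.simplex] with r hr
            rw [← Finset.sum_sub_distrib]
            refine (Finset.abs_sum_le_sum_abs _ _).trans (Finset.sum_le_sum fun j _ => ?_)
            exact H.abs_meanRest_cnt_sub_le hL hlip hx0.le hr j
        _ = ∑ j, L * qrt n * (∫ r, |(cnt s s₀ s₁ n r j - n * r.1 j : ℝ)| ∂rootLaw σ + 2) := by
            have hi4 : ∀ j, Integrable (fun r : Root b => L * qrt n *
                (|(cnt s s₀ s₁ n r j - n * r.1 j : ℝ)| + 2)) (rootLaw σ) :=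
              fun j => ((hi3 j).add (integrable_const 2)).const_mul _
            rw [integral_finsetSum _ fun j _ => hi4 j]
            refine Finset.sum_congr rfl fun j _ => ?_
            rw [integral_const_mul, integral_add (hi3 j) (integrable_const 2)]
            simp
        _ ≤ ∑ _j : Fin b, L * qrt n * (√(varConst s * n) + 2) := by
            refine Finset.sum_le_sum fun j _ => mul_le_mul_of_nonneg_left ?_
              (mul_nonneg hL (qrt_nonneg _))
            linarith [H.integral_abs_cnt_sub_le hsn j]
        _ = _ := by simp; ring
    rw [integral_sub hi1 hi2] at h1
    have h2 := hsub n hsn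
    have h3 : |x * (h x - scaleAvg (sizeBiased σ) h x)| ≤
        K * qrt n ^ 3 + L * qrt n * (b * (√(varConst s * n) + 2)) := by
      rw [mul_sub, e3, e2]
      have := abs_add_le (f n - ∫ r, ∑ j, f (cnt s s₀ s₁ n r j) ∂rootLaw σ)
        (∫ r, ∑ j, f (cnt s s₀ s₁ n r j) ∂rootLaw σ - ∫ r, ∑ j, f ⌊x * r.1 j⌋₊ ∂rootLaw σ)
      rw [sub_add_sub_cancel] at this
      linarith
    have hq1 := one_le_qrt hn1
    have h4 : √(varConst s * n) + 2 ≤ (√(varConst s) + 2) * qrt n ^ 2 := by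
      rw [Real.sqrt_mul varConst_pos.le, ← qrt_sq (n : ℝ), add_mul]
      have : 1 ≤ qrt n ^ 2 := one_le_pow₀ hq1
      linarith
    have h5 : |x * (h x - scaleAvg (sizeBiased σ) h x)| ≤ C * qrt n ^ 3 := by
      refine h3.trans ?_
      have : L * qrt n * (b * (√(varConst s * n) + 2)) ≤
          L * qrt n * (b * ((√(varConst s) + 2) * qrt n ^ 2)) := by
        have := qrt_nonneg n
        gcongr
      calc _ ≤ K * qrt n ^ 3 + L * qrt n * (b * ((√(varConst s) + 2) * qrt n ^ 2)) := by
            linarith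
        _ = _ := by rw [hC]; ring
    have hqx : qrt n ≤ qrt x := qrt_mono (Nat.floor_le hx0.le)
    have hqx0 : 0 < qrt x := by linarith
    have h6 : |x * (h x - scaleAvg (sizeBiased σ) h x)| ≤ C * qrt x ^ 3 :=
      h5.trans (mul_le_mul_of_nonneg_left (pow_le_pow_left₀ (qrt_nonneg _) hqx 3) hC0)
    rw [abs_mul, abs_of_pos hx0] at h6
    rw [le_div_iff₀ hqx0]
    have h7 := qrt_pow_four hx0.le
    refine le_of_mul_le_mul_left ?_ (by positivity : 0 < qrt x ^ 3)
    calc qrt x ^ 3 * (|h x - scaleAvg (sizeBiased σ) h x| * qrt x)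
        = qrt x ^ 4 * |h x - scaleAvg (sizeBiased σ) h x| := by ring
      _ ≤ C * qrt x ^ 3 := by rw [h7]; exact h6
      _ = _ := by ring
  refine squeeze_zero_norm' ?_ (tendsto_qrt.const_div_atTop C)
  filter_upwards [eventually_ge_atTop ((s : ℝ) + 1)] with x hx using hbound x hx

theorem Setting.tendsto_scaleVar_relRest (H : Setting b s s₀ s₁ σ) :
    Tendsto (scaleVar (sizeBiased σ) (relRest b s s₀ s₁ σ)) atTop (nhds 0) :=
  have := H.isProbabilityMeasure_sizeBiased
  tendsto_scaleVar_of_asymptotically_harmonic ae_sizeBiased_pos H.bddMeas_relRest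
    H.tendsto_relRest_sub_scaleAvg

/-- The mean lower order part is asymptotically preserved by the splitting, in mean square. -/
theorem Setting.tendsto_integral_sq_sum_meanRest_sub (H : Setting b s s₀ s₁ σ) :
    Tendsto (fun n : ℕ => ∫ r, ((∑ j, meanRest b s s₀ s₁ σ (cnt s s₀ s₁ n r j) -
      meanRest b s s₀ s₁ σ n) / n) ^ 2 ∂rootLaw σ) atTop (nhds 0) := by
  obtain ⟨L, hL, hlip⟩ := H.exists_lipschitz_meanRest
  have hb := H.bddMeas_relRest
  have hprob := H.isProbabilityMeasure_sizeBiased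
  set f := meanRest b s s₀ s₁ σ with hf
  set h := relRest b s s₀ s₁ σ with hh
  set C := 4 * L ^ 2 * b * (b * (varConst s + 4)) with hC
  have hbound : ∀ n : ℕ, s < n →
      ∫ r, ((∑ j, f (cnt s s₀ s₁ n r j) - f n) / n) ^ 2 ∂rootLaw σ ≤
        C / qrt n ^ 2 + 2 * scaleVar (sizeBiased σ) h n := by
    intro n hn
    have hn1 : (1 : ℝ) ≤ n := by exact_mod_cast (by omega : 1 ≤ n)
    have hn0 : (0 : ℝ) < n := by linarith
    have hi1 := fun j => H.integrable_sq_cnt_sub n j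
    have hbv : BddMeas fun z => (h (n * z) - h n) ^ 2 := by
      have : BddMeas fun z => h (n * z) :=
        ⟨hb.1.comp (by fun_prop), hb.2.imp fun B hB z => hB _⟩
      exact (this.sub (BddMeas.const _)).sq
    have hi2 : ∀ j, Integrable (fun r : Root b => r.1 j * (h (n * r.1 j) - h n) ^ 2)
        (rootLaw σ) := by
      intro j
      obtain ⟨hm, B, hB⟩ := hbv
      refine Integrable.of_bound (C := B) (((measurable_pi_apply j).comp measurable_fst).mul
        (hm.comp ((measurable_pi_apply j).comp measurable_fst))).aestronglyMeasurable ?_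
      filter_upwards [ae_good H.simplex] with r hr
      rw [Real.norm_eq_abs, abs_mul, abs_of_nonneg (hr.1.1 j)]
      calc r.1 j * |(h (n * r.1 j) - h n) ^ 2| ≤ 1 * B :=
            mul_le_mul (le_one_of_mem_stdSimplex hr.1 j) (hB _) (abs_nonneg _) zero_le_one
        _ = B := one_mul B
    have hvar : ∫ r, ∑ j, r.1 j * (h (n * r.1 j) - h n) ^ 2 ∂rootLaw σ =
        scaleVar (sizeBiased σ) h n := by
      rw [integral_rootLaw_fst fun v => ∑ j, v j * (h (n * v j) - h n) ^ 2]
      exact (H.integral_sizeBiased hbv).symm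
    calc ∫ r, ((∑ j, f (cnt s s₀ s₁ n r j) - f n) / n) ^ 2 ∂rootLaw σ
        ≤ ∫ r, (4 * L ^ 2 * b * qrt n ^ 2 / n ^ 2 *
            ∑ j, ((cnt s s₀ s₁ n r j - n * r.1 j : ℝ) ^ 2 + 4) +
            2 * ∑ j, r.1 j * (h (n * r.1 j) - h n) ^ 2) ∂rootLaw σ := by
          refine integral_mono_of_nonneg (ae_of_all _ fun _ => sq_nonneg _)
            (((integrable_finsetSum _ fun j _ => (hi1 j).add (integrable_const 4)).const_mul
              _).add ((integrable_finsetSum _ fun j _ => hi2 j).const_mul 2)) ?_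
          filter_upwards [ae_good H.simplex] with r hr
          -- `U` collects fluctuation and rounding errors. `W` is the convex combination of the
          -- increments of `h`; by Cauchy–Schwarz its square is at most the weighted sum of squared
          -- increments, with mean `scaleVar`.
          set U := ∑ j, (f (cnt s s₀ s₁ n r j) - f ⌊n * r.1 j⌋₊) with hU
          set W := ∑ j, r.1 j * (h (n * r.1 j) - h n) with hW
          have e1 : (∑ j, f (cnt s s₀ s₁ n r j) - f n) / n = U / n + W := by
            have e2 : n * W = ∑ j, f ⌊n * r.1 j⌋₊ - f n := by
              have e3 : f n = ∑ j, r.1 j * (n * h n) := by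
                rw [← Finset.sum_mul, hr.1.2, one_mul, mul_relRest hn0.le, Nat.floor_natCast]
              rw [hW, e3, Finset.mul_sum, ← Finset.sum_sub_distrib]
              refine Finset.sum_congr rfl fun j _ => ?_
              rw [hf, ← mul_relRest (mul_nonneg hn0.le (hr.1.1 j))]
              ring
            have e4 : ∑ j, f (cnt s s₀ s₁ n r j) - f n = U + n * W := by
              rw [e2, hU, Finset.sum_sub_distrib]; ring
            rw [e4]; field_simp
          have hW2 : W ^ 2 ≤ ∑ j, r.1 j * (h (n * r.1 j) - h n) ^ 2 := by
            have hcs := Finset.sum_mul_sq_le_sq_mul_sq Finset.univ (fun j => √(r.1 j))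
              (fun j => √(r.1 j) * (h (n * r.1 j) - h n))
            simp only [← mul_assoc, Real.mul_self_sqrt (hr.1.1 _), mul_pow,
              Real.sq_sqrt (hr.1.1 _), hr.1.2, one_mul] at hcs
            exact hcs
          have hU2 : U ^ 2 ≤ 2 * L ^ 2 * b * qrt n ^ 2 *
              ∑ j, ((cnt s s₀ s₁ n r j - n * r.1 j : ℝ) ^ 2 + 4) := by
            refine sq_sum_le_card_mul_sum_sq.trans ?_
            rw [Finset.card_univ, Fintype.card_fin]
            have : ∑ j, (f (cnt s s₀ s₁ n r j) - f ⌊n * r.1 j⌋₊) ^ 2 ≤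
                ∑ j, 2 * L ^ 2 * qrt n ^ 2 *
                  ((cnt s s₀ s₁ n r j - n * r.1 j : ℝ) ^ 2 + 4) := by
              refine Finset.sum_le_sum fun j _ => ?_
              have h1 := H.abs_meanRest_cnt_sub_le hL hlip hn0.le hr j
              rw [Nat.floor_natCast] at h1
              rw [← sq_abs]
              refine (pow_le_pow_left₀ (abs_nonneg _) h1 2).trans ?_
              rw [mul_pow, mul_pow]
              have h2 : (|(cnt s s₀ s₁ n r j - n * r.1 j : ℝ)| + 2) ^ 2 ≤
                  2 * ((cnt s s₀ s₁ n r j - n * r.1 j : ℝ) ^ 2 + 4) := by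
                rw [← sq_abs (cnt s s₀ s₁ n r j - n * r.1 j : ℝ)]
                nlinarith [sq_nonneg (|(cnt s s₀ s₁ n r j - n * r.1 j : ℝ)| - 2)]
              refine (mul_le_mul_of_nonneg_left h2 (by positivity)).trans (le_of_eq (by ring))
            refine (mul_le_mul_of_nonneg_left this (by positivity)).trans (le_of_eq ?_)
            rw [← Finset.mul_sum]
            ring
          rw [e1]
          have h3 : (U / n + W) ^ 2 ≤ 2 * (U ^ 2 / n ^ 2) + 2 * W ^ 2 := by
            rw [← div_pow]; nlinarith [sq_nonneg (U / n - W)]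
          have h4 := div_le_div_of_nonneg_right hU2 (by positivity : (0 : ℝ) ≤ n ^ 2)
          have h5 : 4 * L ^ 2 * b * qrt n ^ 2 / n ^ 2 *
              ∑ j, ((cnt s s₀ s₁ n r j - n * r.1 j : ℝ) ^ 2 + 4) =
              2 * ((2 * L ^ 2 * b * qrt n ^ 2 *
              ∑ j, ((cnt s s₀ s₁ n r j - n * r.1 j : ℝ) ^ 2 + 4)) / n ^ 2) := by
            generalize ∑ j, ((cnt s s₀ s₁ n r j - n * r.1 j : ℝ) ^ 2 + 4) = S
            ring
          linarith
      _ = 4 * L ^ 2 * b * qrt n ^ 2 / n ^ 2 *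
            ∑ j, (∫ r, (cnt s s₀ s₁ n r j - n * r.1 j : ℝ) ^ 2 ∂rootLaw σ + 4) +
            2 * scaleVar (sizeBiased σ) h n := by
          have hi3 : ∀ j, Integrable (fun r : Root b =>
              (cnt s s₀ s₁ n r j - n * r.1 j : ℝ) ^ 2 + 4) (rootLaw σ) :=
            fun j => (hi1 j).add (integrable_const 4)
          rw [integral_add ((integrable_finsetSum _ fun j _ => hi3 j).const_mul _)
            ((integrable_finsetSum _ fun j _ => hi2 j).const_mul 2), integral_const_mul,
            integral_const_mul, hvar, integral_finsetSum _ fun j _ => hi3 j]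
          congr 2
          refine Finset.sum_congr rfl fun j _ => ?_
          rw [integral_add (hi1 j) (integrable_const 4)]
          simp
      _ ≤ 4 * L ^ 2 * b * qrt n ^ 2 / n ^ 2 * ∑ _j : Fin b, (varConst s * n + 4 * n) +
            2 * scaleVar (sizeBiased σ) h n := by
          gcongr with j _
          · exact H.integral_sq_cnt_sub_le hn j
          · linarith
      _ = C / qrt n ^ 2 + 2 * scaleVar (sizeBiased σ) h n := by
          have hq : 0 < qrt n := by linarith [one_le_qrt hn1]
          have h4 := qrt_pow_four hn0.le
          congr 1
          have h6 : varConst s * (n : ℝ) + 4 * n = (varConst s + 4) * qrt n ^ 4 := by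
            rw [h4]; ring
          have h7 : (n : ℝ) ^ 2 = qrt n ^ 8 := by rw [← h4]; ring_nf; rw [h4]
          rw [hC, h6, h7]
          simp only [Finset.sum_const, Finset.card_univ, Fintype.card_fin, nsmul_eq_mul]
          field_simp
  have hlim : Tendsto (fun n : ℕ => C / qrt n ^ 2 + 2 * scaleVar (sizeBiased σ) h n) atTop
      (nhds (0 + 2 * 0)) := by
    refine Tendsto.add ?_ ((H.tendsto_scaleVar_relRest.comp
      tendsto_natCast_atTop_atTop).const_mul 2)
    exact Tendsto.const_div_atTop ((tendsto_pow_atTop two_ne_zero).comp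
      (tendsto_qrt.comp tendsto_natCast_atTop_atTop)) C
  rw [mul_zero, add_zero] at hlim
  refine squeeze_zero' (Eventually.of_forall fun n => integral_nonneg fun r => sq_nonneg _) ?_ hlim
  filter_upwards [eventually_gt_atTop s] with n hn using hbound n hn

variable (s s₀ s₁ σ) in
/-- The toll at the root of a split tree with `n` items, centred and divided by `n`. -/
def treeToll (n : ℕ) (r : Root b) : ℝ :=
  ((n - s₀ : ℝ) + ∑ j, meanPath b s s₀ s₁ σ (cnt s s₀ s₁ n r j) - meanPath b s s₀ s₁ σ n) / n

theorem measurable_treeToll (n : ℕ) :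
    Measurable fun r : Root b => treeToll s s₀ s₁ σ n r := by
  unfold treeToll
  refine ((measurable_const.add (Finset.measurable_fun_sum _ fun j _ => ?_)).sub
    measurable_const).div_const _
  exact (measurable_of_countable (meanPath b s s₀ s₁ σ)).comp (measurable_cnt n j)

theorem Setting.integrable_sq_sum_meanRest_sub (H : Setting b s s₀ s₁ σ) (n : ℕ) :
    Integrable (fun r => ((∑ j, meanRest b s s₀ s₁ σ (cnt s s₀ s₁ n r j) -
      meanRest b s s₀ s₁ σ n) / n) ^ 2) (rootLaw σ) := by
  have hm : Measurable fun r : Root b => ∑ j, meanRest b s s₀ s₁ σ (cnt s s₀ s₁ n r j) :=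
    Finset.measurable_fun_sum _ fun j _ =>
      (measurable_of_countable (meanRest b s s₀ s₁ σ)).comp (measurable_cnt n j)
  set f := meanRest b s s₀ s₁ σ
  refine Integrable.of_bound (((hm.sub_const _).div_const _).pow_const 2).aestronglyMeasurable
    (((∑ _j : Fin b, ∑ k ∈ Finset.range (n + 1), |f k| + |f n|) / n) ^ 2) (ae_of_all _ fun r => ?_)
  rw [Real.norm_of_nonneg (sq_nonneg _), ← sq_abs, abs_div, Nat.abs_cast]
  gcongr
  refine (abs_sub _ _).trans ?_
  gcongr
  refine (Finset.abs_sum_le_sum_abs _ _).trans (Finset.sum_le_sum fun j _ => ?_)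
  exact H.abs_le_sum_range f n r j

/-- The rescaled tolls converge in mean square to the toll function of the split vector. -/
theorem Setting.tendsto_integral_sq_treeToll_sub (H : Setting b s s₀ s₁ σ) :
    Tendsto (fun n : ℕ => ∫ r, (treeToll s s₀ s₁ σ n r - toll (entropy σ) r.1) ^ 2 ∂rootLaw σ)
      atTop (nhds 0) := by
  obtain ⟨K, hK, hKn⟩ := H.exists_bound_sq_stepErr
  have hlim : Tendsto (fun n : ℕ => 2 * K / qrt n ^ 2 + 2 *
      ∫ r, ((∑ j, meanRest b s s₀ s₁ σ (cnt s s₀ s₁ n r j) -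
      meanRest b s s₀ s₁ σ n) / n) ^ 2 ∂rootLaw σ) atTop (nhds (0 + 2 * 0)) :=
    Tendsto.add (Tendsto.const_div_atTop ((tendsto_pow_atTop two_ne_zero).comp
      (tendsto_qrt.comp tendsto_natCast_atTop_atTop)) _)
      (H.tendsto_integral_sq_sum_meanRest_sub.const_mul 2)
  rw [mul_zero, add_zero] at hlim
  refine squeeze_zero' (Eventually.of_forall fun n => integral_nonneg fun r => sq_nonneg _) ?_ hlim
  filter_upwards [eventually_gt_atTop s] with n hn
  have hn1 : (1 : ℝ) ≤ n := by exact_mod_cast (by omega : 1 ≤ n)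
  have hn0 : (0 : ℝ) < n := by linarith
  have hi1 := H.integrable_sq_stepErr hn
  have hi2 := H.integrable_sq_sum_meanRest_sub n
  calc ∫ r, (treeToll s s₀ s₁ σ n r - toll (entropy σ) r.1) ^ 2 ∂rootLaw σ
      ≤ ∫ r, (2 / n ^ 2 * stepErr s s₀ s₁ (entropy σ) n r ^ 2 +
        2 * ((∑ j, meanRest b s s₀ s₁ σ (cnt s s₀ s₁ n r j) -
          meanRest b s s₀ s₁ σ n) / n) ^ 2) ∂rootLaw σ := by
        refine integral_mono_of_nonneg (ae_of_all _ fun _ => sq_nonneg _)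
          ((hi1.const_mul _).add (hi2.const_mul 2)) ?_
        filter_upwards [ae_good H.simplex] with r hr
        rw [treeToll, H.step_eq hn hr]
        set E := stepErr s s₀ s₁ (entropy σ) n r
        set D := ∑ j, meanRest b s s₀ s₁ σ (cnt s s₀ s₁ n r j) - meanRest b s s₀ s₁ σ n
        have e : (n * toll (entropy σ) r.1 + E + D) / n - toll (entropy σ) r.1 =
            E / n + D / n := by field_simp; ring
        rw [e]
        have e2 : 2 / n ^ 2 * E ^ 2 = 2 * (E / n) ^ 2 := by rw [div_pow]; ring
        rw [e2]
        nlinarith [sq_nonneg (E / n - D / n)]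
    _ = 2 / n ^ 2 * ∫ r, stepErr s s₀ s₁ (entropy σ) n r ^ 2 ∂rootLaw σ + 2 *
      ∫ r, ((∑ j, meanRest b s s₀ s₁ σ (cnt s s₀ s₁ n r j) -
      meanRest b s s₀ s₁ σ n) / n) ^ 2 ∂rootLaw σ := by
        rw [integral_add (hi1.const_mul _) (hi2.const_mul 2), integral_const_mul,
          integral_const_mul]
    _ ≤ 2 / n ^ 2 * (K * qrt n ^ 6) + 2 *
      ∫ r, ((∑ j, meanRest b s s₀ s₁ σ (cnt s s₀ s₁ n r j) -
      meanRest b s s₀ s₁ σ n) / n) ^ 2 ∂rootLaw σ := by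
        gcongr
        exact hKn n hn
    _ = _ := by
        have hq : 0 < qrt n := by linarith [one_le_qrt hn1]
        have h4 := qrt_pow_four hn0.le
        congr 1
        nth_rewrite 1 [← h4]
        field_simp

end TollLimit

/-! ### Orthogonality and almost sure summability. -/

section Independence

variable {b : ℕ} {Ω : Type*} {mΩ : MeasurableSpace Ω} {P : Measure Ω} [IsProbabilityMeasure P]

/-- Independent centred summands are orthogonal to each other and to constants. This is how the
weights enter `L²` estimates as squares, so that `κ` becomes the contraction factor. -/
theorem integral_sq_add_sum_pi {f : Fin b → Ω → ℝ} (hf : ∀ j, MemLp (f j) 2 P)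
    (h0 : ∀ j, ∫ x, f j x ∂P = 0) (c : ℝ) :
    ∫ ω, (c + ∑ j, f j (ω j)) ^ 2 ∂(Measure.pi fun _ : Fin b => P) =
      c ^ 2 + ∑ j, ∫ x, f j x ^ 2 ∂P := by
  have hm : ∀ j, MemLp (fun ω : Fin b → Ω => f j (ω j)) 2 (Measure.pi fun _ : Fin b => P) :=
    fun j => (hf j).comp_measurePreserving (measurePreserving_eval (fun _ : Fin b => P) j)
  have hmean : ∀ j, ∫ ω : Fin b → Ω, f j (ω j) ∂(Measure.pi fun _ : Fin b => P) = 0 := by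
    intro j
    rw [← h0 j]
    exact integral_comp_eval (μ := fun _ : Fin b => P) (hf j).1
  have hS : MemLp (∑ j, fun ω : Fin b → Ω => f j (ω j)) 2 (Measure.pi fun _ : Fin b => P) :=
    memLp_finsetSum' _ fun j _ => hm j
  have hS0 : ∫ ω, (∑ j, fun ω : Fin b → Ω => f j (ω j)) ω ∂(Measure.pi fun _ : Fin b => P) = 0 := by
    simp only [Finset.sum_apply]
    rw [integral_finsetSum _ fun j _ => (hm j).integrable one_le_two]
    exact Finset.sum_eq_zero fun j _ => hmean j
  have hvar := variance_sum_pi (μ := fun _ : Fin b => P) hf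
  rw [variance_eq_sub hS, hS0] at hvar
  have h2 : ∀ j, variance (f j) P = ∫ x, f j x ^ 2 ∂P := by
    intro j
    rw [variance_eq_sub (hf j), h0 j]
    simp
  simp only [h2] at hvar
  rw [← hvar]
  set S := ∑ j, fun ω : Fin b → Ω => f j (ω j) with hSdef
  have e : ∀ ω : Fin b → Ω, (c + ∑ j, f j (ω j)) ^ 2 = c ^ 2 + 2 * c * S ω + S ω ^ 2 := by
    intro ω
    rw [hSdef, Finset.sum_apply]; ring
  simp only [e]
  have hi1 : Integrable S (Measure.pi fun _ : Fin b => P) := hS.integrable one_le_two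
  have hi2 : Integrable (fun ω => c ^ 2 + 2 * c * S ω) (Measure.pi fun _ : Fin b => P) :=
    (integrable_const _).add (hi1.const_mul _)
  rw [integral_add hi2 hS.integrable_sq, integral_add (integrable_const _) (hi1.const_mul _),
    integral_const_mul, hS0]
  simp

theorem ae_summable_of_summable_integral_norm {F : ℕ → Ω → ℝ} (hF : ∀ i, Integrable (F i) P)
    (hs : Summable fun i => ∫ a, ‖F i a‖ ∂P) : ∀ᵐ a ∂P, Summable fun i => F i a := by
  have h1 : ∫⁻ a, ∑' i, ‖F i a‖ₑ ∂P ≠ ⊤ := by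
    rw [lintegral_tsum fun i => (hF i).1.enorm]
    have : ∀ i, ∫⁻ a, ‖F i a‖ₑ ∂P = ENNReal.ofReal (∫ a, ‖F i a‖ ∂P) := fun i =>
      (ofReal_integral_norm_eq_lintegral_enorm (hF i)).symm
    simp_rw [this]
    rw [← ENNReal.ofReal_tsum_of_nonneg (fun i => integral_nonneg fun _ => norm_nonneg _) hs]
    exact ENNReal.ofReal_ne_top
  filter_upwards [ae_lt_top' (AEMeasurable.tsum fun i => (hF i).1.enorm) h1] with a ha
  refine Summable.of_norm ?_
  have h2 : ∑' i, ((‖F i a‖₊ : NNReal) : ENNReal) ≠ ⊤ := ha.ne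
  exact NNReal.summable_coe.2 (ENNReal.tsum_coe_ne_top_iff_summable.1 h2)

end Independence

/-! ### Approximations of the limit and their exponential moments. -/

section Limit

variable {b s s₀ s₁ : ℕ} {σ : Measure (Fin b → ℝ)} [IsProbabilityMeasure σ]

/-- Successive approximations to the limit of the normalized path length. -/
def limApprox (μ : ℝ) : ℕ → Env b → ℝ
  | 0, _ => 0
  | K + 1, e => toll μ (e []).1 + ∑ j, (e []).1 j * limApprox μ K fun u => e (u ++ [j])

theorem limApprox_join (μ : ℝ) (K : ℕ) (p : Root b × (Fin b → Env b)) :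
    limApprox μ (K + 1) (join p) = toll μ p.1.1 + ∑ j, p.1.1 j * limApprox μ K (p.2 j) := by
  simp [limApprox]

theorem measurable_limApprox (μ : ℝ) (K : ℕ) : Measurable (limApprox (b := b) μ K) := by
  induction K with
  | zero => exact measurable_const
  | succ K ih =>
    have h0 : Measurable fun e : Env b => (e []).1 := measurable_fst.comp (measurable_pi_apply _)
    refine ((measurable_toll μ).comp h0).add (Finset.measurable_fun_sum _ fun j _ => ?_)
    refine ((measurable_pi_apply j).comp h0).mul (ih.comp ?_)
    exact measurable_pi_iff.2 fun u => measurable_pi_apply _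

theorem abs_limApprox_le {μ M : ℝ} (hM : ∀ v ∈ stdSimplex ℝ (Fin b), |toll μ v| ≤ M) (K : ℕ)
    {e : Env b} (he : ∀ u, Good (e u)) : |limApprox μ K e| ≤ K * M := by
  induction K generalizing e with
  | zero => simp [limApprox]
  | succ K ih =>
    have hv := (he []).1
    calc |limApprox μ (K + 1) e|
        ≤ |toll μ (e []).1| + ∑ j, |(e []).1 j * limApprox μ K fun u => e (u ++ [j])| :=
          (abs_add_le _ _).trans (by gcongr; exact Finset.abs_sum_le_sum_abs _ _)
      _ ≤ M + ∑ j, (e []).1 j * (K * M) := by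
          gcongr with j _
          · exact hM _ hv
          · rw [abs_mul, abs_of_nonneg (hv.1 j)]
            exact mul_le_mul_of_nonneg_left (ih fun u => he _) (hv.1 j)
      _ = _ := by rw [← Finset.sum_mul, hv.2]; push_cast; ring

theorem Setting.memLp_limApprox (H : Setting b s s₀ s₁ σ) (μ : ℝ) (K : ℕ) :
    MemLp (limApprox μ K) 2 (envLaw σ) := by
  obtain ⟨M, hM⟩ := exists_toll_bound b μ
  refine MemLp.of_bound (measurable_limApprox μ K).aestronglyMeasurable (K * M) ?_
  filter_upwards [ae_env_good H] with e he using abs_limApprox_le hM K he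

theorem Setting.integral_limApprox (H : Setting b s s₀ s₁ σ) (K : ℕ) :
    ∫ e, limApprox (entropy σ) K e ∂envLaw σ = 0 := by
  induction K with
  | zero => simp [limApprox]
  | succ K ih =>
    have hi : Integrable (limApprox (entropy σ) K) (envLaw σ) :=
      (H.memLp_limApprox _ K).integrable one_le_two
    rw [integral_env ((H.memLp_limApprox _ _).integrable one_le_two)]
    have : ∀ r : Root b, ∫ ē, limApprox (entropy σ) (K + 1) (join (r, ē))
        ∂(Measure.pi fun _ : Fin b => envLaw σ) = toll (entropy σ) r.1 := by
      intro r
      simp only [limApprox_join]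
      rw [integral_add (integrable_const _) (integrable_finsetSum _ fun j _ =>
        (integrable_pi_eval hi j).const_mul _), integral_finsetSum _ fun j _ =>
        (integrable_pi_eval hi j).const_mul _]
      simp [integral_const_mul, integral_pi_eval hi.1, ih]
    simp_rw [this]
    rw [integral_rootLaw_fst (toll (entropy σ)), H.integral_toll]

/-- Successive differences solve the equation without toll: given the root they are weighted sums of
independent centred copies. -/
theorem Setting.integral_sq_limApprox_sub (H : Setting b s s₀ s₁ σ) (K : ℕ) :
    ∫ e, (limApprox (entropy σ) (K + 2) e - limApprox (entropy σ) (K + 1) e) ^ 2 ∂envLaw σ =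
      kappa σ *
        ∫ e, (limApprox (entropy σ) (K + 1) e - limApprox (entropy σ) K e) ^ 2 ∂envLaw σ := by
  set μ := entropy σ
  set D : ℕ → Env b → ℝ := fun K e => limApprox μ (K + 1) e - limApprox μ K e with hD
  have hmem : ∀ K, MemLp (D K) 2 (envLaw σ) := fun K =>
    (H.memLp_limApprox μ (K + 1)).sub (H.memLp_limApprox μ K)
  have hmean : ∫ e, D K e ∂envLaw σ = 0 := by
    rw [hD]
    simp only
    rw [integral_sub ((H.memLp_limApprox μ (K + 1)).integrable one_le_two)
      ((H.memLp_limApprox μ K).integrable one_le_two), H.integral_limApprox, H.integral_limApprox,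
      sub_zero]
  change ∫ e, D (K + 1) e ^ 2 ∂envLaw σ = kappa σ * ∫ e, D K e ^ 2 ∂envLaw σ
  rw [integral_env (hmem (K + 1)).integrable_sq]
  have h1 : ∀ r : Root b, ∫ ē, D (K + 1) (join (r, ē)) ^ 2
      ∂(Measure.pi fun _ : Fin b => envLaw σ) = ∑ j, r.1 j ^ 2 * ∫ e, D K e ^ 2 ∂envLaw σ := by
    intro r
    have e1 : ∀ ē : Fin b → Env b, D (K + 1) (join (r, ē)) ^ 2 =
        (0 + ∑ j, r.1 j * D K (ē j)) ^ 2 := by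
      intro ē
      simp only [hD, limApprox_join, mul_sub, Finset.sum_sub_distrib]
      ring
    simp_rw [e1]
    rw [integral_sq_add_sum_pi (f := fun j e => r.1 j * D K e)
      (fun j => (hmem K).const_mul (r.1 j)) (fun j => by rw [integral_const_mul, hmean, mul_zero])]
    simp [mul_pow, integral_const_mul]
  simp_rw [h1, ← Finset.sum_mul]
  rw [integral_mul_const, integral_rootLaw_fst fun v => ∑ j, v j ^ 2]
  rfl

/-- Solutions of the fixed point equation that characterizes the limit of the normalized path
length, realized as functions of the environment. -/
structure IsFixedPoint (σ : Measure (Fin b → ℝ)) (X : Env b → ℝ) : Prop where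
  meas : Measurable X
  moments : ∀ k : ℕ, MemLp X k (envLaw σ)
  mean : ∫ e, X e ∂envLaw σ = 0
  fixed : ∀ᵐ p ∂(rootLaw σ).prod (Measure.pi fun _ : Fin b => envLaw σ),
    X (join p) = toll (entropy σ) p.1.1 + ∑ j, p.1.1 j * X (p.2 j)

theorem Setting.integrable_exp_limApprox (H : Setting b s s₀ s₁ σ) (μ θ : ℝ) (K : ℕ) :
    Integrable (fun e => Real.exp (θ * limApprox μ K e)) (envLaw σ) := by
  obtain ⟨M, hM⟩ := exists_toll_bound b μ
  refine Integrable.of_bound (Real.measurable_exp.comp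
    ((measurable_limApprox μ K).const_mul θ)).aestronglyMeasurable (Real.exp (|θ| * (K * M))) ?_
  filter_upwards [ae_env_good H] with e he
  rw [Real.norm_of_nonneg (Real.exp_pos _).le]
  refine Real.exp_le_exp.2 ((le_abs_self _).trans ?_)
  rw [abs_mul]
  exact mul_le_mul_of_nonneg_left (abs_limApprox_le hM K he) (abs_nonneg _)

/-- Uniform sub-Gaussian bounds for the approximations near the origin. -/
theorem Setting.exists_integral_exp_limApprox_le (H : Setting b s s₀ s₁ σ) :
    ∃ c > 0, ∀ K : ℕ, ∀ θ : ℝ, |θ| ≤ 1 / (2 * c) →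
      ∫ e, Real.exp (θ * limApprox (entropy σ) K e) ∂envLaw σ ≤ Real.exp (c * θ ^ 2) := by
  obtain ⟨M₀, hM₀⟩ := exists_toll_bound b (entropy σ)
  set μ := entropy σ with hμ
  set M := max M₀ 1 with hMd
  have hM : ∀ v ∈ stdSimplex ℝ (Fin b), |toll μ v| ≤ M := fun v hv =>
    (hM₀ v hv).trans (le_max_left _ _)
  have hM1 : 1 ≤ M := le_max_right _ _
  have hκ := H.kappa_lt_one
  have hκ0 := kappa_nonneg (σ := σ)
  have hpos : 0 < 1 - kappa σ := by linarith
  -- The induction closes if the exponential of `Y = θ C(V) - c θ² (1 - ∑ V_j²)` has mean at most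
  -- `1`. For `|Y| ≤ 1` it is at most `1 + Y + Y²`. Here `Y² ≤ 4 M² θ²`, while `E Y = -c θ² (1 -
  -- κ)`, so this `c` makes the two cancel. The range `|θ| ≤ 1/(2c)` ensures `|Y| ≤ 1`.
  set c := 4 * M ^ 2 / (1 - kappa σ) with hc
  have hc1 : c * (1 - kappa σ) = 4 * M ^ 2 := by rw [hc]; field_simp
  have hcM : 4 * M ^ 2 ≤ c := by rw [hc, le_div_iff₀ hpos]; nlinarith [sq_nonneg M]
  have hc4 : 4 ≤ c := by nlinarith
  have hc0 : 0 < c := by linarith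
  have key : ∀ θ : ℝ, |θ| ≤ 1 / (2 * c) →
      ∫ v, Real.exp (θ * toll μ v - c * θ ^ 2 * (1 - ∑ j, v j ^ 2)) ∂σ ≤ 1 := by
    intro θ hθ
    have hθc : |θ| * c ≤ 1 / 2 := by
      calc |θ| * c ≤ 1 / (2 * c) * c := mul_le_mul_of_nonneg_right hθ hc0.le
        _ = 1 / 2 := by field_simp
    have hθ0 := abs_nonneg θ
    have hθM : |θ| * M ≤ 1 / 8 := by nlinarith
    have hθ2 : c * θ ^ 2 ≤ 1 / 2 := by
      rw [← sq_abs]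
      have : |θ| ≤ 1 := by nlinarith
      nlinarith
    set Y : (Fin b → ℝ) → ℝ := fun v => θ * toll μ v - c * θ ^ 2 * (1 - ∑ j, v j ^ 2) with hY
    have hYm : Measurable Y := by
      refine ((measurable_toll μ).const_mul θ).sub ?_
      fun_prop
    have hYabs : ∀ v ∈ stdSimplex ℝ (Fin b), |Y v| ≤ 1 ∧ Y v ^ 2 ≤ 4 * M ^ 2 * θ ^ 2 := by
      intro v hv
      have h1 : |θ * toll μ v| ≤ |θ| * M := by
        rw [abs_mul]; exact mul_le_mul_of_nonneg_left (hM v hv) hθ0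
      have hS0 : 0 ≤ ∑ j, v j ^ 2 := Finset.sum_nonneg fun _ _ => sq_nonneg _
      have hS1 := sum_sq_le_one_of_mem_stdSimplex hv
      have h2 : |c * θ ^ 2 * (1 - ∑ j, v j ^ 2)| ≤ c * θ ^ 2 := by
        rw [abs_of_nonneg (mul_nonneg (by positivity) (by linarith))]
        exact mul_le_of_le_one_right (by positivity) (by linarith)
      have h3 : |Y v| ≤ |θ| * M + c * θ ^ 2 := (abs_sub _ _).trans (add_le_add h1 h2)
      refine ⟨by linarith, ?_⟩
      have h4 : c * θ ^ 2 ≤ |θ| * M := by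
        rw [← sq_abs]
        nlinarith
      rw [← sq_abs]
      calc |Y v| ^ 2 ≤ (2 * (|θ| * M)) ^ 2 := pow_le_pow_left₀ (abs_nonneg _) (by linarith) 2
        _ = 4 * M ^ 2 * θ ^ 2 := by rw [mul_pow, mul_pow, sq_abs]; ring
    have hiY : Integrable Y σ := H.integrable_of_le_one hYm fun v hv => (hYabs v hv).1
    have hEY : ∫ v, Y v ∂σ = - (4 * M ^ 2 * θ ^ 2) := by
      have ht : Integrable (toll μ) σ := H.integrable_of_le_one (measurable_toll _) hM
      have hsq : Integrable (fun v : Fin b → ℝ => 1 - ∑ j, v j ^ 2) σ :=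
        (integrable_const _).sub H.integrable_sum_sq
      rw [hY]
      simp only
      rw [integral_sub (ht.const_mul θ) (hsq.const_mul _), integral_const_mul,
        integral_const_mul, H.integral_toll, integral_sub (integrable_const _) H.integrable_sum_sq]
      simp only [integral_const, probReal_univ, one_smul]
      change θ * 0 - c * θ ^ 2 * (1 - kappa σ) = _
      rw [← hc1]; ring
    calc ∫ v, Real.exp (Y v) ∂σ ≤ ∫ v, (1 + 4 * M ^ 2 * θ ^ 2 + Y v) ∂σ := by
          refine integral_mono_of_nonneg (ae_of_all _ fun _ => (Real.exp_pos _).le)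
            ((integrable_const _).add hiY) ?_
          filter_upwards [H.simplex] with v hv
          obtain ⟨h1, h2⟩ := hYabs v hv
          have h3 := Real.norm_exp_sub_one_sub_id_le (x := Y v) h1
          rw [Real.norm_eq_abs, Real.norm_eq_abs, sq_abs] at h3
          have h4 := le_abs_self (Real.exp (Y v) - 1 - Y v)
          linarith
      _ = 1 := by
          rw [integral_add (integrable_const _) hiY, hEY]
          simp
  refine ⟨c, hc0, fun K => ?_⟩
  induction K with
  | zero =>
    intro θ _
    simp only [limApprox, mul_zero, Real.exp_zero, integral_const, probReal_univ, one_smul]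
    exact Real.one_le_exp (by positivity)
  | succ K ih =>
    intro θ hθ
    rw [integral_env (H.integrable_exp_limApprox μ θ (K + 1))]
    have h1 : ∀ r : Root b, ∫ ē, Real.exp (θ * limApprox μ (K + 1) (join (r, ē)))
        ∂(Measure.pi fun _ : Fin b => envLaw σ) = Real.exp (θ * toll μ r.1) *
          ∏ j, ∫ e, Real.exp (θ * r.1 j * limApprox μ K e) ∂envLaw σ := by
      intro r
      rw [← integral_fintype_prod_eq_prod (𝕜 := ℝ)
        (fun j e => Real.exp (θ * r.1 j * limApprox μ K e)), ← integral_const_mul]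
      congr with ē
      rw [limApprox_join, mul_add, Real.exp_add, Finset.mul_sum, Real.exp_sum]
      simp only [mul_assoc]
    -- The parameters `θ V_j` are no larger than `θ`, so the induction hypothesis applies in each
    -- subtree and produces the factor `exp (c θ² ∑ V_j²)`.
    have h2 : ∀ᵐ r ∂rootLaw σ, Real.exp (θ * toll μ r.1) *
          ∏ j, ∫ e, Real.exp (θ * r.1 j * limApprox μ K e) ∂envLaw σ ≤
        Real.exp (c * θ ^ 2) *
          Real.exp (θ * toll μ r.1 - c * θ ^ 2 * (1 - ∑ j, r.1 j ^ 2)) := by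
      filter_upwards [ae_good H.simplex] with r hr
      have h3 : ∏ j, ∫ e, Real.exp (θ * r.1 j * limApprox μ K e) ∂envLaw σ ≤
          ∏ j, Real.exp (c * (θ * r.1 j) ^ 2) := by
        refine Finset.prod_le_prod (fun j _ => integral_nonneg fun _ => (Real.exp_pos _).le)
          fun j _ => ih _ ?_
        rw [abs_mul, abs_of_nonneg (hr.1.1 j)]
        exact (mul_le_of_le_one_right (abs_nonneg _) (le_one_of_mem_stdSimplex hr.1 j)).trans hθ
      refine (mul_le_mul_of_nonneg_left h3 (Real.exp_pos _).le).trans (le_of_eq ?_)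
      rw [← Real.exp_sum, ← Real.exp_add, ← Real.exp_add]
      congr 1
      simp only [mul_pow, ← mul_assoc, ← Finset.mul_sum]
      ring
    have hie : Integrable (fun r : Root b =>
        Real.exp (θ * toll μ r.1 - c * θ ^ 2 * (1 - ∑ j, r.1 j ^ 2))) (rootLaw σ) := by
      have : Integrable (fun v : Fin b → ℝ =>
          Real.exp (θ * toll μ v - c * θ ^ 2 * (1 - ∑ j, v j ^ 2))) σ := by
        refine H.integrable_of_le_one (C := Real.exp (|θ| * M)) ?_ fun v hv => ?_
        · exact Real.measurable_exp.comp (((measurable_toll μ).const_mul θ).sub (by fun_prop))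
        · rw [abs_of_pos (Real.exp_pos _)]
          refine Real.exp_le_exp.2 ?_
          have h4 : θ * toll μ v ≤ |θ| * M := (le_abs_self _).trans (by
            rw [abs_mul]; exact mul_le_mul_of_nonneg_left (hM v hv) (abs_nonneg _))
          have h5 : 0 ≤ c * θ ^ 2 * (1 - ∑ j, v j ^ 2) :=
            mul_nonneg (by positivity) (by linarith [sum_sq_le_one_of_mem_stdSimplex hv])
          linarith
      exact this.comp_fst unifSeqLaw
    simp_rw [h1]
    refine (integral_mono_of_nonneg (ae_of_all _ fun r => mul_nonneg (Real.exp_pos _).le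
      (Finset.prod_nonneg fun j _ => integral_nonneg fun _ => (Real.exp_pos _).le))
      (hie.const_mul _) h2).trans ?_
    rw [integral_const_mul, integral_rootLaw_fst fun v =>
      Real.exp (θ * toll μ v - c * θ ^ 2 * (1 - ∑ j, v j ^ 2))]
    exact mul_le_of_le_one_right (Real.exp_pos _).le (key θ hθ)

end Limit

/-! ### The fixed point, its moments and its variance. -/

section Existence

variable {b s s₀ s₁ : ℕ} {σ : Measure (Fin b → ℝ)} [IsProbabilityMeasure σ]

theorem Setting.summable_integral_limApprox_sub (H : Setting b s s₀ s₁ σ) :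
    Summable fun K : ℕ => ∫ e, ‖limApprox (entropy σ) (K + 1) e - limApprox (entropy σ) K e‖
      ∂envLaw σ := by
  set μ := entropy σ with hμ
  set D : ℕ → Env b → ℝ := fun K e => limApprox μ (K + 1) e - limApprox μ K e with hD
  have hmem : ∀ K, MemLp (D K) 2 (envLaw σ) := fun K =>
    (H.memLp_limApprox μ (K + 1)).sub (H.memLp_limApprox μ K)
  set A := ∫ e, D 0 e ^ 2 ∂envLaw σ with hA
  have hA0 : 0 ≤ A := integral_nonneg fun _ => sq_nonneg _
  have hκ0 := kappa_nonneg (σ := σ)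
  have hsq : ∀ K, ∫ e, D K e ^ 2 ∂envLaw σ = kappa σ ^ K * A := by
    intro K
    induction K with
    | zero => simp [hA]
    | succ K ih =>
      have := H.integral_sq_limApprox_sub K
      change ∫ e, D (K + 1) e ^ 2 ∂envLaw σ = kappa σ * ∫ e, D K e ^ 2 ∂envLaw σ at this
      rw [this, ih]; ring
  have hle : ∀ K, ∫ e, ‖D K e‖ ∂envLaw σ ≤ √(kappa σ) ^ K * √A := by
    intro K
    refine abs_le_of_sq_le_sq' ?_ (by positivity) |>.2
    have h1 := sq_integral_le_integral_sq (m := envLaw σ) ((hmem K).integrable one_le_two).norm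
      (by simpa using (hmem K).integrable_sq)
    refine h1.trans (le_of_eq ?_)
    simp only [Real.norm_eq_abs, sq_abs]
    rw [hsq, mul_pow, ← pow_mul, mul_comm K 2, pow_mul, Real.sq_sqrt hκ0, Real.sq_sqrt hA0]
  refine Summable.of_nonneg_of_le (fun K => integral_nonneg fun _ => norm_nonneg _) hle
    (Summable.mul_right _ (summable_geometric_of_lt_one (Real.sqrt_nonneg _) ?_))
  rw [Real.sqrt_lt' one_pos, one_pow]
  exact H.kappa_lt_one

theorem Setting.exists_isFixedPoint (H : Setting b s s₀ s₁ σ) :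
    ∃ X : Env b → ℝ, IsFixedPoint σ X := by
  set μ := entropy σ with hμ
  set D : ℕ → Env b → ℝ := fun K e => limApprox μ (K + 1) e - limApprox μ K e with hD
  have hDi : ∀ K, Integrable (D K) (envLaw σ) := fun K =>
    ((H.memLp_limApprox μ (K + 1)).integrable one_le_two).sub
      ((H.memLp_limApprox μ K).integrable one_le_two)
  have hsum := H.summable_integral_limApprox_sub
  have htel : ∀ K e, ∑ k ∈ Finset.range K, D k e = limApprox μ K e := by
    intro K e
    rw [Finset.sum_range_sub (fun k => limApprox μ k e)]
    simp [limApprox]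
  have hconv : ∀ᵐ e ∂envLaw σ,
      Tendsto (fun K => limApprox μ K e) atTop (nhds (∑' K, D K e)) := by
    filter_upwards [ae_summable_of_summable_integral_norm hDi hsum] with e he
    have := he.hasSum.tendsto_sum_nat
    simpa only [htel] using this
  obtain ⟨X, hXm, hX⟩ := measurable_limit_of_tendsto_metrizable_ae
    (fun K => (measurable_limApprox (b := b) μ K).aemeasurable)
    (hconv.mono fun e he => ⟨_, he⟩)
  -- Fatou's lemma passes the uniform exponential bounds to the limit. Integrability at some `θ` and
  -- `-θ` then yields all moments.
  have hexp : ∃ θ : ℝ, θ ≠ 0 ∧ Integrable (fun e => Real.exp (θ * X e)) (envLaw σ) ∧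
      Integrable (fun e => Real.exp (-θ * X e)) (envLaw σ) := by
    obtain ⟨c, hc, hcK⟩ := H.exists_integral_exp_limApprox_le
    have hall : ∀ θ : ℝ, |θ| ≤ 1 / (2 * c) →
        Integrable (fun e => Real.exp (θ * X e)) (envLaw σ) := by
      intro θ hθ
      refine ⟨(Real.measurable_exp.comp (hXm.const_mul θ)).aestronglyMeasurable, ?_⟩
      have hm : ∀ K, Measurable fun e : Env b => ‖Real.exp (θ * limApprox μ K e)‖ₑ := fun K =>
        (Real.measurable_exp.comp ((measurable_limApprox μ K).const_mul θ)).enorm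
      have hle : ∫⁻ e, ‖Real.exp (θ * X e)‖ₑ ∂envLaw σ ≤
          liminf (fun K => ∫⁻ e, ‖Real.exp (θ * limApprox μ K e)‖ₑ ∂envLaw σ) atTop := by
        refine le_trans (le_of_eq (lintegral_congr_ae ?_)) (lintegral_liminf_le hm)
        filter_upwards [hX] with e he
        exact ((Real.continuous_exp.tendsto _).comp (he.const_mul θ)).enorm.liminf_eq.symm
      refine lt_of_le_of_lt hle ?_
      · refine lt_of_le_of_lt (liminf_le_of_le (by isBoundedDefault) (a := ENNReal.ofReal
          (Real.exp (c * θ ^ 2))) fun x hx => ?_) ENNReal.ofReal_lt_top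
        obtain ⟨K, hK⟩ := hx.exists
        refine hK.trans ?_
        rw [← ofReal_integral_norm_eq_lintegral_enorm (H.integrable_exp_limApprox μ θ K)]
        refine ENNReal.ofReal_le_ofReal ?_
        simp only [Real.norm_of_nonneg (Real.exp_pos _).le]
        exact hcK K θ hθ
    have hpos : 0 < 1 / (2 * c) := by positivity
    exact ⟨1 / (2 * c), hpos.ne', hall _ (by rw [abs_of_pos hpos]),
      hall _ (by rw [abs_neg, abs_of_pos hpos])⟩
  refine ⟨X, hXm, fun k => ?_, ?_, ?_⟩
  · obtain ⟨θ, hθ, h1, h2⟩ := hexp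
    rcases Nat.eq_zero_or_pos k with rfl | hk
    · simpa using hXm.aestronglyMeasurable
    rw [← integrable_norm_rpow_iff hXm.aestronglyMeasurable (by exact_mod_cast hk.ne')
      (ENNReal.natCast_ne_top k)]
    simpa using integrable_pow_abs_of_integrable_exp_mul hθ h1 h2 k
  · have h1 := hasSum_integral_of_summable_integral_norm hDi hsum
    have h2 : ∀ K, ∫ e, D K e ∂envLaw σ = 0 := fun K => by
      rw [integral_sub ((H.memLp_limApprox μ (K + 1)).integrable one_le_two)
        ((H.memLp_limApprox μ K).integrable one_le_two), H.integral_limApprox,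
        H.integral_limApprox, sub_zero]
    simp only [h2] at h1
    refine Eq.trans ?_ (h1.unique hasSum_zero)
    refine integral_congr_ae ?_
    filter_upwards [hX, hconv] with e h3 h4 using tendsto_nhds_unique h3 h4
  · filter_upwards [measurePreserving_join.quasiMeasurePreserving.ae hX,
      ae_prod_of_ae_env hX] with p h1 h2
    refine tendsto_nhds_unique ((tendsto_add_atTop_iff_nat 1).2 h1) ?_
    simp only [limApprox_join]
    exact tendsto_const_nhds.add (tendsto_finsetSum _ fun j _ => (h2 j).const_mul _)

theorem IsFixedPoint.integrable {X : Env b → ℝ} (hX : IsFixedPoint σ X) :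
    Integrable X (envLaw σ) := by
  have := hX.moments 1
  exact memLp_one_iff_integrable.1 (by simpa using this)

theorem IsFixedPoint.memLp_two {X : Env b → ℝ} (hX : IsFixedPoint σ X) :
    MemLp X 2 (envLaw σ) := by
  have := hX.moments 2
  simpa using this

/-- The limit has positive variance unless the toll function vanishes. -/
theorem IsFixedPoint.integral_sq_pos (H : Setting b s s₀ s₁ σ) {X : Env b → ℝ}
    (hX : IsFixedPoint σ X) (hC : 0 < σ {v | toll (entropy σ) v ≠ 0}) :
    0 < ∫ e, X e ^ 2 ∂envLaw σ := by
  set μ := entropy σ with hμ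
  have h1 : ∀ᵐ r ∂rootLaw σ, ∫ ē, X (join (r, ē)) ^ 2 ∂(Measure.pi fun _ : Fin b => envLaw σ) =
      toll μ r.1 ^ 2 + ∑ j, r.1 j ^ 2 * ∫ e, X e ^ 2 ∂envLaw σ := by
    filter_upwards [Measure.ae_ae_of_ae_prod hX.fixed] with r hr
    have : ∀ᵐ ē ∂(Measure.pi fun _ : Fin b => envLaw σ), X (join (r, ē)) ^ 2 =
        (toll μ r.1 + ∑ j, r.1 j * X (ē j)) ^ 2 := hr.mono fun ē h => by rw [h]
    rw [integral_congr_ae this, integral_sq_add_sum_pi (f := fun j e => r.1 j * X e)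
      (fun j => hX.memLp_two.const_mul (r.1 j))
      (fun j => by rw [integral_const_mul, hX.mean, mul_zero])]
    simp [mul_pow, integral_const_mul]
  have hit : Integrable (fun v : Fin b → ℝ => toll μ v ^ 2) σ := by
    obtain ⟨M, hM⟩ := exists_toll_bound b μ
    exact H.integrable_of_le_one ((measurable_toll _).pow_const 2) (C := M ^ 2) fun v hv => by
      rw [abs_pow]; exact pow_le_pow_left₀ (abs_nonneg _) (hM v hv) 2
  have hpos : 0 < ∫ v, toll μ v ^ 2 ∂σ := by
    rw [integral_pos_iff_support_of_nonneg (fun v => sq_nonneg _) hit]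
    have : Function.support (fun v : Fin b → ℝ => toll μ v ^ 2) = {v | toll μ v ≠ 0} := by
      ext v; simp
    rwa [this]
  -- Orthogonality in the fixed point equation gives `E X² = E C² + κ E X²`, so the variance is at
  -- least the positive mean square of the toll.
  have h2 : ∫ e, X e ^ 2 ∂envLaw σ = ∫ v, toll μ v ^ 2 ∂σ + kappa σ * ∫ e, X e ^ 2 ∂envLaw σ := by
    have := integral_env hX.memLp_two.integrable_sq
    rw [integral_congr_ae h1] at this
    have hit' : Integrable (fun r : Root b => toll μ r.1 ^ 2) (rootLaw σ) :=
      hit.comp_fst unifSeqLaw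
    have hk' : Integrable (fun r : Root b => ∑ j, r.1 j ^ 2) (rootLaw σ) :=
      H.integrable_sum_sq.comp_fst unifSeqLaw
    simp only [← Finset.sum_mul] at this
    rw [integral_add hit' (hk'.mul_const _), integral_mul_const,
      integral_rootLaw_fst fun v => toll μ v ^ 2, integral_rootLaw_fst fun v => ∑ j, v j ^ 2]
      at this
    exact this
  have h3 : 0 ≤ kappa σ * ∫ e, X e ^ 2 ∂envLaw σ :=
    mul_nonneg kappa_nonneg (integral_nonneg fun _ => sq_nonneg _)
  linarith

end Existence

/-! ### Mean square convergence of the normalized path length. -/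

section Convergence

variable {b s s₀ s₁ : ℕ} {σ : Measure (Fin b → ℝ)} [IsProbabilityMeasure σ]

variable (b s s₀ s₁ σ) in
/-- The mean square distance between the centred path length and its limit. -/
def sqDist (X : Env b → ℝ) (n : ℕ) : ℝ :=
  ∫ e, (pathReal b s s₀ s₁ n e - meanPath b s s₀ s₁ σ n - n * X e) ^ 2 ∂envLaw σ

theorem sqDist_nonneg (X : Env b → ℝ) (n : ℕ) : 0 ≤ sqDist b s s₀ s₁ σ X n :=
  integral_nonneg fun _ => sq_nonneg _

theorem sqDist_zero (X : Env b → ℝ) : sqDist b s s₀ s₁ σ X 0 = 0 := by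
  simp [sqDist, pathReal_of_le (Nat.zero_le s), meanPath_of_le (Nat.zero_le s)]

theorem Setting.memLp_centred (H : Setting b s s₀ s₁ σ) {X : Env b → ℝ}
    (hX : IsFixedPoint σ X) (n : ℕ) (c : ℝ) :
    MemLp (fun e => pathReal b s s₀ s₁ n e - meanPath b s s₀ s₁ σ n - c * X e) 2 (envLaw σ) :=
  ((H.memLp_pathReal n).sub (memLp_const _)).sub (hX.memLp_two.const_mul c)

theorem Setting.integral_centred (H : Setting b s s₀ s₁ σ) {X : Env b → ℝ}
    (hX : IsFixedPoint σ X) (n : ℕ) (c : ℝ) :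
    ∫ e, (pathReal b s s₀ s₁ n e - meanPath b s s₀ s₁ σ n - c * X e) ∂envLaw σ = 0 := by
  have h1 : Integrable (fun e => pathReal b s s₀ s₁ n e - meanPath b s s₀ s₁ σ n) (envLaw σ) :=
    (H.integrable_pathReal n).sub (integrable_const _)
  rw [integral_sub h1 (hX.integrable.const_mul c),
    integral_sub (H.integrable_pathReal n) (integrable_const _), integral_const_mul, hX.mean]
  simp [meanPath]

/-- In a subtree the limit appears with weight `n V_j` instead of the true size `N_j`. Young's
inequality changes the weight at the price of a factor `1 + η` and of a term in `(N_j - n V_j)²`. -/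
theorem Setting.integral_sq_centred_le (H : Setting b s s₀ s₁ σ) {X : Env b → ℝ}
    (hX : IsFixedPoint σ X) (n : ℕ) (c : ℝ) {η : ℝ} (hη : 0 < η) :
    ∫ e, (pathReal b s s₀ s₁ n e - meanPath b s s₀ s₁ σ n - c * X e) ^ 2 ∂envLaw σ ≤
      (1 + η) * sqDist b s s₀ s₁ σ X n +
        (1 + 1 / η) * (n - c) ^ 2 * ∫ e, X e ^ 2 ∂envLaw σ := by
  have h1 := (H.memLp_centred hX n n).integrable_sq
  have h2 := hX.memLp_two.integrable_sq
  rw [sqDist, ← integral_const_mul, ← integral_const_mul,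
    ← integral_add (h1.const_mul _) (h2.const_mul _)]
  refine integral_mono (H.memLp_centred hX n c).integrable_sq
    ((h1.const_mul _).add (h2.const_mul _)) fun e => ?_
  simp only
  set A := pathReal b s s₀ s₁ n e - meanPath b s s₀ s₁ σ n - n * X e with hA
  have e1 : pathReal b s s₀ s₁ n e - meanPath b s s₀ s₁ σ n - c * X e = A + (n - c) * X e := by
    rw [hA]; ring
  rw [e1]
  set B := (n - c) * X e with hB
  have e2 : (1 + 1 / η) * (n - c) ^ 2 * X e ^ 2 = (1 + 1 / η) * B ^ 2 := by rw [hB]; ring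
  rw [e2]
  have h3 : 0 ≤ (√η * A - B / √η) ^ 2 := sq_nonneg _
  have hs : √η ^ 2 = η := Real.sq_sqrt hη.le
  have hs0 : √η ≠ 0 := (Real.sqrt_pos.2 hη).ne'
  have h4 : (√η * A - B / √η) ^ 2 = η * A ^ 2 - 2 * A * B + 1 / η * B ^ 2 := by
    rw [sub_sq, mul_pow, div_pow, hs]; field_simp
  nlinarith

/-- Given the root, the distance splits orthogonally into the error of the toll and centred
contributions of the subtrees. All but the first term on the right will be `o(n²)`. -/
theorem Setting.sqDist_le (H : Setting b s s₀ s₁ σ) {X : Env b → ℝ}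
    (hX : IsFixedPoint σ X) {n : ℕ} (hn : s < n) {η : ℝ} (hη : 0 < η) :
    sqDist b s s₀ s₁ σ X n ≤
      ∫ r, ∑ j, (1 + η) * sqDist b s s₀ s₁ σ X (cnt s s₀ s₁ n r j) ∂rootLaw σ +
      (n ^ 2 * ∫ r, (treeToll s s₀ s₁ σ n r - toll (entropy σ) r.1) ^ 2 ∂rootLaw σ +
        (1 + 1 / η) * (∫ e, X e ^ 2 ∂envLaw σ) * (b * (varConst s * n))) := by
  have hn0 : (n : ℝ) ≠ 0 := by exact_mod_cast (by omega : n ≠ 0)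
  set μ := entropy σ with hμ
  set V := ∫ e, X e ^ 2 ∂envLaw σ with hV
  have hV0 : 0 ≤ V := integral_nonneg fun _ => sq_nonneg _
  have h1 : ∀ᵐ r ∂rootLaw σ, ∫ ē, (pathReal b s s₀ s₁ n (join (r, ē)) - meanPath b s s₀ s₁ σ n
      - n * X (join (r, ē))) ^ 2 ∂(Measure.pi fun _ : Fin b => envLaw σ) ≤
      n ^ 2 * (treeToll s s₀ s₁ σ n r - toll μ r.1) ^ 2 +
        (∑ j, (1 + η) * sqDist b s s₀ s₁ σ X (cnt s s₀ s₁ n r j) +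
          (1 + 1 / η) * V * ∑ j, (cnt s s₀ s₁ n r j - n * r.1 j : ℝ) ^ 2) := by
    filter_upwards [Measure.ae_ae_of_ae_prod hX.fixed,
      Measure.ae_ae_of_ae_prod (H.pathReal_join hn)] with r hr1 hr2
    have : ∀ᵐ ē ∂(Measure.pi fun _ : Fin b => envLaw σ),
        (pathReal b s s₀ s₁ n (join (r, ē)) - meanPath b s s₀ s₁ σ n
          - n * X (join (r, ē))) ^ 2 =
        (n * (treeToll s s₀ s₁ σ n r - toll μ r.1) +
          ∑ j, (pathReal b s s₀ s₁ (cnt s s₀ s₁ n r j) (ē j) -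
            meanPath b s s₀ s₁ σ (cnt s s₀ s₁ n r j) - n * r.1 j * X (ē j))) ^ 2 := by
      filter_upwards [hr1, hr2] with ē h1 h2
      rw [h1, h2, treeToll, mul_sub, mul_div_cancel₀ _ hn0]
      simp only [Finset.sum_sub_distrib, mul_assoc, ← Finset.mul_sum]
      ring
    rw [integral_congr_ae this, integral_sq_add_sum_pi
      (f := fun j e => pathReal b s s₀ s₁ (cnt s s₀ s₁ n r j) e -
            meanPath b s s₀ s₁ σ (cnt s s₀ s₁ n r j) - n * r.1 j * X e)
      (fun j => H.memLp_centred hX _ _) (fun j => H.integral_centred hX _ _), mul_pow,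
      Finset.mul_sum, ← Finset.sum_add_distrib]
    gcongr with j _
    refine (H.integral_sq_centred_le hX _ _ hη).trans (le_of_eq ?_)
    ring
  have hi1 : Integrable (fun r : Root b => (treeToll s s₀ s₁ σ n r - toll μ r.1) ^ 2)
      (rootLaw σ) := by
    obtain ⟨M, hM⟩ := exists_toll_bound b μ
    refine MemLp.integrable_sq ((MemLp.sub ?_ ?_ : MemLp (fun r : Root b =>
      treeToll s s₀ s₁ σ n r - toll μ r.1) 2 (rootLaw σ)))
    · unfold treeToll
      set f := meanPath b s s₀ s₁ σ
      refine MemLp.of_bound (measurable_treeToll (σ := σ) n).aestronglyMeasurable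
        ((|(n - s₀ : ℝ)| + ∑ _j : Fin b, ∑ k ∈ Finset.range (n + 1), |f k| + |f n|) / n)
        (ae_of_all _ fun r => ?_)
      rw [Real.norm_eq_abs, abs_div, Nat.abs_cast]
      gcongr
      refine (abs_sub _ _).trans ?_
      gcongr
      refine (abs_add_le _ _).trans ?_
      gcongr
      refine (Finset.abs_sum_le_sum_abs _ _).trans (Finset.sum_le_sum fun j _ => ?_)
      exact H.abs_le_sum_range f n r j
    · refine MemLp.of_bound ((measurable_toll μ).comp measurable_fst).aestronglyMeasurable M ?_
      filter_upwards [ae_good H.simplex] with r hr using hM _ hr.1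
  have hi2 := H.integrable_sum_cnt (fun k => (1 + η) * sqDist b s s₀ s₁ σ X k) n
  have hi3 : Integrable (fun r : Root b => ∑ j, (cnt s s₀ s₁ n r j - n * r.1 j : ℝ) ^ 2)
      (rootLaw σ) := integrable_finsetSum _ fun j _ => H.integrable_sq_cnt_sub n j
  have hi4 : Integrable (fun r : Root b =>
      ∑ j, (1 + η) * sqDist b s s₀ s₁ σ X (cnt s s₀ s₁ n r j) +
          (1 + 1 / η) * V * ∑ j, (cnt s s₀ s₁ n r j - n * r.1 j : ℝ) ^ 2) (rootLaw σ) :=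
    hi2.add (hi3.const_mul _)
  have h2 : ∫ r, ∑ j, (cnt s s₀ s₁ n r j - n * r.1 j : ℝ) ^ 2 ∂rootLaw σ ≤
      b * (varConst s * n) := by
    rw [integral_finsetSum _ fun j _ => H.integrable_sq_cnt_sub n j]
    refine (Finset.sum_le_sum fun j _ => H.integral_sq_cnt_sub_le hn j).trans (le_of_eq ?_)
    simp
  have h3 := integral_env (H.memLp_centred hX n n).integrable_sq
  rw [sqDist, h3]
  refine (integral_mono_of_nonneg (ae_of_all _ fun r => integral_nonneg fun _ => sq_nonneg _)
    ((hi1.const_mul _).add hi4) h1).trans ?_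
  have e5 : ∫ r, (n ^ 2 * (treeToll s s₀ s₁ σ n r - toll μ r.1) ^ 2 +
        (∑ j, (1 + η) * sqDist b s s₀ s₁ σ X (cnt s s₀ s₁ n r j) +
          (1 + 1 / η) * V * ∑ j, (cnt s s₀ s₁ n r j - n * r.1 j : ℝ) ^ 2)) ∂rootLaw σ =
      n ^ 2 * ∫ r, (treeToll s s₀ s₁ σ n r - toll μ r.1) ^ 2 ∂rootLaw σ +
      (∫ r, ∑ j, (1 + η) * sqDist b s s₀ s₁ σ X (cnt s s₀ s₁ n r j) ∂rootLaw σ +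
        (1 + 1 / η) * V * ∫ r, ∑ j, (cnt s s₀ s₁ n r j - n * r.1 j : ℝ) ^ 2 ∂rootLaw σ) := by
    rw [integral_add (hi1.const_mul _) hi4, integral_add hi2 (hi3.const_mul _),
      integral_const_mul, integral_const_mul]
  refine e5.le.trans ?_
  have h6 := mul_le_mul_of_nonneg_left h2 (mul_nonneg (by positivity : 0 ≤ 1 + 1 / η) hV0)
  linarith

/-- A quantitative form of the convexity of `x ↦ x ^ (3 / 2)`. -/
theorem mul_sqrt_le {x y : ℝ} (hx : 0 ≤ x) (hy : 0 < y) :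
    x * √x ≤ y * √y * ((x / y + (x / y) ^ 2) / 2) := by
  have hp : 0 < √y := Real.sqrt_pos.2 hy
  set t := √x / √y with ht
  have ht0 : 0 ≤ t := by positivity
  have e0 : √x = √y * t := by rw [ht]; field_simp
  have e1 : x = y * t ^ 2 := by
    rw [ht, div_pow, Real.sq_sqrt hx, Real.sq_sqrt hy.le]; field_simp
  have e2 : x / y = t ^ 2 := by rw [e1]; field_simp
  rw [e2, e0]
  nth_rewrite 1 [e1]
  have : t ^ 3 ≤ (t ^ 2 + (t ^ 2) ^ 2) / 2 := by
    nlinarith [mul_nonneg (sq_nonneg t) (sq_nonneg (t - 1))]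
  calc y * t ^ 2 * (√y * t) = y * √y * t ^ 3 := by ring
    _ ≤ _ := mul_le_mul_of_nonneg_left this (by positivity)

-- The barrier `ε n² + A n^(3/2)` is a supersolution: its quadratic part contracts by about `κ` and
-- absorbs the toll error. The second part dominates the initial values without affecting the order
-- `n²`. Its exponent has to exceed `1`, for otherwise averaging would not offset the factor `1 +
-- η`.
set_option maxHeartbeats 400000 in
theorem Setting.exists_sqDist_le (H : Setting b s s₀ s₁ σ) {X : Env b → ℝ}
    (hX : IsFixedPoint σ X) {ε : ℝ} (hε : 0 < ε) :
    ∃ A, ∀ n : ℕ, sqDist b s s₀ s₁ σ X n ≤ ε * n ^ 2 + A * (n * √n) := by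
  have hκ := H.kappa_lt_one
  have hκ0 := kappa_nonneg (σ := σ)
  -- Then `κ' = 1 - 4η`, so `(1 + η) κ' + η ≤ 1` serves the quadratic part and `(1 + η)(1 + κ')/2 ≤
  -- 1` the part `n^(3/2)`.
  set η := (1 - kappa σ) / 8 with hη
  have hη0 : 0 < η := by rw [hη]; linarith
  have hη1 : η ≤ 1 / 8 := by rw [hη]; linarith
  set κ' := (1 + kappa σ) / 2 with hκ'
  have hκη : κ' = 1 - 4 * η := by rw [hκ', hη]; ring
  set V := ∫ e, X e ^ 2 ∂envLaw σ with hV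
  set E := sqDist b s s₀ s₁ σ X with hE
  have hρ : Tendsto (fun n : ℕ =>
      ∫ r, (treeToll s s₀ s₁ σ n r - toll (entropy σ) r.1) ^ 2 ∂rootLaw σ +
        (1 + 1 / η) * V * (b * varConst s) / n) atTop (nhds (0 + 0)) :=
    H.tendsto_integral_sq_treeToll_sub.add (tendsto_const_div_atTop_nhds_zero_nat _)
  rw [add_zero] at hρ
  obtain ⟨n₀, hn₀⟩ := eventually_atTop.1 ((hρ.eventually_le_const
    (by positivity : 0 < η * ε)).and ((eventually_gt_atTop s).and
    (H.eventually_integral_sum_sq_cnt_le (by linarith : kappa σ < κ'))))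
  set A := ∑ k ∈ Finset.range (n₀ + 1), E k with hA
  have hA0 : 0 ≤ A := Finset.sum_nonneg fun k _ => sqDist_nonneg X k
  set w : ℕ → ℝ := fun n => ε * n ^ 2 + A * (n * √n) with hw
  refine ⟨A, fun n => ?_⟩
  suffices h : E n - w n ≤ 0 by
    have : E n ≤ w n := by linarith
    exact this
  refine H.max_principle (u := fun n => E n - w n) (θ := fun _ _ _ => 1 + η) (c := 1 + η)
    (n₀ := n₀ + 1) (fun _ _ => measurable_const) (fun _ _ _ => by linarith)
    (fun _ _ _ => le_rfl) (Nat.succ_pos _) (fun n hn => ?_) (fun n hn => ?_) (fun n hn => ?_) n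
  · obtain ⟨-, -, h2⟩ := hn₀ n (by omega)
    have hn0 : (0 : ℝ) < n := by exact_mod_cast (by omega : 0 < n)
    have h3 : (0 : ℝ) < (n : ℝ) ^ 2 := by positivity
    have h4 := mul_le_mul_of_nonneg_left h2 (by linarith : 0 ≤ 1 + η)
    have h5 : (1 + η) * κ' < 1 := by rw [hκη]; nlinarith
    nlinarith
  · rcases Nat.eq_zero_or_pos n with rfl | hn0
    · simp [hw, hE, sqDist_zero]
    · have h1 : E n ≤ A := Finset.single_le_sum (f := fun k => E k)
        (fun k _ => sqDist_nonneg X k) (Finset.mem_range.2 hn)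
      have hn1 : (1 : ℝ) ≤ n := by exact_mod_cast hn0
      have h2 : 1 ≤ √(n : ℝ) := by rw [Real.one_le_sqrt]; exact hn1
      have h3 : A * 1 ≤ A * (n * √n) := mul_le_mul_of_nonneg_left (by nlinarith) hA0
      have h4 : 0 ≤ ε * (n : ℝ) ^ 2 := by positivity
      simp only [hw]
      linarith
  · obtain ⟨h1, hsn, h2⟩ := hn₀ n (by omega)
    have hn0 : (0 : ℝ) < n := by exact_mod_cast (by omega : 0 < n)
    have h3 := H.sqDist_le hX hsn hη0
    have hi1 := H.integrable_sum_cnt (fun k => (1 + η) * E k) n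
    have hi2 := H.integrable_sum_cnt (fun k => (k : ℝ) ^ 2) n
    have hi3 := H.integrable_sum_cnt (fun k => (k : ℝ) * √k) n
    have h4 : ∫ r, ∑ j, (cnt s s₀ s₁ n r j : ℝ) * √(cnt s s₀ s₁ n r j) ∂rootLaw σ ≤
        n * √n * ((1 + κ') / 2) := by
      calc ∫ r, ∑ j, (cnt s s₀ s₁ n r j : ℝ) * √(cnt s s₀ s₁ n r j) ∂rootLaw σ
          ≤ ∫ r, (n * √n / 2 + √n / (2 * n) * ∑ j, (cnt s s₀ s₁ n r j : ℝ) ^ 2) ∂rootLaw σ := by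
            refine integral_mono_ae hi3 ((integrable_const _).add (hi2.const_mul _)) ?_
            filter_upwards [ae_good H.simplex] with r hr
            have hs := H.sum_cnt_real hsn hr
            have hs' : ∑ j, (cnt s s₀ s₁ n r j : ℝ) ≤ n := by
              rw [hs]; linarith [(Nat.cast_nonneg s₀ : (0 : ℝ) ≤ s₀)]
            calc ∑ j, (cnt s s₀ s₁ n r j : ℝ) * √(cnt s s₀ s₁ n r j)
                ≤ ∑ j, n * √n * (((cnt s s₀ s₁ n r j : ℝ) / n
                  + ((cnt s s₀ s₁ n r j : ℝ) / n) ^ 2) / 2) :=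
                  Finset.sum_le_sum fun j _ => mul_sqrt_le (by positivity) hn0
              _ = √n / 2 * ∑ j, (cnt s s₀ s₁ n r j : ℝ)
                  + √n / (2 * n) * ∑ j, (cnt s s₀ s₁ n r j : ℝ) ^ 2 := by
                  rw [Finset.mul_sum, Finset.mul_sum, ← Finset.sum_add_distrib]
                  refine Finset.sum_congr rfl fun j _ => ?_
                  field_simp
              _ ≤ √n / 2 * n + √n / (2 * n) * ∑ j, (cnt s s₀ s₁ n r j : ℝ) ^ 2 := by gcongr
              _ = _ := by ring
        _ = n * √n / 2 + √n / (2 * n) * ∫ r, ∑ j, (cnt s s₀ s₁ n r j : ℝ) ^ 2 ∂rootLaw σ := by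
            rw [integral_add (integrable_const _) (hi2.const_mul _), integral_const_mul]
            simp
        _ ≤ n * √n / 2 + √n / (2 * n) * (κ' * n ^ 2) := by gcongr
        _ = _ := by field_simp
    have h5 : ∫ r, ∑ j, (1 + η) * (E (cnt s s₀ s₁ n r j) - w (cnt s s₀ s₁ n r j)) ∂rootLaw σ =
        ∫ r, ∑ j, (1 + η) * E (cnt s s₀ s₁ n r j) ∂rootLaw σ -
        ((1 + η) * ε * ∫ r, ∑ j, (cnt s s₀ s₁ n r j : ℝ) ^ 2 ∂rootLaw σ +
        (1 + η) * A *
          ∫ r, ∑ j, (cnt s s₀ s₁ n r j : ℝ) * √(cnt s s₀ s₁ n r j) ∂rootLaw σ) := by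
      have hi5 : Integrable (fun r : Root b => (1 + η) * ε *
          ∑ j, (cnt s s₀ s₁ n r j : ℝ) ^ 2 + (1 + η) * A *
          ∑ j, (cnt s s₀ s₁ n r j : ℝ) * √(cnt s s₀ s₁ n r j)) (rootLaw σ) :=
        (hi2.const_mul _).add (hi3.const_mul _)
      rw [← integral_const_mul, ← integral_const_mul,
        ← integral_add (hi2.const_mul _) (hi3.const_mul _), ← integral_sub hi1 hi5]
      congr with r
      simp only [hw, Finset.mul_sum]
      rw [← Finset.sum_add_distrib, ← Finset.sum_sub_distrib]
      exact Finset.sum_congr rfl fun j _ => by ring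
    rw [h5]
    have h6 := mul_le_mul_of_nonneg_left h2 (by positivity : 0 ≤ (1 + η) * ε)
    have h7 := mul_le_mul_of_nonneg_left h4 (by positivity : 0 ≤ (1 + η) * A)
    have h8 := mul_le_mul_of_nonneg_left h1 (by positivity : (0 : ℝ) ≤ n ^ 2)
    have h9 : (n : ℝ) ^ 2 * (∫ r, (treeToll s s₀ s₁ σ n r - toll (entropy σ) r.1) ^ 2 ∂rootLaw σ +
        (1 + 1 / η) * V * (b * varConst s) / n) =
        n ^ 2 * ∫ r, (treeToll s s₀ s₁ σ n r - toll (entropy σ) r.1) ^ 2 ∂rootLaw σ +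
        (1 + 1 / η) * V * (b * (varConst s * n)) := by
      rw [mul_add]; congr 1; field_simp
    rw [h9] at h8
    have h10 : (1 + η) * ε * (κ' * n ^ 2) + n ^ 2 * (η * ε) ≤ ε * n ^ 2 := by
      have : (1 + η) * κ' + η ≤ 1 := by rw [hκη]; nlinarith
      calc (1 + η) * ε * (κ' * n ^ 2) + n ^ 2 * (η * ε) = ε * n ^ 2 * ((1 + η) * κ' + η) := by
            ring
        _ ≤ ε * n ^ 2 := mul_le_of_le_one_right (by positivity) this
    have h11 : (1 + η) * A * (n * √n * ((1 + κ') / 2)) ≤ A * (n * √n) := by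
      have : (1 + η) * ((1 + κ') / 2) ≤ 1 := by rw [hκη]; nlinarith
      calc (1 + η) * A * (n * √n * ((1 + κ') / 2)) =
            A * (n * √n) * ((1 + η) * ((1 + κ') / 2)) := by ring
        _ ≤ A * (n * √n) := mul_le_of_le_one_right (by positivity) this
    simp only [hw]
    linarith

theorem Setting.tendsto_sqDist (H : Setting b s s₀ s₁ σ) {X : Env b → ℝ}
    (hX : IsFixedPoint σ X) :
    Tendsto (fun n : ℕ => sqDist b s s₀ s₁ σ X n / n ^ 2) atTop (nhds 0) := by
  rw [Metric.tendsto_atTop']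
  intro ε hε
  obtain ⟨A, hA⟩ := H.exists_sqDist_le hX (half_pos hε)
  have ht : Tendsto (fun n : ℕ => A / √(n : ℝ)) atTop (nhds 0) :=
    Tendsto.const_div_atTop (Real.tendsto_sqrt_atTop.comp tendsto_natCast_atTop_atTop) _
  obtain ⟨N, hN⟩ := eventually_atTop.1 (ht.eventually_lt_const (half_pos hε))
  refine ⟨N, fun n hn => ?_⟩
  have hn0 : (0 : ℝ) < n := by exact_mod_cast (by omega : 0 < n)
  rw [Real.dist_0_eq_abs, abs_of_nonneg (div_nonneg (sqDist_nonneg X n) (by positivity)),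
    div_lt_iff₀ (by positivity)]
  have h1 := hN n hn.le
  have hs : 0 < √(n : ℝ) := Real.sqrt_pos.2 hn0
  have h2 : A * (n * √n) = A / √(n : ℝ) * n ^ 2 := by
    have : (n : ℝ) = √n * √n := (Real.mul_self_sqrt hn0.le).symm
    field_simp
    rw [Real.sq_sqrt hn0.le]
  have h3 := mul_lt_mul_of_pos_right h1 (by positivity : (0 : ℝ) < n ^ 2)
  have h4 := hA n
  rw [h2] at h4
  linarith

end Convergence

/-! ### The characteristic function near the origin. -/

section CharFun

variable {Ω : Type*} {mΩ : MeasurableSpace Ω} {P : Measure Ω} [IsProbabilityMeasure P]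

theorem charFun_map_apply {X : Ω → ℝ} (hX : Measurable X) (t : ℝ) :
    charFun (P.map X) t = ∫ ω, Complex.exp (t * X ω * Complex.I) ∂P := by
  rw [charFun_apply_real, integral_map hX.aemeasurable (by fun_prop)]

/-- The characteristic function of a centred variable with positive variance has modulus less
than one near the origin, except at the origin. -/
theorem exists_norm_charFun_lt_one {X : Ω → ℝ} (hX : Measurable X) (h0 : ∫ ω, X ω ∂P = 0)
    (hV : 0 < ∫ ω, X ω ^ 2 ∂P) :
    ∃ t₀ : ℝ, 0 < t₀ ∧ ∀ t, 0 < t → t ≤ t₀ → ‖charFun (P.map X) t‖ < 1 := by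
  set V := ∫ ω, X ω ^ 2 ∂P with hVd
  have hs : 0 < √V := Real.sqrt_pos.2 hV
  -- The second order expansion `1 - t²/2 + o(t²)` is applied at unit variance; the scaling is
  -- undone at the end.
  set Y : Ω → ℝ := fun ω => X ω / √V with hY
  have hYm : Measurable Y := hX.div_const _
  have hY0 : ∫ ω, Y ω ∂P = 0 := by rw [hY, integral_div, h0, zero_div]
  have hY1 : ∫ ω, (Y ^ 2) ω ∂P = 1 := by
    simp only [hY, Pi.pow_apply, div_pow]
    rw [integral_div, Real.sq_sqrt hV.le, ← hVd, div_self hV.ne']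
  have htay := taylor_charFun_two hYm.aemeasurable hY0 hY1
  -- Any constant below `1/2` works, so that the remainder does not eat up the term `-t²/2`.
  have hev := (htay.def (by norm_num : (0 : ℝ) < 1 / 4))
  obtain ⟨δ, hδ, hball⟩ := Metric.eventually_nhds_iff.1 hev
  have hYlt : ∀ t, 0 < t → t ≤ min (δ / 2) 1 → ‖charFun (P.map Y) t‖ < 1 := by
    intro t ht htle
    have htδ : t < δ := by linarith [min_le_left (δ / 2) 1]
    have ht1 : t ≤ 1 := htle.trans (min_le_right _ _)
    have h1 := hball (y := t) (by rw [Real.dist_0_eq_abs, abs_of_pos ht]; exact htδ)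
    have h2 : ‖(1 - (t : ℂ) ^ 2 / 2)‖ = 1 - t ^ 2 / 2 := by
      have : (1 - (t : ℂ) ^ 2 / 2) = ((1 - t ^ 2 / 2 : ℝ) : ℂ) := by push_cast; ring
      rw [this, Complex.norm_real, Real.norm_of_nonneg (by nlinarith)]
    have h3 := norm_add_le (charFun (P.map Y) t - (1 - (t : ℂ) ^ 2 / 2)) (1 - (t : ℂ) ^ 2 / 2)
    rw [sub_add_cancel, h2] at h3
    have h4 : ‖t ^ 2‖ = t ^ 2 := Real.norm_of_nonneg (sq_nonneg t)
    rw [h4] at h1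
    nlinarith
  have hscale : ∀ t, charFun (P.map X) t = charFun (P.map Y) (t * √V) := by
    intro t
    rw [charFun_map_apply hX, charFun_map_apply hYm]
    congr with ω
    congr 2
    rw [hY]
    push_cast
    have : (√V : ℂ) ≠ 0 := by exact_mod_cast hs.ne'
    field_simp
  refine ⟨min (δ / 2) 1 / √V, by positivity, fun t ht htle => ?_⟩
  rw [hscale]
  exact hYlt _ (by positivity) ((le_div_iff₀ hs).1 htle)

end CharFun

/-! ### Assembly: density of the limit and convergence in distribution. -/

section Density

variable {b s s₀ s₁ : ℕ} {σ : Measure (Fin b → ℝ)} [IsProbabilityMeasure σ]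

/-- Given the root, the subtrees are independent and the characteristic function factorizes; the
toll contributes a phase of modulus one. -/
theorem IsFixedPoint.norm_charFun_le {X : Env b → ℝ} (hX : IsFixedPoint σ X) (t : ℝ) :
    ‖charFun ((envLaw σ).map X) t‖ ≤
      ∫ v, ∏ j, ‖charFun ((envLaw σ).map X) (t * v j)‖ ∂σ := by
  set φ := charFun ((envLaw σ).map X) with hφ
  have hm : Measurable fun e : Env b => Complex.exp (t * X e * Complex.I) := by
    have := hX.meas
    fun_prop
  have hInt : Integrable (fun e : Env b => Complex.exp (t * X e * Complex.I)) (envLaw σ) := by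
    refine Integrable.of_bound hm.aestronglyMeasurable 1 (ae_of_all _ fun e => ?_)
    have : (t * X e * Complex.I : ℂ) = ((t * X e : ℝ) : ℂ) * Complex.I := by push_cast; ring
    rw [this, Complex.norm_exp_ofReal_mul_I]
  have hj : Integrable (fun p => Complex.exp (t * X (join p) * Complex.I))
      ((rootLaw σ).prod (Measure.pi fun _ : Fin b => envLaw σ)) :=
    measurePreserving_join.integrable_comp_of_integrable hInt
  have e1 : φ t = ∫ r, ∫ ē, Complex.exp (t * X (join (r, ē)) * Complex.I)
      ∂(Measure.pi fun _ : Fin b => envLaw σ) ∂rootLaw σ := by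
    rw [← integral_prod _ hj, hφ, charFun_map_apply hX.meas]
    have := map_join (σ := σ)
    nth_rewrite 1 [← this]
    exact integral_map measurable_join.aemeasurable (by rw [this]; exact hInt.1)
  have e2 : ∀ᵐ r ∂rootLaw σ, ∫ ē, Complex.exp (t * X (join (r, ē)) * Complex.I)
      ∂(Measure.pi fun _ : Fin b => envLaw σ) =
      Complex.exp ((t * toll (entropy σ) r.1 : ℝ) * Complex.I) * ∏ j, φ (t * r.1 j) := by
    filter_upwards [Measure.ae_ae_of_ae_prod hX.fixed] with r hr
    have : ∀ᵐ ē ∂(Measure.pi fun _ : Fin b => envLaw σ),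
        Complex.exp (t * X (join (r, ē)) * Complex.I) =
          Complex.exp ((t * toll (entropy σ) r.1 : ℝ) * Complex.I) *
            ∏ j, Complex.exp ((t * r.1 j : ℝ) * X (ē j) * Complex.I) := by
      filter_upwards [hr] with ē h
      rw [h, ← Complex.exp_sum, ← Complex.exp_add]
      congr 1
      push_cast
      rw [mul_add, add_mul, Finset.mul_sum, Finset.sum_mul]
      simp only [mul_assoc]
    rw [integral_congr_ae this, integral_const_mul, integral_fintype_prod_eq_prod (𝕜 := ℂ)
      (fun j e => Complex.exp ((t * r.1 j : ℝ) * X e * Complex.I))]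
    simp only [hφ, charFun_map_apply hX.meas]
  rw [e1, integral_congr_ae e2]
  refine (norm_integral_le_integral_norm _).trans (le_of_eq ?_)
  rw [← integral_rootLaw_fst fun v => ∏ j, ‖φ (t * v j)‖]
  congr with r
  rw [norm_mul, Complex.norm_exp_ofReal_mul_I, one_mul, norm_prod]

/-- The limit of the normalized path length admits a Schwartz density. -/
theorem IsFixedPoint.exists_schwartz_density (H : Setting b s s₀ s₁ σ) {X : Env b → ℝ}
    (hX : IsFixedPoint σ X) {lam ν : ℝ} (hlam : 0 < lam) (hν : 0 < ν)
    (htail : ∀ x : ℝ, 0 ≤ x → σ.real {v | 1 - x ≤ ⨆ j, v j} ≤ lam * x ^ ν)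
    (hC : 0 < σ {v | toll (entropy σ) v ≠ 0}) :
    ∃ f : SchwartzMap ℝ ℝ, (∀ x, 0 ≤ f x) ∧
      (envLaw σ).map X = (volume : Measure ℝ).withDensity fun x => ENNReal.ofReal (f x) := by
  have hprob : IsProbabilityMeasure ((envLaw σ).map X) :=
    Measure.isProbabilityMeasure_map hX.meas.aemeasurable
  obtain ⟨t₀, ht₀, hlt⟩ := exists_norm_charFun_lt_one hX.meas hX.mean (hX.integral_sq_pos H hC)
  refine SplitTree.exists_schwartz_density (fun k => ?_) fun k => ?_
  · rw [memLp_map_measure_iff aestronglyMeasurable_id hX.meas.aemeasurable]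
    exact hX.moments k
  · exact rapid_decay_of_split H.two_le H.simplex hlam hν htail
      (φ := fun t => ‖charFun ((envLaw σ).map X) t‖) continuous_charFun.norm
      (fun t => norm_nonneg _) (fun t => norm_charFun_le_one t)
      (fun t => by simp only [charFun_neg, RCLike.norm_conj]) hX.norm_charFun_le ht₀ hlt k

/-- Trees and limit share one environment, so the `L²` estimate gives convergence in `L¹`, hence in
measure, hence in distribution. -/
theorem Setting.tendstoInDistribution_normalizedPathLength (H : Setting b s s₀ s₁ σ)
    {X : Env b → ℝ} (hX : IsFixedPoint σ X) :
    TendstoInDistribution (normalizedPathLength b s s₀ s₁ σ) atTop X (fun _ => envLaw σ)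
      (envLaw σ) := by
  have hdef : ∀ n e, normalizedPathLength b s s₀ s₁ σ n e =
      (pathReal b s s₀ s₁ n e - meanPath b s s₀ s₁ σ n) / n := fun n e => rfl
  have hmeas : ∀ n, Measurable (normalizedPathLength b s s₀ s₁ σ n) := fun n =>
    ((measurable_pathReal n).sub_const _).div_const _
  refine TendstoInMeasure.tendstoInDistribution (tendstoInMeasure_of_tendsto_eLpNorm
    (p := 1) one_ne_zero (fun n => (hmeas n).aestronglyMeasurable)
    hX.meas.aestronglyMeasurable ?_) fun n => (hmeas n).aemeasurable
  have hlim : Tendsto (fun n : ℕ => ENNReal.ofReal √(sqDist b s s₀ s₁ σ X n / n ^ 2)) atTop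
      (nhds 0) := by
    have := ENNReal.tendsto_ofReal ((Real.continuous_sqrt.tendsto _).comp (H.tendsto_sqDist hX))
    simpa using this
  refine tendsto_of_tendsto_of_tendsto_of_le_of_le' tendsto_const_nhds hlim
    (Eventually.of_forall fun n => zero_le) ?_
  filter_upwards [eventually_gt_atTop 0] with n hn
  have hn0 : (0 : ℝ) < n := by exact_mod_cast hn
  have hmem := (H.memLp_centred hX n n).const_mul (1 / (n : ℝ))
  have e1 : normalizedPathLength b s s₀ s₁ σ n - X = fun e => 1 / (n : ℝ) *
      (pathReal b s s₀ s₁ n e - meanPath b s s₀ s₁ σ n - n * X e) := by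
    ext e
    rw [Pi.sub_apply, hdef]
    field_simp
  rw [e1, eLpNorm_one_eq_lintegral_enorm,
    ← ofReal_integral_norm_eq_lintegral_enorm (hmem.integrable one_le_two)]
  refine ENNReal.ofReal_le_ofReal (Real.le_sqrt_of_sq_le ?_)
  refine (sq_integral_le_integral_sq (hmem.integrable one_le_two).norm
    (by simpa only [Real.norm_eq_abs, sq_abs] using hmem.integrable_sq)).trans (le_of_eq ?_)
  simp only [Real.norm_eq_abs, sq_abs, mul_pow]
  rw [integral_const_mul, sqDist]
  ring

end Density

end SplitTree

end

theorem mainTheorem8 (b s s₀ s₁ : ℕ) (hb : 2 ≤ b) (hs : 1 ≤ s) (hs₀ : s₀ ≤ s)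
    (hs₁ : b * s₁ + s₀ ≤ s + 1)
    (σ : Measure (Fin b → ℝ)) [IsProbabilityMeasure σ]
    (hsimplex : ∀ᵐ v ∂σ, v ∈ stdSimplex ℝ (Fin b))
    (lam ν : ℝ) (hlam : 0 < lam) (hν : 0 < ν)
    (htail : ∀ x : ℝ, 0 ≤ x → σ.real {v | 1 - x ≤ ⨆ j, v j} ≤ lam * x ^ ν)
    (hC : 0 < σ {v | SplitTree.toll (SplitTree.entropy σ) v ≠ 0}) :
    -- the path lengths are integrable
    (∀ n : ℕ, ∫⁻ e, SplitTree.pathLength b s s₀ s₁ n e ∂SplitTree.envLaw σ < ⊤) ∧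
    -- the normalized path lengths converge in distribution
    (∃ ρ : ProbabilityMeasure ℝ,
      TendstoInDistribution (SplitTree.normalizedPathLength b s s₀ s₁ σ) atTop
        (id : ℝ → ℝ) (fun _ => SplitTree.envLaw σ) (ρ : Measure ℝ)) ∧
    -- the limit admits a Schwartz density
    (∀ (Ω : Type*) [MeasurableSpace Ω] (P : Measure Ω) [IsProbabilityMeasure P] (X : Ω → ℝ),
      TendstoInDistribution (SplitTree.normalizedPathLength b s s₀ s₁ σ) atTop
        X (fun _ => SplitTree.envLaw σ) P →
      SplitTree.AdmitsSchwartzDensity P X) := by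
  have H : SplitTree.Setting b s s₀ s₁ σ :=
    -- Convergence needs only this consequence of the tail bound, its case `x = 0`; the full bound
    -- is used for the density alone.
    ⟨hb, hs, hs₀, hs₁, hsimplex, SplitTree.ae_iSup_lt_one hν htail⟩
  obtain ⟨Z, hZ⟩ := H.exists_isFixedPoint
  have hconv := H.tendstoInDistribution_normalizedPathLength hZ
  refine ⟨H.lintegral_pathLength_lt_top, ?_, fun Ω _ P _ X hX => ?_⟩
  · let ρ : ProbabilityMeasure ℝ :=
      ⟨(SplitTree.envLaw σ).map Z, Measure.isProbabilityMeasure_map hZ.meas.aemeasurable⟩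
    refine ⟨ρ, hconv.forall_aemeasurable, aemeasurable_id, ?_⟩
    convert hconv.tendsto using 3
    exact congrArg nhds (Subtype.ext (Measure.map_id (μ := (ρ : Measure ℝ))))
  · obtain ⟨f, hf0, hf⟩ := hZ.exists_schwartz_density H hlam hν htail hC
    refine ⟨f, hf0, ?_⟩
    -- Limits in distribution have a unique law, so the density of the constructed fixed point is
    -- that of any limit variable.
    rw [tendstoInDistribution_unique _ hX hconv, hf]
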